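/- Let $\alpha=(\alpha_1,\dots,\alpha_n)$ be positive real numbers which are generic, i.e. $\sum_{i\in T}\alpha_i\neq\sum_{j\notin T}\alpha_j$ for every $T\subseteq\{1,\dots,n\}$. Let $S\subseteq\{1,\dots,n\}$ satisfy $|S|\ge 2$ and be short, i.e. $\sum_{i\in S}\alpha_i<\sum_{j\notin S}\alpha_j$. Consider pairs $(p,q)$, where $p=(p_1,\dots,p_n)$ is a tuple of row vectors in $\mathbb C^2$ and $q=(q_1,\dots,q_n)$ is a tuple of column vectors in $\mathbb C^2$. The group $SL(2,\mathbb C)\times(\mathbb C^\times)^n$ acts on the right by $(p,q)\cdot(\Theta,e)=\big((e_i^{-1}p_i\Theta)_i,(\Theta^{-1}q_ie_i)_i\big)$. Let $\mathfrak M(\alpha)$ be the hyperpolygon space, that is, the topological quotient by $SU(2)\times U(1)^n$ of the set of all $(p,q)$ with $$\sum_{i=1}^n(q_iq_i^*-p_i^*p_i)_0=0,\qquad \tfrac12\big(|q_i|^2-|p_i|^2\big)=\alpha_i\ (1\le i\le n),\qquad \sum_{i=1}^n(q_ip_i)_0=0,\qquad p_iq_i=0\ (1\le i\le n),$$ where $A_0=A-\tfrac12(\operatorname{tr}A)\,I$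 denotes the traceless part. The group $\mathbb C^\times$ acts on $\mathfrak M(\alpha)$ as follows: $\tau\cdot[p,q]$ is the class of a point $(p',q')$ of this set which lies in the $SL(2,\mathbb C)\times(\mathbb C^\times)^n$-orbit of $(\tau p,q)$. Let $\mathfrak M_S\subseteq\mathfrak M(\alpha)$ be the set of classes $[p,q]$ such that $q_i$ and $q_j$ are proportional whenever $i,j\in S$ and whenever $i,j\notin S$, and $p_j=0$ for all $j\notin S$ (it is a component of the fixed point set of $\mathbb C^\times$). Let the core component $U_S$ be the closure in $\mathfrak M(\alpha)$ of the set of points $m$ for which $\lim_{\tau\to\infty}\tau\cdot m$ exists and lies in $\mathfrak M_S$. Then $U_S$ is homeomorphic to the moduli space, taken up to simultaneous rotation by $SO(3)$ and with the quotient topology, of $n+1$ vectors $u_i$ $(i\in S)$, $v_j$ $(j\notin S)$ and $w$ in $\mathbb R^3$ satisfying: 1. $w+\sum_{j\notin S}v_j=0$; 2. $\sum_{i\in S}u_i=0$; 3. $u_i\cdot w=0$ for all $i\in S$; 4. $\|v_j\|=\alpha_j$ for all $j\notin S$; 5. $\|w\|=\sum_{i\in S}\sqrt{\alpha_i^2+\|u_i\|^2}$.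 -/

import Mathlib

namespace Hyperpolygon

open scoped Matrix
open Filter Topology

noncomputable section

/-! ### Representations, group actions and moment maps -/

/-- The cotangent bundle of the representation space `ℂ²ⁿ`: pairs `(p, q)` of an `n`-tuple of row
vectors `p i` and an `n`-tuple of column vectors `q i`, all of length two. -/
abbrev CotRep (n : ℕ) : Type := (Fin n → Fin 2 → ℂ) × (Fin n → Fin 2 → ℂ)

/-- The complex group `SL(2, ℂ) × (ℂˣ)ⁿ`.  Dividing it by the diagonal sign `±1`, which acts
trivially, does not change any orbit. -/
abbrev ComplexGroup (n : ℕ) : Type :=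
  Matrix.SpecialLinearGroup (Fin 2) ℂ × (Fin n → ℂˣ)

variable {n : ℕ}

/-- The right action
`(p, q) [Θ; e₁, …, eₙ] = (e₁⁻¹ p₁ Θ, …, eₙ⁻¹ pₙ Θ; Θ⁻¹ q₁ e₁, …, Θ⁻¹ qₙ eₙ)`. -/
def act (x : CotRep n) (g : ComplexGroup n) : CotRep n :=
  (fun i => ((g.2 i : ℂ))⁻¹ • (x.1 i ᵥ* (g.1 : Matrix (Fin 2) (Fin 2) ℂ)),
   fun i => (g.2 i : ℂ) • (((g.1⁻¹ : Matrix.SpecialLinearGroup (Fin 2) ℂ) :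
      Matrix (Fin 2) (Fin 2) ℂ) *ᵥ x.2 i))

/-- The compact form `SU(2) × U(1)ⁿ` of the complex group. -/
def compactForm (n : ℕ) : Subgroup (ComplexGroup n) where
  carrier := {g | (g.1 : Matrix (Fin 2) (Fin 2) ℂ) ∈ Matrix.unitaryGroup (Fin 2) ℂ ∧
    ∀ i, ‖(g.2 i : ℂ)‖ = 1}
  one_mem' := by
    refine ⟨?_, fun i => ?_⟩
    · simp
    · simp
  mul_mem' := by
    rintro a b ⟨ha, ha'⟩ ⟨hb, hb'⟩
    refine ⟨?_, fun i => ?_⟩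
    · simpa using mul_mem ha hb
    · simp [ha' i, hb' i]
  inv_mem' := by
    rintro a ⟨ha, ha'⟩
    refine ⟨?_, fun i => ?_⟩
    · have h1 : star (a.1 : Matrix (Fin 2) (Fin 2) ℂ) * a.1 = 1 :=
        (Matrix.mem_unitaryGroup_iff').1 ha
      have h2 : (a.1 : Matrix (Fin 2) (Fin 2) ℂ) * ((a.1⁻¹ : Matrix.SpecialLinearGroup (Fin 2) ℂ) :
          Matrix (Fin 2) (Fin 2) ℂ) = 1 := by
        rw [← Matrix.SpecialLinearGroup.coe_mul, mul_inv_cancel, Matrix.SpecialLinearGroup.coe_one]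
      have h3 : star (a.1 : Matrix (Fin 2) (Fin 2) ℂ) =
          ((a.1⁻¹ : Matrix.SpecialLinearGroup (Fin 2) ℂ) : Matrix (Fin 2) (Fin 2) ℂ) :=
        left_inv_eq_right_inv h1 h2
      have h4 : star (a.1 : Matrix (Fin 2) (Fin 2) ℂ) ∈ Matrix.unitaryGroup (Fin 2) ℂ :=
        Unitary.star_mem ha
      rw [h3] at h4
      simpa using h4
    · simp [ha' i]

theorem act_one (x : CotRep n) : act x 1 = x := by
  simp [act]

theorem act_mul (x : CotRep n) (g h : ComplexGroup n) : act x (g * h) = act (act x g) h := by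
  refine Prod.ext (funext fun i => ?_) (funext fun i => ?_)
  · simp only [act, Prod.fst_mul, Prod.snd_mul, Pi.mul_apply, Units.val_mul,
      Matrix.SpecialLinearGroup.coe_mul, Matrix.smul_vecMul, Matrix.vecMul_vecMul, smul_smul]
    rw [mul_inv, mul_comm]
  · simp only [act, Prod.fst_mul, Prod.snd_mul, Pi.mul_apply, Units.val_mul, mul_inv_rev,
      Matrix.SpecialLinearGroup.coe_mul, Matrix.mulVec_smul, Matrix.mulVec_mulVec, smul_smul]
    rw [mul_comm]

/-- The traceless part `A - (tr A / 2) 1` of a `2 × 2` matrix. -/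
def traceless (A : Matrix (Fin 2) (Fin 2) ℂ) : Matrix (Fin 2) (Fin 2) ℂ :=
  A - (A.trace / 2) • (1 : Matrix (Fin 2) (Fin 2) ℂ)

/-- The square `|v|²` of the standard hermitian norm on `ℂ²`. -/
def normSq2 (v : Fin 2 → ℂ) : ℝ := ∑ k, ‖v k‖ ^ 2

/-- The real moment map
`(√-1/2) ∑ (qᵢ qᵢ* - pᵢ* pᵢ)₀ ⊕ (½ (|qᵢ|² - |pᵢ|²))ᵢ`. -/
def realMoment (x : CotRep n) : Matrix (Fin 2) (Fin 2) ℂ × (Fin n → ℝ) :=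
  ((Complex.I / 2) • ∑ i, traceless
      (Matrix.vecMulVec (x.2 i) (star (x.2 i)) - Matrix.vecMulVec (star (x.1 i)) (x.1 i)),
   fun i => (1 / 2) * (normSq2 (x.2 i) - normSq2 (x.1 i)))

/-- The complex moment map `- ∑ (qᵢ pᵢ)₀ ⊕ (√-1 pᵢ qᵢ)ᵢ`. -/
def complexMoment (x : CotRep n) : Matrix (Fin 2) (Fin 2) ℂ × (Fin n → ℂ) :=
  (- ∑ i, traceless (Matrix.vecMulVec (x.2 i) (x.1 i)),
   fun i => Complex.I * (x.1 i ⬝ᵥ x.2 i))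

/-! ### Hyperpolygon spaces -/

/-- `α` is generic: no subset of the index set has the same total weight as its complement. -/
def Generic (α : Fin n → ℝ) : Prop :=
  ∀ T : Finset (Fin n), ∑ i ∈ T, α i ≠ ∑ j ∈ Tᶜ, α j

/-- `S` is short: its total weight is smaller than that of its complement. -/
def Short (α : Fin n → ℝ) (S : Finset (Fin n)) : Prop :=
  ∑ i ∈ S, α i < ∑ j ∈ Sᶜ, α j

/-- The common level set `μ_ℝ⁻¹(0 ⊕ α) ∩ μ_ℂ⁻¹(0)`. -/
def levelSet (α : Fin n → ℝ) : Set (CotRep n) :=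
  {x | realMoment x = (0, α) ∧ complexMoment x = 0}

/-- Two points of the level set are equivalent if they lie in one orbit of `SU(2) × U(1)ⁿ`. -/
def orbitSetoid (α : Fin n → ℝ) : Setoid (levelSet α) where
  r x y := ∃ g ∈ compactForm n, act (x : CotRep n) g = y
  iseqv :=
    { refl := fun x => ⟨1, one_mem _, act_one _⟩
      symm := by
        rintro x y ⟨g, hg, h⟩
        exact ⟨g⁻¹, inv_mem hg, by rw [← h, ← act_mul, mul_inv_cancel, act_one]⟩
      trans := by
        rintro x y z ⟨g, hg, h⟩ ⟨k, hk, h'⟩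
        exact ⟨g * k, mul_mem hg hk, by rw [act_mul, h, h']⟩ }

/-- The hyperpolygon space `𝔐(α) = (μ_ℝ⁻¹(α) ∩ μ_ℂ⁻¹(0)) / G`, with the quotient topology. -/
abbrev Space (α : Fin n → ℝ) : Type := Quotient (orbitSetoid α)

/-- The class `[p, q]_ℝ` of a point of the level set. -/
def toSpace (α : Fin n → ℝ) (x : levelSet α) : Space α := Quotient.mk (orbitSetoid α) x

/-- `S` is straight in `(p, q)`: the vectors `q i`, `i ∈ S`, are pairwise proportional. -/
def Straight (x : CotRep n) (S : Finset (Fin n)) : Prop :=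
  ∀ i ∈ S, ∀ j ∈ S, ∃ c : ℂ, x.2 i = c • x.2 j

/-! ### The `ℂˣ`-action and the core components -/

/-- Scalar multiplication on the cotangent fibres, `τ · (p, q) = (τ p, q)`. -/
def scale (τ : ℂˣ) (x : CotRep n) : CotRep n := ((τ : ℂ) • x.1, x.2)

/-- `m' = τ · m` for the action of `ℂˣ` on the hyperpolygon space that is induced by scalar
multiplication on the fibres.  Under the identification of `𝔐` with the quotient of the stable
points of `μ_ℂ⁻¹(0)` by the complex group, `τ · [p, q]` is the class of `(τ p, q)`; thus it is
represented by the points of the level set that lie in the complex orbit of `(τ p, q)`. -/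
def IsScaling (α : Fin n → ℝ) (τ : ℂˣ) (m m' : Space α) : Prop :=
  ∃ x y : levelSet α, toSpace α x = m ∧ toSpace α y = m' ∧
    ∃ g : ComplexGroup n, act (scale τ (x : CotRep n)) g = y

/-- The component `𝔐_S` of the fixed point set of `ℂˣ`: the classes `[p, q]` for which `S` and its
complement are each straight, and `p j = 0` for all `j ∉ S`. -/
def fixedComponent (α : Fin n → ℝ) (S : Finset (Fin n)) : Set (Space α) :=
  {m | ∃ x : levelSet α, toSpace α x = m ∧ Straight (x : CotRep n) S ∧
    Straight (x : CotRep n) Sᶜ ∧ ∀ j ∉ S, (x : CotRep n).1 j = 0}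

/-- The points `m` of the hyperpolygon space for which the limit of `τ · m` as `τ → ∞` in `ℂˣ`
exists and lies in `F`. -/
def flowsUpTo (α : Fin n → ℝ) (F : Set (Space α)) : Set (Space α) :=
  {m | ∃ f : ℂˣ → Space α, (∀ τ, IsScaling α τ m (f τ)) ∧
    ∃ m' ∈ F, Tendsto f (comap (fun τ : ℂˣ => ‖(τ : ℂ)‖) atTop) (𝓝 m')}

/-- The core component `U_S`: the closure of the set of points that flow up to `𝔐_S`. -/
def coreComponent (α : Fin n → ℝ) (S : Finset (Fin n)) : Set (Space α) :=
  closure (flowsUpTo α (fixedComponent α S))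

/-! ### The moduli space of pairs of polygons -/

/-- Euclidean three-space. -/
abbrev E3 : Type := EuclideanSpace ℝ (Fin 3)

/-- Tuples `((u i)_{i ∈ S}, (v j)_{j ∉ S}, w)` of vectors of `ℝ³`. -/
abbrev VectorTuple (S : Finset (Fin n)) : Type :=
  ({i // i ∈ S} → E3) × ({j // j ∉ S} → E3) × E3

/-- The five conditions on `((u i)_{i ∈ S}, (v j)_{j ∉ S}, w)`. -/
structure IsPolygonPair (α : Fin n → ℝ) (S : Finset (Fin n)) (z : VectorTuple S) : Prop where
  sum_v : z.2.2 + ∑ j, z.2.1 j = 0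
  sum_u : ∑ i, z.1 i = 0
  perp : ∀ i, inner ℝ (z.1 i) z.2.2 = 0
  norm_v : ∀ j, ‖z.2.1 j‖ = α j
  norm_w : ‖z.2.2‖ = ∑ i : {i // i ∈ S}, Real.sqrt (α i ^ 2 + ‖z.1 i‖ ^ 2)

/-- Two tuples are equivalent if a rotation of `ℝ³` (a linear isometry of determinant one) takes
all vectors of the first to the corresponding vectors of the second. -/
def rotationSetoid (α : Fin n → ℝ) (S : Finset (Fin n)) :
    Setoid {z : VectorTuple S // IsPolygonPair α S z} where
  r z z' := ∃ R : E3 ≃ₗᵢ[ℝ] E3, LinearEquiv.det R.toLinearEquiv = 1 ∧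
    (∀ i, R (z.1.1 i) = z'.1.1 i) ∧ (∀ j, R (z.1.2.1 j) = z'.1.2.1 j) ∧ R z.1.2.2 = z'.1.2.2
  iseqv :=
    { refl := fun z => ⟨LinearIsometryEquiv.refl ℝ E3, LinearEquiv.det_refl, by simp, by simp,
        by simp⟩
      symm := by
        rintro z z' ⟨R, hR, hu, hv, hw⟩
        refine ⟨R.symm, ?_, fun i => ?_, fun j => ?_, ?_⟩
        · have h : LinearEquiv.det R.toLinearEquiv.symm = 1 := by
            rw [LinearEquiv.det_symm, map_inv, hR, inv_one]
          exact h
        · rw [← hu i, R.symm_apply_apply]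
        · rw [← hv j, R.symm_apply_apply]
        · rw [← hw, R.symm_apply_apply]
      trans := by
        rintro z z' z'' ⟨R, hR, hu, hv, hw⟩ ⟨R', hR', hu', hv', hw'⟩
        refine ⟨R.trans R', ?_, fun i => ?_, fun j => ?_, ?_⟩
        · have h : LinearEquiv.det (R.toLinearEquiv.trans R'.toLinearEquiv) = 1 := by
            rw [LinearEquiv.det_trans, hR, hR', mul_one]
          exact h
        · rw [LinearIsometryEquiv.trans_apply, hu i, hu' i]
        · rw [LinearIsometryEquiv.trans_apply, hv j, hv' j]
        · rw [LinearIsometryEquiv.trans_apply, hw, hw'] }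

/-- The moduli space of the tuples satisfying the five conditions, taken up to rotation, with the
quotient topology. -/
abbrev PolygonModuli (α : Fin n → ℝ) (S : Finset (Fin n)) : Type :=
  Quotient (rotationSetoid α S)

end

end Hyperpolygon

/-!
# Core components of hyperpolygon spaces and pairs of polygons

A class `[p, q]` in which `S` is straight and `p j = 0` for `j ∉ S` has a standard representative:
`SU(2) × U(1)ⁿ` moves `q i`, `i ∈ S`, to a positive multiple of the first basis vector, and then
`p i` is a multiple of the second one.  The standard points form a compact set `stdSet`.  Such a
point is a pair of polygons: the products `q i p i` are complex numbers, that is, horizontal vectors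
`u i`; the Hopf map takes `q j` to a vector `v j` of length `α j`; and `w` is the vertical vector
that closes the polygon of the `v j`.  The complex moment map says that the `u i` sum to zero, the
real moment map that `w` closes the polygon and has length `∑ √(αᵢ² + ‖uᵢ‖²)`.  Two standard points
have the same class exactly if their polygons differ by a rotation about the vertical axis
(`stdClass_eq_iff`, `polygonClass_eq_iff`).  Hence the set of classes of standard points and the
moduli space of polygon pairs, both Hausdorff, are quotients of the compact space `stdSet` by the
same relation, and they are homeomorphic (`exists_homeomorph_range`).

It remains to see that the core component is the set of classes of standard points
(`coreComponent_eq_range`).  This set is compact, hence closed.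

* It contains every point that flows up to the fixed component (`flowsUpTo_subset`).  For `i ∈ S`
  with `p i ≠ 0` at the limit, `(p i q k) [q i, q j] / [q k, q j]` and `(p j q i) (p i q j)`, for
  `k ∈ S` and `j ∉ S`, are invariant under the complex group and are multiplied by `τ` and `τ²`
  under the flow; as they have finite limits, they vanish, which makes `S` straight and `p j` zero.
* If some `p i` is nonzero and no `q j`, `j ∉ S`, is proportional to the `q i`, the standard point
  flows up to the fixed component (`stdClass_mem_flowsUpTo`).  In the affine coordinates of the
  `q j` the flow is multiplication by `τ⁻¹`.  The point of the level set in the complex orbit is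
  found by an affine change of coordinates `z ↦ l z + c`, the minimum of a proper function
  (`exists_balance`); the properness uses that `S` is short.  The translation is bounded by the
  spread of the points (`norm_le_of_balance`), so all of them tend to the origin.
* These generic points are dense, which is shown on the side of polygons
  (`mem_closure_isGenericPair`): the second polygon can be stretched so that no edge points along
  `w` (`exists_stretching`), and the first can be adjusted to the longer `w` (`exists_adjusted`);
  the latter needs two edges in `S`.
-/

namespace Hyperpolygon

open scoped Matrix ComplexConjugate
open Filter Topology

noncomputable section

variable {n : ℕ}

/-! ### The compact group action on the level set -/

set_option maxHeartbeats 1000000 in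
/-- The level set in coordinates.  The first two equations are the entries of the `2 × 2` part of
the real moment map, the last three those of the `2 × 2` part of the complex moment map. -/
theorem mem_levelSet_iff (α : Fin n → ℝ) (x : CotRep n) : x ∈ levelSet α ↔
    (∑ i, (x.2 i 0 * conj (x.2 i 1) - conj (x.1 i 0) * x.1 i 1) = 0) ∧
    (∑ i, (‖x.2 i 0‖ ^ 2 - ‖x.2 i 1‖ ^ 2 - ‖x.1 i 0‖ ^ 2 + ‖x.1 i 1‖ ^ 2) = 0) ∧
    (∀ i, ‖x.2 i 0‖ ^ 2 + ‖x.2 i 1‖ ^ 2 - ‖x.1 i 0‖ ^ 2 - ‖x.1 i 1‖ ^ 2 = 2 * α i) ∧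
    (∀ i, x.1 i 0 * x.2 i 0 + x.1 i 1 * x.2 i 1 = 0) ∧
    (∑ i, x.2 i 0 * x.1 i 1 = 0) ∧ (∑ i, x.2 i 1 * x.1 i 0 = 0) ∧
    (∑ i, (x.2 i 0 * x.1 i 0 - x.2 i 1 * x.1 i 1) = 0) := by
  have hI : (Complex.I / 2) ≠ 0 := by simp
  have hsq : ∀ z : ℂ, z * conj z = ((‖z‖ ^ 2 : ℝ) : ℂ) := fun z => by
    rw [Complex.mul_conj, Complex.normSq_eq_norm_sq]
  have hsq' : ∀ z : ℂ, conj z * z = ((‖z‖ ^ 2 : ℝ) : ℂ) := fun z => by rw [mul_comm, hsq]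
  have h2 : (∑ i, (‖x.2 i 0‖ ^ 2 - ‖x.2 i 1‖ ^ 2 - ‖x.1 i 0‖ ^ 2 + ‖x.1 i 1‖ ^ 2) = 0) ↔
      (∑ i, (((‖x.2 i 0‖ ^ 2 : ℝ) : ℂ) - ((‖x.2 i 1‖ ^ 2 : ℝ) : ℂ) - ((‖x.1 i 0‖ ^ 2 : ℝ) : ℂ)
        + ((‖x.1 i 1‖ ^ 2 : ℝ) : ℂ)) = 0) := by
    norm_cast
  have h1 : (∑ i, (x.2 i 0 * conj (x.2 i 1) - conj (x.1 i 0) * x.1 i 1) = 0) ↔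
      (∑ i, (x.2 i 1 * conj (x.2 i 0) - conj (x.1 i 1) * x.1 i 0) = 0) := by
    rw [← map_eq_zero (starRingEnd ℂ), map_sum]
    refine Eq.congr (Finset.sum_congr rfl fun i _ => ?_) rfl
    simp; ring
  have hd : ∀ f : Fin n → ℂ, (∑ i, (1 / 2 : ℂ) * f i = 0) ↔ ∑ i, f i = 0 := fun f => by
    rw [← Finset.mul_sum]; simp
  have hd' : ∀ f : Fin n → ℂ, (∑ i, (-1 / 2 : ℂ) * f i = 0) ↔ ∑ i, f i = 0 := fun f => by
    rw [← Finset.mul_sum]; simp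
  have hR : (realMoment x).1 = 0 ↔
      (∑ i, (x.2 i 0 * conj (x.2 i 1) - conj (x.1 i 0) * x.1 i 1) = 0) ∧
      (∑ i, (‖x.2 i 0‖ ^ 2 - ‖x.2 i 1‖ ^ 2 - ‖x.1 i 0‖ ^ 2 + ‖x.1 i 1‖ ^ 2) = 0) := by
    rw [h2, realMoment, smul_eq_zero_iff_right hI, ← Matrix.ext_iff]
    simp only [Fin.forall_fin_two, Matrix.sum_apply, traceless, Matrix.sub_apply,
      Matrix.smul_apply, Matrix.trace_fin_two, Matrix.vecMulVec_apply, Pi.star_apply,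
      RCLike.star_def, Matrix.zero_apply, Matrix.one_apply_eq, smul_eq_mul, mul_one, ne_eq,
      zero_ne_one, one_ne_zero, not_false_eq_true, Matrix.one_apply_ne, mul_zero, sub_zero,
      hsq, hsq']
    constructor
    · rintro ⟨⟨h00, h01⟩, -⟩
      refine ⟨h01, (hd _).1 ?_⟩
      rw [← h00]
      exact Finset.sum_congr rfl fun i _ => by ring
    · rintro ⟨h01, h00⟩
      refine ⟨⟨?_, h01⟩, h1.1 h01, ?_⟩
      · rw [← (hd _).2 h00]
        exact Finset.sum_congr rfl fun i _ => by ring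
      · rw [← (hd' _).2 h00]
        exact Finset.sum_congr rfl fun i _ => by ring
  have hR2 : (realMoment x).2 = α ↔
      (∀ i, ‖x.2 i 0‖ ^ 2 + ‖x.2 i 1‖ ^ 2 - ‖x.1 i 0‖ ^ 2 - ‖x.1 i 1‖ ^ 2 = 2 * α i) := by
    simp only [realMoment, funext_iff, normSq2, Fin.sum_univ_two]
    refine forall_congr' fun i => ?_
    constructor <;> intro h <;> linarith
  have hC2 : (complexMoment x).2 = 0 ↔ (∀ i, x.1 i 0 * x.2 i 0 + x.1 i 1 * x.2 i 1 = 0) := by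
    simp [complexMoment, funext_iff, dotProduct, Fin.sum_univ_two]
  have hC : (complexMoment x).1 = 0 ↔
      (∑ i, x.2 i 0 * x.1 i 1 = 0) ∧ (∑ i, x.2 i 1 * x.1 i 0 = 0) ∧
      (∑ i, (x.2 i 0 * x.1 i 0 - x.2 i 1 * x.1 i 1) = 0) := by
    rw [complexMoment, neg_eq_zero, ← Matrix.ext_iff]
    simp only [Fin.forall_fin_two, Matrix.sum_apply, traceless, Matrix.sub_apply,
      Matrix.smul_apply, Matrix.trace_fin_two, Matrix.vecMulVec_apply,
      Matrix.zero_apply, Matrix.one_apply_eq, smul_eq_mul, mul_one, ne_eq,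
      zero_ne_one, one_ne_zero, not_false_eq_true, Matrix.one_apply_ne, mul_zero, sub_zero]
    constructor
    · rintro ⟨⟨h00, h01⟩, h10, -⟩
      refine ⟨h01, h10, (hd _).1 ?_⟩
      rw [← h00]
      exact Finset.sum_congr rfl fun i _ => by ring
    · rintro ⟨h01, h10, h00⟩
      refine ⟨⟨?_, h01⟩, h10, ?_⟩
      · rw [← (hd _).2 h00]
        exact Finset.sum_congr rfl fun i _ => by ring
      · rw [← (hd' _).2 h00]
        exact Finset.sum_congr rfl fun i _ => by ring
  have hL : x ∈ levelSet α ↔ ((realMoment x).1 = 0 ∧ (realMoment x).2 = α) ∧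
      ((complexMoment x).1 = 0 ∧ (complexMoment x).2 = 0) := by
    rw [levelSet, Set.mem_ofPred_eq, Prod.ext_iff, Prod.ext_iff]
    rfl
  rw [hL, hR, hR2, hC, hC2]
  tauto

/-- The action of a unitary matrix and of `n` complex numbers of modulus one, written without
inverses so that it is jointly continuous in all arguments. -/
def unitaryAct (M : Matrix (Fin 2) (Fin 2) ℂ) (e : Fin n → ℂ) (x : CotRep n) : CotRep n :=
  (fun i => conj (e i) • (x.1 i ᵥ* M), fun i => e i • (star M *ᵥ x.2 i))

theorem inv_eq_conj_of_norm_eq_one {z : ℂ} (hz : ‖z‖ = 1) : z⁻¹ = conj z := by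
  rw [Complex.inv_def, Complex.normSq_eq_norm_sq, hz]; simp

theorem act_eq_unitaryAct {g : ComplexGroup n} (hg : g ∈ compactForm n) (x : CotRep n) :
    act x g = unitaryAct (g.1 : Matrix (Fin 2) (Fin 2) ℂ) (fun i => (g.2 i : ℂ)) x := by
  obtain ⟨h1, h2⟩ := hg
  have h3 : star (g.1 : Matrix (Fin 2) (Fin 2) ℂ) =
      ((g.1⁻¹ : Matrix.SpecialLinearGroup (Fin 2) ℂ) : Matrix (Fin 2) (Fin 2) ℂ) := by
    refine left_inv_eq_right_inv ((Matrix.mem_unitaryGroup_iff').1 h1) ?_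
    rw [← Matrix.SpecialLinearGroup.coe_mul, mul_inv_cancel, Matrix.SpecialLinearGroup.coe_one]
  simp only [act, unitaryAct, h3, inv_eq_conj_of_norm_eq_one (h2 _)]

theorem exists_act_eq_unitaryAct {M : Matrix (Fin 2) (Fin 2) ℂ}
    (hM : M ∈ Matrix.unitaryGroup (Fin 2) ℂ) (hdet : M.det = 1) {e : Fin n → ℂ}
    (he : ∀ i, ‖e i‖ = 1) :
    ∃ g ∈ compactForm n, ∀ x : CotRep n, act x g = unitaryAct M e x := by
  have he0 : ∀ i, e i ≠ 0 := fun i h => by simpa [h] using he i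
  refine ⟨(⟨M, hdet⟩, fun i => Units.mk0 (e i) (he0 i)), ⟨hM, he⟩, fun x => ?_⟩
  rw [act_eq_unitaryAct (g := (⟨M, hdet⟩, fun i => Units.mk0 (e i) (he0 i))) ⟨hM, he⟩]
  rfl

theorem traceless_conj {M : Matrix (Fin 2) (Fin 2) ℂ} (hM : M * star M = 1)
    (A : Matrix (Fin 2) (Fin 2) ℂ) : traceless (star M * A * M) = star M * traceless A * M := by
  have hM' : star M * M = 1 := mul_eq_one_comm.1 hM
  have ht : (star M * A * M).trace = A.trace := by
    rw [Matrix.trace_mul_cycle, hM, one_mul]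
  rw [traceless, traceless, ht, mul_sub, sub_mul]
  simp [hM']

theorem unitaryAct_mem_levelSet {α : Fin n → ℝ} {M : Matrix (Fin 2) (Fin 2) ℂ}
    (hM : M * star M = 1) {e : Fin n → ℂ} (he : ∀ i, ‖e i‖ = 1) {x : CotRep n}
    (hx : x ∈ levelSet α) : unitaryAct M e x ∈ levelSet α := by
  have he1 : ∀ i, conj (e i) * e i = 1 := fun i => by
    rw [mul_comm, Complex.mul_conj, Complex.normSq_eq_norm_sq, he]; simp
  have hq : ∀ i, Matrix.vecMulVec ((unitaryAct M e x).2 i) (star ((unitaryAct M e x).2 i)) =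
      star M * Matrix.vecMulVec (x.2 i) (star (x.2 i)) * M := fun i => by
    have : star (star M *ᵥ x.2 i) = star (x.2 i) ᵥ* M := by
      rw [Matrix.star_mulVec, ← Matrix.star_eq_conjTranspose, star_star]
    simp only [unitaryAct, star_smul, Matrix.smul_vecMulVec, Matrix.vecMulVec_smul, smul_smul,
      RCLike.star_def, this, he1, one_smul, Matrix.mul_vecMulVec, Matrix.vecMulVec_mul]
  have hp : ∀ i, Matrix.vecMulVec (star ((unitaryAct M e x).1 i)) ((unitaryAct M e x).1 i) =
      star M * Matrix.vecMulVec (star (x.1 i)) (x.1 i) * M := fun i => by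
    have : star (x.1 i ᵥ* M) = star M *ᵥ star (x.1 i) := by
      rw [Matrix.star_vecMul, Matrix.star_eq_conjTranspose]
    simp only [unitaryAct, star_smul, Matrix.smul_vecMulVec, Matrix.vecMulVec_smul, smul_smul,
      RCLike.star_def, this, Complex.conj_conj, he1, one_smul, Matrix.mul_vecMulVec,
      Matrix.vecMulVec_mul]
  have hqp : ∀ i, Matrix.vecMulVec ((unitaryAct M e x).2 i) ((unitaryAct M e x).1 i) =
      star M * Matrix.vecMulVec (x.2 i) (x.1 i) * M := fun i => by
    simp only [unitaryAct, Matrix.smul_vecMulVec, Matrix.vecMulVec_smul, smul_smul,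
      he1, one_smul, Matrix.mul_vecMulVec, Matrix.vecMulVec_mul]
  have hnorm : ∀ v : Fin 2 → ℂ, ((normSq2 v : ℝ) : ℂ) = (Matrix.vecMulVec v (star v)).trace :=
    fun v => by
      simp [normSq2, Fin.sum_univ_two,
        Complex.mul_conj, Complex.normSq_eq_norm_sq]
  have hnorm' : ∀ v : Fin 2 → ℂ, ((normSq2 v : ℝ) : ℂ) = (Matrix.vecMulVec (star v) v).trace :=
    fun v => by
      rw [hnorm, Matrix.trace_vecMulVec, Matrix.trace_vecMulVec, dotProduct_comm]
  have hcyc : ∀ A, (star M * A * M).trace = A.trace := fun A => by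
    rw [Matrix.trace_mul_cycle, hM, one_mul]
  obtain ⟨hr, hc⟩ := hx
  refine ⟨Prod.ext ?_ (funext fun i => ?_), Prod.ext ?_ (funext fun i => ?_)⟩
  · have := congrArg Prod.fst hr
    simp only [realMoment] at this ⊢
    simp only [hq, hp, ← mul_sub, ← sub_mul, traceless_conj hM]
    rw [← Finset.sum_mul, ← Finset.mul_sum, ← Matrix.smul_mul, ← Matrix.mul_smul, this]
    simp
  · have := congrFun (congrArg Prod.snd hr) i
    simp only [realMoment] at this ⊢
    rw [← this]
    congr 2
    · apply Complex.ofReal_injective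
      rw [hnorm, hnorm, hq, hcyc]
    · apply Complex.ofReal_injective
      rw [hnorm', hnorm', hp, hcyc]
  · have := congrArg Prod.fst hc
    simp only [complexMoment] at this ⊢
    simp only [hqp, traceless_conj hM]
    rw [← Finset.sum_mul, ← Finset.mul_sum, ← neg_mul, ← mul_neg, this]
    simp
  · have := congrFun (congrArg Prod.snd hc) i
    simp only [complexMoment] at this ⊢
    rw [← this, dotProduct_comm, ← Matrix.trace_vecMulVec, hqp, hcyc, Matrix.trace_vecMulVec,
      dotProduct_comm]

theorem act_mem_levelSet {α : Fin n → ℝ} {g : ComplexGroup n} (hg : g ∈ compactForm n)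
    {x : CotRep n} (hx : x ∈ levelSet α) : act x g ∈ levelSet α := by
  rw [act_eq_unitaryAct hg]
  exact unitaryAct_mem_levelSet (Matrix.mem_unitaryGroup_iff.1 hg.1) hg.2 hx

theorem toSpace_eq_iff {α : Fin n → ℝ} {x y : levelSet α} :
    toSpace α x = toSpace α y ↔ ∃ g ∈ compactForm n, act (x : CotRep n) g = y :=
  ⟨fun h => Quotient.exact h, fun h => Quotient.sound h⟩

theorem toSpace_act {α : Fin n → ℝ} {g : ComplexGroup n} (hg : g ∈ compactForm n)
    (x : levelSet α) :
    toSpace α ⟨act (x : CotRep n) g, act_mem_levelSet hg x.2⟩ = toSpace α x :=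
  (toSpace_eq_iff.2 ⟨g, hg, rfl⟩ : toSpace α x = toSpace α ⟨_, act_mem_levelSet hg x.2⟩).symm

theorem continuous_act (g : ComplexGroup n) : Continuous fun x : CotRep n => act x g := by
  unfold act
  refine Continuous.prodMk (continuous_pi fun i => ?_) (continuous_pi fun i => ?_)
  · have h : Continuous fun x : CotRep n => x.1 i := by fun_prop
    have h2 : Continuous fun x : CotRep n => x.1 i ᵥ* (g.1 : Matrix (Fin 2) (Fin 2) ℂ) :=
      h.matrix_vecMul continuous_const
    exact h2.const_smul (g.2 i : ℂ)⁻¹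
  · have h : Continuous fun x : CotRep n => x.2 i := by fun_prop
    have h2 : Continuous fun x : CotRep n =>
        ((g.1⁻¹ : Matrix.SpecialLinearGroup (Fin 2) ℂ) : Matrix (Fin 2) (Fin 2) ℂ) *ᵥ x.2 i :=
      Continuous.matrix_mulVec continuous_const h
    exact h2.const_smul (g.2 i : ℂ)

theorem isOpenQuotientMap_toSpace (α : Fin n → ℝ) : IsOpenQuotientMap (toSpace α) := by
  refine ⟨Quotient.mk_surjective, continuous_quotient_mk', fun V hV => ?_⟩
  change IsOpen (toSpace α ⁻¹' (toSpace α '' V))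
  have : toSpace α ⁻¹' (toSpace α '' V) = ⋃ g : compactForm n,
      (fun y : levelSet α => (⟨act (y : CotRep n) g, act_mem_levelSet g.2 y.2⟩ : levelSet α)) ⁻¹'
        V := by
    ext y
    simp only [Set.mem_preimage, Set.mem_image, Set.mem_iUnion]
    constructor
    · rintro ⟨x, hx, hxy⟩
      obtain ⟨g, hg, h⟩ := toSpace_eq_iff.1 hxy.symm
      have hgx : (⟨act (y : CotRep n) g, act_mem_levelSet hg y.2⟩ : levelSet α) = x :=
        Subtype.ext h
      exact ⟨⟨g, hg⟩, hgx ▸ hx⟩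
    · rintro ⟨g, hg⟩
      exact ⟨_, hg, toSpace_act g.2 y⟩
  rw [this]
  refine isOpen_iUnion fun g => hV.preimage ?_
  exact ((continuous_act _).comp continuous_subtype_val).subtype_mk _

/-- The pairs of a special unitary matrix and `n` complex numbers of modulus one. -/
def unitaryParams (n : ℕ) : Set (Matrix (Fin 2) (Fin 2) ℂ × (Fin n → ℂ)) :=
  {a | (a.1 * star a.1 = 1 ∧ a.1.det = 1) ∧ ∀ i, ‖a.2 i‖ = 1}

theorem isCompact_unitaryParams (n : ℕ) : IsCompact (unitaryParams n) := by
  have hsub : unitaryParams n ⊆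
      (Set.univ.pi fun _ => Set.univ.pi fun _ => Metric.closedBall (0 : ℂ) 1) ×ˢ
        (Set.univ.pi fun _ => Metric.closedBall (0 : ℂ) 1) := by
    rintro a ⟨⟨h1, -⟩, h2⟩
    refine ⟨fun i _ j _ => ?_, fun i _ => ?_⟩
    · simpa using entry_norm_bound_of_unitary (Matrix.mem_unitaryGroup_iff.2 h1) i j
    · simpa using (h2 i).le
  refine IsCompact.of_isClosed_subset ?_ ?_ hsub
  · refine IsCompact.prod (isCompact_univ_pi fun _ => isCompact_univ_pi fun _ => ?_)
      (isCompact_univ_pi fun _ => ?_) <;> exact isCompact_closedBall _ _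
  · have hc : Continuous fun a : Matrix (Fin 2) (Fin 2) ℂ × (Fin n → ℂ) => a.1 * star a.1 :=
      continuous_fst.matrix_mul continuous_fst.star
    have hd : Continuous fun a : Matrix (Fin 2) (Fin 2) ℂ × (Fin n → ℂ) => a.1.det :=
      continuous_fst.matrix_det
    have : unitaryParams n = ({a | a.1 * star a.1 = 1} ∩ {a | a.1.det = 1}) ∩
        ⋂ i, {a | ‖a.2 i‖ = 1} := by
      ext a
      simp [unitaryParams]
    rw [this]
    exact ((isClosed_eq hc continuous_const).inter (isClosed_eq hd continuous_const)).inter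
      (isClosed_iInter fun i => isClosed_eq (by fun_prop) continuous_const)

/-- Orbits of a compact group can be separated: the orbit relation is closed because it is the
projection of a closed set along a compact factor. -/
instance instT2SpaceSpace (α : Fin n → ℝ) : T2Space (Space α) := by
  rw [t2Space_iff_of_isOpenQuotientMap (isOpenQuotientMap_toSpace α)]
  have := isCompact_iff_compactSpace.1 (isCompact_unitaryParams n)
  let T : Set (unitaryParams n × (levelSet α × levelSet α)) :=
    {a | unitaryAct a.1.1.1 a.1.1.2 (a.2.1 : CotRep n) = (a.2.2 : CotRep n)}
  have hT : IsClosed T := by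
    refine isClosed_eq ?_ (by fun_prop)
    unfold unitaryAct
    refine Continuous.prodMk (continuous_pi fun i => ?_) (continuous_pi fun i => ?_)
    · have h1 : Continuous fun a : unitaryParams n × (levelSet α × levelSet α) =>
          (a.2.1 : CotRep n).1 i := by fun_prop
      have h2 : Continuous fun a : unitaryParams n × (levelSet α × levelSet α) =>
          (a.1 : Matrix (Fin 2) (Fin 2) ℂ × (Fin n → ℂ)).1 := by fun_prop
      have h3 : Continuous fun a : unitaryParams n × (levelSet α × levelSet α) =>
          conj ((a.1 : Matrix (Fin 2) (Fin 2) ℂ × (Fin n → ℂ)).2 i) :=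
        Complex.continuous_conj.comp (by fun_prop)
      exact h3.smul (h1.matrix_vecMul h2)
    · have h1 : Continuous fun a : unitaryParams n × (levelSet α × levelSet α) =>
          (a.2.1 : CotRep n).2 i := by fun_prop
      have h2 : Continuous fun a : unitaryParams n × (levelSet α × levelSet α) =>
          star (a.1 : Matrix (Fin 2) (Fin 2) ℂ × (Fin n → ℂ)).1 := Continuous.star (by fun_prop)
      have h3 : Continuous fun a : unitaryParams n × (levelSet α × levelSet α) =>
          ((a.1 : Matrix (Fin 2) (Fin 2) ℂ × (Fin n → ℂ)).2 i) := by fun_prop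
      exact h3.smul (h2.matrix_mulVec h1)
  have key : {q : levelSet α × levelSet α | toSpace α q.1 = toSpace α q.2} = Prod.snd '' T := by
    ext ⟨x, y⟩
    refine (Iff.trans (toSpace_eq_iff (x := x) (y := y)) ?_)
    constructor
    · rintro ⟨g, hg, h⟩
      refine ⟨⟨⟨((g.1 : Matrix (Fin 2) (Fin 2) ℂ), fun i => (g.2 i : ℂ)),
        ⟨Matrix.mem_unitaryGroup_iff.1 hg.1, g.1.2⟩, hg.2⟩, x, y⟩, ?_, rfl⟩
      rw [act_eq_unitaryAct hg] at h
      exact h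
    · rintro ⟨⟨⟨a, ⟨h1, h2⟩, h3⟩, z⟩, h, rfl⟩
      obtain ⟨g, hg, h'⟩ := exists_act_eq_unitaryAct (Matrix.mem_unitaryGroup_iff.2 h1) h2 h3
      exact ⟨g, hg, by rw [h']; exact h⟩
  rw [key]
  exact isClosedMap_snd_of_compactSpace T hT

/-! ### Standard representatives -/

/-- The standard points: points of the level set for which `q i` is a nonnegative multiple of the
first basis vector and `p i` a multiple of the second one for `i ∈ S`, and `p j = 0` for `j ∉ S`.
They represent exactly the classes in which `S` is straight and `p j = 0` for `j ∉ S`. -/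
def stdSet (α : Fin n → ℝ) (S : Finset (Fin n)) : Set (CotRep n) :=
  {x | x ∈ levelSet α ∧ (∀ i ∈ S, x.2 i 1 = 0 ∧ x.1 i 0 = 0 ∧ x.2 i 0 = (‖x.2 i 0‖ : ℂ)) ∧
    ∀ j ∉ S, x.1 j = 0}

theorem mem_stdSet_iff {α : Fin n → ℝ} {S : Finset (Fin n)} {x : CotRep n} : x ∈ stdSet α S ↔
    (∀ i ∈ S, x.2 i 1 = 0 ∧ x.1 i 0 = 0 ∧ x.2 i 0 = (‖x.2 i 0‖ : ℂ)) ∧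
    (∀ j ∉ S, x.1 j = 0) ∧
    (∑ j ∈ Sᶜ, x.2 j 0 * conj (x.2 j 1) = 0) ∧
    (∑ i ∈ S, (‖x.2 i 0‖ ^ 2 + ‖x.1 i 1‖ ^ 2) + ∑ j ∈ Sᶜ, (‖x.2 j 0‖ ^ 2 - ‖x.2 j 1‖ ^ 2) = 0) ∧
    (∀ i ∈ S, ‖x.2 i 0‖ ^ 2 - ‖x.1 i 1‖ ^ 2 = 2 * α i) ∧
    (∀ j ∉ S, ‖x.2 j 0‖ ^ 2 + ‖x.2 j 1‖ ^ 2 = 2 * α j) ∧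
    (∑ i ∈ S, x.2 i 0 * x.1 i 1 = 0) := by
  have hL : x ∈ stdSet α S ↔ x ∈ levelSet α ∧
      ((∀ i ∈ S, x.2 i 1 = 0 ∧ x.1 i 0 = 0 ∧ x.2 i 0 = (‖x.2 i 0‖ : ℂ)) ∧
        ∀ j ∉ S, x.1 j = 0) := Iff.rfl
  rw [hL, and_comm, and_assoc]
  refine and_congr_right fun hS => and_congr_right fun hSc => ?_
  rw [mem_levelSet_iff]
  have h1 : ∑ i, (x.2 i 0 * conj (x.2 i 1) - conj (x.1 i 0) * x.1 i 1) =
      ∑ j ∈ Sᶜ, x.2 j 0 * conj (x.2 j 1) := by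
    rw [← Finset.sum_add_sum_compl S, Finset.sum_eq_zero, zero_add]
    · exact Finset.sum_congr rfl fun j hj => by simp [hSc j (Finset.mem_compl.1 hj)]
    · intro i hi
      rw [(hS i hi).1, (hS i hi).2.1]; simp
  have h2 : ∑ i, (‖x.2 i 0‖ ^ 2 - ‖x.2 i 1‖ ^ 2 - ‖x.1 i 0‖ ^ 2 + ‖x.1 i 1‖ ^ 2) =
      ∑ i ∈ S, (‖x.2 i 0‖ ^ 2 + ‖x.1 i 1‖ ^ 2) + ∑ j ∈ Sᶜ, (‖x.2 j 0‖ ^ 2 - ‖x.2 j 1‖ ^ 2) := by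
    rw [← Finset.sum_add_sum_compl S]
    congr 1
    · exact Finset.sum_congr rfl fun i hi => by rw [(hS i hi).1, (hS i hi).2.1]; simp
    · exact Finset.sum_congr rfl fun j hj => by simp [hSc j (Finset.mem_compl.1 hj)]
  have h3 : (∀ i, ‖x.2 i 0‖ ^ 2 + ‖x.2 i 1‖ ^ 2 - ‖x.1 i 0‖ ^ 2 - ‖x.1 i 1‖ ^ 2 = 2 * α i) ↔
      (∀ i ∈ S, ‖x.2 i 0‖ ^ 2 - ‖x.1 i 1‖ ^ 2 = 2 * α i) ∧
      (∀ j ∉ S, ‖x.2 j 0‖ ^ 2 + ‖x.2 j 1‖ ^ 2 = 2 * α j) := by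
    constructor
    · refine fun h => ⟨fun i hi => ?_, fun j hj => ?_⟩
      · rw [← h i, (hS i hi).1, (hS i hi).2.1]; simp
      · rw [← h j, hSc j hj]; simp
    · rintro ⟨ha, hb⟩ i
      by_cases hi : i ∈ S
      · rw [← ha i hi, (hS i hi).1, (hS i hi).2.1]; simp
      · rw [← hb i hi, hSc i hi]; simp
  have h4 : ∀ i, x.1 i 0 * x.2 i 0 + x.1 i 1 * x.2 i 1 = 0 := fun i => by
    by_cases hi : i ∈ S
    · rw [(hS i hi).1, (hS i hi).2.1]; simp
    · simp [hSc i hi]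
  have h5 : ∑ i, x.2 i 0 * x.1 i 1 = ∑ i ∈ S, x.2 i 0 * x.1 i 1 := by
    rw [← Finset.sum_add_sum_compl S, Finset.sum_eq_zero (s := Sᶜ), add_zero]
    intro j hj
    simp [hSc j (Finset.mem_compl.1 hj)]
  have h6 : ∑ i, x.2 i 1 * x.1 i 0 = 0 := Finset.sum_eq_zero fun i _ => by
    by_cases hi : i ∈ S
    · rw [(hS i hi).1]; simp
    · simp [hSc i hi]
  have h7 : ∑ i, (x.2 i 0 * x.1 i 0 - x.2 i 1 * x.1 i 1) = 0 := Finset.sum_eq_zero fun i _ => by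
    by_cases hi : i ∈ S
    · rw [(hS i hi).1, (hS i hi).2.1]; simp
    · simp [hSc i hi]
  rw [h1, h2, h3, h5]
  tauto

theorem isClosed_setOf_and {X : Type*} [TopologicalSpace X] {P Q : X → Prop}
    (hP : IsClosed {x | P x}) (hQ : IsClosed {x | Q x}) : IsClosed {x | P x ∧ Q x} :=
  hP.inter hQ

theorem isClosed_setOf_forall {X ι : Type*} [TopologicalSpace X] {P : ι → X → Prop}
    (hP : ∀ i, IsClosed {x | P i x}) : IsClosed {x | ∀ i, P i x} := by
  have : {x | ∀ i, P i x} = ⋂ i, {x | P i x} := by ext; simp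
  rw [this]
  exact isClosed_iInter hP

theorem isClosed_setOf_imp {X : Type*} [TopologicalSpace X] {p : Prop} {P : X → Prop}
    (hP : p → IsClosed {x | P x}) : IsClosed {x | p → P x} := by
  by_cases hp : p <;> simp [hp]
  exact hP hp

theorem isClosed_stdSet (α : Fin n → ℝ) (S : Finset (Fin n)) : IsClosed (stdSet α S) := by
  have : stdSet α S = {x | _} := Set.ext fun x => mem_stdSet_iff
  rw [this]
  have hc : ∀ j k, Continuous fun x : CotRep n => conj (x.2 j k) := fun j k =>
    Complex.continuous_conj.comp (by fun_prop)
  have ho : ∀ i, Continuous fun x : CotRep n => ((‖x.2 i 0‖ : ℝ) : ℂ) := fun j =>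
    Complex.continuous_ofReal.comp (by fun_prop)
  refine isClosed_setOf_and ?_ (isClosed_setOf_and ?_ (isClosed_setOf_and ?_
    (isClosed_setOf_and ?_ (isClosed_setOf_and ?_ (isClosed_setOf_and ?_ ?_)))))
  · refine isClosed_setOf_forall fun i => isClosed_setOf_imp fun hi => isClosed_setOf_and ?_
      (isClosed_setOf_and ?_ ?_)
    · exact isClosed_eq (by fun_prop) continuous_const
    · exact isClosed_eq (by fun_prop) continuous_const
    · exact isClosed_eq (by fun_prop) (ho i)
  · exact isClosed_setOf_forall fun i => isClosed_setOf_imp fun hi =>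
      isClosed_eq (by fun_prop) continuous_const
  · refine isClosed_eq (continuous_finsetSum _ fun j _ => ?_) continuous_const
    exact Continuous.mul (by fun_prop) (hc j 1)
  · exact isClosed_eq (by fun_prop) continuous_const
  · exact isClosed_setOf_forall fun i => isClosed_setOf_imp fun hi =>
      isClosed_eq (by fun_prop) continuous_const
  · exact isClosed_setOf_forall fun i => isClosed_setOf_imp fun hi =>
      isClosed_eq (by fun_prop) continuous_const
  · exact isClosed_eq (by fun_prop) continuous_const

theorem stdSet_entry_bound {α : Fin n → ℝ} (hα : ∀ i, 0 < α i) {S : Finset (Fin n)}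
    {x : CotRep n} (hx : x ∈ stdSet α S) (i : Fin n) (k : Fin 2) :
    ‖x.1 i k‖ ^ 2 ≤ 2 * ∑ j, α j ∧ ‖x.2 i k‖ ^ 2 ≤ 2 * ∑ j, α j := by
  obtain ⟨hS, hSc, -, h2, -, h4, -⟩ := mem_stdSet_iff.1 hx
  have hnn : 0 ≤ 2 * ∑ j, α j := mul_nonneg zero_le_two (Finset.sum_nonneg fun j _ => (hα j).le)
  by_cases hi : i ∈ S
  · have h5 : ‖x.2 i 0‖ ^ 2 + ‖x.1 i 1‖ ^ 2 ≤ 2 * ∑ j, α j := by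
      calc ‖x.2 i 0‖ ^ 2 + ‖x.1 i 1‖ ^ 2 ≤ ∑ i ∈ S, (‖x.2 i 0‖ ^ 2 + ‖x.1 i 1‖ ^ 2) :=
            Finset.single_le_sum (f := fun i => ‖x.2 i 0‖ ^ 2 + ‖x.1 i 1‖ ^ 2)
              (fun j _ => by positivity) hi
        _ = ∑ j ∈ Sᶜ, (‖x.2 j 1‖ ^ 2 - ‖x.2 j 0‖ ^ 2) := by
            rw [eq_neg_of_add_eq_zero_left h2, ← Finset.sum_neg_distrib]
            exact Finset.sum_congr rfl fun j _ => by ring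
        _ ≤ ∑ j ∈ Sᶜ, 2 * α j := by
            refine Finset.sum_le_sum fun j hj => ?_
            rw [← h4 j (Finset.mem_compl.1 hj)]
            nlinarith [sq_nonneg ‖x.2 j 0‖]
        _ ≤ ∑ j, 2 * α j := Finset.sum_le_univ_sum_of_nonneg fun j => by linarith [hα j]
        _ = 2 * ∑ j, α j := by rw [Finset.mul_sum]
    have h6 := sq_nonneg ‖x.2 i 0‖
    have h7 := sq_nonneg ‖x.1 i 1‖
    fin_cases k
    · simp only [Fin.zero_eta, (hS i hi).2.1, norm_zero]
      exact ⟨by simpa using hnn, by linarith⟩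
    · simp only [Fin.mk_one, (hS i hi).1, norm_zero]
      exact ⟨by linarith, by simpa using hnn⟩
  · have h5 : ‖x.2 i 0‖ ^ 2 + ‖x.2 i 1‖ ^ 2 ≤ 2 * ∑ j, α j := by
      rw [h4 i hi]
      exact mul_le_mul_of_nonneg_left
        (Finset.single_le_sum (fun j _ => (hα j).le) (Finset.mem_univ i)) zero_le_two
    have h6 := sq_nonneg ‖x.2 i 0‖
    have h7 := sq_nonneg ‖x.2 i 1‖
    rw [hSc i hi]
    refine ⟨by simpa using hnn, ?_⟩
    fin_cases k
    · simp only [Fin.zero_eta]; linarith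
    · simp only [Fin.mk_one]; linarith

theorem isCompact_stdSet {α : Fin n → ℝ} (hα : ∀ i, 0 < α i) (S : Finset (Fin n)) :
    IsCompact (stdSet α S) := by
  refine Metric.isCompact_of_isClosed_isBounded (isClosed_stdSet α S) ?_
  refine (Metric.isBounded_closedBall (x := 0) (r := √(2 * ∑ j, α j))).subset fun x hx => ?_
  rw [mem_closedBall_zero_iff, Prod.norm_def, max_le_iff]
  have h := stdSet_entry_bound hα hx
  constructor
  · exact (pi_norm_le_iff_of_nonneg (Real.sqrt_nonneg _)).2 fun i =>
      (pi_norm_le_iff_of_nonneg (Real.sqrt_nonneg _)).2 fun k => Real.le_sqrt_of_sq_le (h i k).1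
  · exact (pi_norm_le_iff_of_nonneg (Real.sqrt_nonneg _)).2 fun i =>
      (pi_norm_le_iff_of_nonneg (Real.sqrt_nonneg _)).2 fun k => Real.le_sqrt_of_sq_le (h i k).2

/-- The class of a standard point. -/
def stdClass (α : Fin n → ℝ) (S : Finset (Fin n)) (x : stdSet α S) : Space α :=
  toSpace α ⟨x, x.2.1⟩

theorem continuous_stdClass (α : Fin n → ℝ) (S : Finset (Fin n)) : Continuous (stdClass α S) :=
  (isOpenQuotientMap_toSpace α).continuous.comp (by fun_prop)

theorem stdSet_norm_pos {α : Fin n → ℝ} (hα : ∀ i, 0 < α i) {S : Finset (Fin n)}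
    {x : CotRep n} (hx : x ∈ stdSet α S) {i : Fin n} (hi : i ∈ S) : 0 < ‖x.2 i 0‖ := by
  have h := (mem_stdSet_iff.1 hx).2.2.2.2.1 i hi
  have : 0 < ‖x.2 i 0‖ ^ 2 := by nlinarith [hα i, sq_nonneg ‖x.1 i 1‖]
  exact (norm_nonneg _).lt_of_ne fun h0 => by rw [← h0] at this; simp at this

theorem Straight.act {x : CotRep n} {S : Finset (Fin n)} (h : Straight x S) (g : ComplexGroup n) :
    Straight (Hyperpolygon.act x g) S := by
  intro i hi j hj
  obtain ⟨c, hc⟩ := h i hi j hj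
  refine ⟨(g.2 i : ℂ) * c * (g.2 j : ℂ)⁻¹, ?_⟩
  have : (g.2 j : ℂ) ≠ 0 := (g.2 j).ne_zero
  simp only [Hyperpolygon.act, hc, Matrix.mulVec_smul, smul_smul]
  rw [mul_assoc, inv_mul_cancel₀ this, mul_one]

/-- Every nonzero vector of `ℂ²` is taken to a positive multiple of the first basis vector by a
special unitary matrix. -/
theorem exists_unitary_mulVec (q : Fin 2 → ℂ) (hq : q ≠ 0) :
    ∃ M : Matrix (Fin 2) (Fin 2) ℂ, M * star M = 1 ∧ M.det = 1 ∧
      ∃ N : ℝ, 0 < N ∧ star M *ᵥ q = ![(N : ℂ), 0] := by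
  set r : ℝ := ‖q 0‖ ^ 2 + ‖q 1‖ ^ 2 with hr
  have hr0 : 0 < r := by
    by_contra hle
    apply hq
    have h0 : ‖q 0‖ ^ 2 = 0 := by nlinarith [sq_nonneg ‖q 0‖, sq_nonneg ‖q 1‖]
    have h1 : ‖q 1‖ ^ 2 = 0 := by nlinarith [sq_nonneg ‖q 0‖, sq_nonneg ‖q 1‖]
    funext k
    fin_cases k
    · simpa using h0
    · simpa using h1
  set N : ℝ := √r with hN
  have hN0 : 0 < N := Real.sqrt_pos.2 hr0
  have hNc : (N : ℂ) ≠ 0 := by exact_mod_cast hN0.ne'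
  have hNN : (N : ℂ) * N = q 0 * conj (q 0) + q 1 * conj (q 1) := by
    rw [Complex.mul_conj, Complex.mul_conj, Complex.normSq_eq_norm_sq, Complex.normSq_eq_norm_sq]
    have : N * N = r := Real.mul_self_sqrt hr0.le
    exact_mod_cast this
  refine ⟨!![q 0 / N, -conj (q 1) / N; q 1 / N, conj (q 0) / N], ?_, ?_, N, hN0, ?_⟩
  · ext i j
    fin_cases i <;> fin_cases j <;>
      simp [Matrix.mul_apply, Fin.sum_univ_two, Matrix.star_apply] <;> field_simp <;>
      first | ring1 | linear_combination -hNN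
  · rw [Matrix.det_fin_two_of]
    field_simp
    rw [pow_two, hNN]
    ring
  · funext i
    fin_cases i <;>
      simp [Matrix.mulVec, dotProduct, Fin.sum_univ_two, Matrix.star_apply] <;> field_simp
    · rw [pow_two, hNN]; ring
    · ring

/-- Every class in which `S` is straight and `p j = 0` for `j ∉ S` has a standard
representative. -/
theorem exists_act_mem_stdSet {α : Fin n → ℝ} (hα : ∀ i, 0 < α i) {S : Finset (Fin n)}
    (hne : S.Nonempty) {x : CotRep n} (hx : x ∈ levelSet α) (hS : Straight x S)
    (hp : ∀ j ∉ S, x.1 j = 0) : ∃ g ∈ compactForm n, act x g ∈ stdSet α S := by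
  obtain ⟨i₀, hi₀⟩ := hne
  have hq0 : ∀ y ∈ levelSet α, ∀ i, y.2 i ≠ 0 := fun y hy i h => by
    have := ((mem_levelSet_iff α y).1 hy).2.2.1 i
    rw [h] at this
    simp only [Pi.zero_apply, norm_zero] at this
    nlinarith [hα i, sq_nonneg ‖y.1 i 0‖, sq_nonneg ‖y.1 i 1‖]
  obtain ⟨M, hM, hdet, N, hN, hMN⟩ := exists_unitary_mulVec (x.2 i₀) (hq0 x hx i₀)
  have hNc : (N : ℂ) ≠ 0 := by exact_mod_cast hN.ne'
  choose! c hc using fun i hi => hS i hi i₀ hi₀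
  have hc0 : ∀ i ∈ S, c i ≠ 0 := fun i hi h => hq0 x hx i (by rw [hc i hi, h, zero_smul])
  let e : Fin n → ℂ := fun i => if i ∈ S then conj (c i) / ‖c i‖ else 1
  have he : ∀ i, ‖e i‖ = 1 := fun i => by
    by_cases hi : i ∈ S
    · have := norm_pos_iff.2 (hc0 i hi)
      simp only [e, hi, if_true]
      rw [norm_div, RCLike.norm_conj, Complex.norm_real, norm_norm, div_self this.ne']
    · simp [e, hi]
  obtain ⟨g, hg, hgx⟩ := exists_act_eq_unitaryAct (Matrix.mem_unitaryGroup_iff.2 hM) hdet he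
  have hlev : act x g ∈ levelSet α := act_mem_levelSet hg hx
  refine ⟨g, hg, hlev, fun i hi => ?_, fun j hj => ?_⟩
  · have hval : (act x g).2 i = ![((‖c i‖ * N : ℝ) : ℂ), 0] := by
      have h3 : (‖c i‖ : ℂ) ≠ 0 := by exact_mod_cast (norm_pos_iff.2 (hc0 i hi)).ne'
      have h4 : conj (c i) * c i = (‖c i‖ : ℂ) * ‖c i‖ := by
        rw [mul_comm, Complex.mul_conj, Complex.normSq_eq_norm_sq, pow_two]; push_cast; rfl
      simp only [hgx, unitaryAct, e, hi, if_true, hc i hi, Matrix.mulVec_smul, hMN]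
      funext k
      fin_cases k
      · simp only [Fin.zero_eta, Pi.smul_apply, Matrix.cons_val_zero, smul_eq_mul]
        push_cast
        rw [div_mul_eq_mul_div, div_eq_iff h3, ← mul_assoc, h4]
        ring
      · simp
    have h1 := ((mem_levelSet_iff α _).1 hlev).2.2.2.1 i
    rw [hval] at h1 ⊢
    have hpos : 0 < ‖c i‖ * N := mul_pos (norm_pos_iff.2 (hc0 i hi)) hN
    refine ⟨rfl, ?_, ?_⟩
    · have h2 : (((‖c i‖ * N : ℝ)) : ℂ) ≠ 0 := by exact_mod_cast hpos.ne'
      simpa [hc0 i hi, hNc] using h1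
    · change ((‖c i‖ * N : ℝ) : ℂ) = ((‖((‖c i‖ * N : ℝ) : ℂ)‖ : ℝ) : ℂ)
      rw [Complex.norm_real, Real.norm_of_nonneg hpos.le]
  · simp [hgx, unitaryAct, hp j hj]

theorem stdSet_straight {α : Fin n → ℝ} (hα : ∀ i, 0 < α i) {S : Finset (Fin n)}
    {x : CotRep n} (hx : x ∈ stdSet α S) : Straight x S := by
  intro i hi j hj
  have hj0 : x.2 j 0 ≠ 0 := norm_pos_iff.1 (stdSet_norm_pos hα hx hj)
  refine ⟨x.2 i 0 / x.2 j 0, funext fun k => ?_⟩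
  fin_cases k
  · simp [hj0]
  · simp [(hx.2.1 i hi).1, (hx.2.1 j hj).1]

/-! ### Vectors and rotations of three-space -/

/-- Three-space as `ℂ × ℝ`; the second factor is the vertical axis. -/
def vec : ℂ × ℝ →ₗ[ℝ] E3 where
  toFun a := !₂[a.1.re, a.1.im, a.2]
  map_add' a b := by ext k; fin_cases k <;> simp
  map_smul' c a := by ext k; fin_cases k <;> simp

@[simp] theorem vec_apply_zero (a : ℂ × ℝ) : vec a 0 = a.1.re := rfl
@[simp] theorem vec_apply_one (a : ℂ × ℝ) : vec a 1 = a.1.im := rfl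
@[simp] theorem vec_apply_two (a : ℂ × ℝ) : vec a 2 = a.2 := rfl

theorem vec_injective : Function.Injective vec := by
  rintro ⟨z, h⟩ ⟨z', h'⟩ e
  refine Prod.ext (Complex.ext ?_ ?_) ?_
  · simpa using congrArg (fun v : E3 => v 0) e
  · simpa using congrArg (fun v : E3 => v 1) e
  · simpa using congrArg (fun v : E3 => v 2) e

theorem vec_coords (v : E3) : vec (⟨v 0, v 1⟩, v 2) = v := by
  ext k; fin_cases k <;> simp

theorem inner_eq_coords (v w : E3) : inner ℝ v w = v 0 * w 0 + v 1 * w 1 + v 2 * w 2 := by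
  simp [PiLp.inner_apply, Fin.sum_univ_three, mul_comm]

theorem norm_sq_vec (a : ℂ × ℝ) : ‖vec a‖ ^ 2 = ‖a.1‖ ^ 2 + a.2 ^ 2 := by
  rw [← real_inner_self_eq_norm_sq, inner_eq_coords, ← Complex.normSq_eq_norm_sq,
    Complex.normSq_apply]
  simp [pow_two]

theorem continuous_vec : Continuous vec := vec.continuous_of_finiteDimensional

theorem det_eq_coords (f : E3 →ₗ[ℝ] E3) : LinearMap.det f =
    (f (vec (1, 0)) 0 * (f (vec (Complex.I, 0)) 1 * f (vec (0, 1)) 2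
        - f (vec (0, 1)) 1 * f (vec (Complex.I, 0)) 2)
      - f (vec (Complex.I, 0)) 0 * (f (vec (1, 0)) 1 * f (vec (0, 1)) 2
        - f (vec (0, 1)) 1 * f (vec (1, 0)) 2)
      + f (vec (0, 1)) 0 * (f (vec (1, 0)) 1 * f (vec (Complex.I, 0)) 2
        - f (vec (Complex.I, 0)) 1 * f (vec (1, 0)) 2)) := by
  have e0 : EuclideanSpace.basisFun (Fin 3) ℝ 0 = vec (1, 0) := by
    ext k; fin_cases k <;> simp
  have e1 : EuclideanSpace.basisFun (Fin 3) ℝ 1 = vec (Complex.I, 0) := by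
    ext k; fin_cases k <;> simp
  have e2 : EuclideanSpace.basisFun (Fin 3) ℝ 2 = vec (0, 1) := by
    ext k; fin_cases k <;> simp
  rw [← LinearMap.det_toMatrix (EuclideanSpace.basisFun (Fin 3) ℝ).toBasis, Matrix.det_fin_three]
  simp only [LinearMap.toMatrix_apply, OrthonormalBasis.coe_toBasis, e0, e1, e2,
    OrthonormalBasis.coe_toBasis_repr_apply, EuclideanSpace.basisFun_repr]
  ring

theorem linearEquiv_det_eq_one_iff (R : E3 ≃ₗᵢ[ℝ] E3) :
    LinearEquiv.det R.toLinearEquiv = 1 ↔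
      LinearMap.det (R.toLinearEquiv : E3 →ₗ[ℝ] E3) = 1 := by
  rw [← LinearEquiv.coe_det, Units.val_eq_one]

/-- Multiplication by `σ` on the horizontal plane. -/
def rotLin (σ : ℂ) : E3 →ₗ[ℝ] E3 where
  toFun v := vec (σ * ⟨v 0, v 1⟩, v 2)
  map_add' a b := by
    rw [← map_add, Prod.mk_add_mk, ← mul_add]; rfl
  map_smul' c a := by
    ext k; fin_cases k <;> simp <;> ring

theorem rotLin_vec (σ z : ℂ) (h : ℝ) : rotLin σ (vec (z, h)) = vec (σ * z, h) := rfl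

/-- The rotation about the vertical axis that multiplies the horizontal plane by `σ`. -/
def rot (σ : ℂ) (hσ : ‖σ‖ = 1) : E3 ≃ₗᵢ[ℝ] E3 :=
  LinearIsometry.toLinearIsometryEquiv
    { rotLin σ with
      norm_map' := fun v => by
        rw [← sq_eq_sq₀ (norm_nonneg _) (norm_nonneg _)]
        change ‖rotLin σ v‖ ^ 2 = _
        rw [← vec_coords v, rotLin_vec, norm_sq_vec, norm_sq_vec, norm_mul, hσ, one_mul] } rfl

theorem rot_vec (σ : ℂ) (hσ : ‖σ‖ = 1) (z : ℂ) (h : ℝ) :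
    rot σ hσ (vec (z, h)) = vec (σ * z, h) := rfl

theorem det_rot (σ : ℂ) (hσ : ‖σ‖ = 1) : LinearEquiv.det (rot σ hσ).toLinearEquiv = 1 := by
  have h : ∀ v, ((rot σ hσ).toLinearEquiv : E3 →ₗ[ℝ] E3) v = rotLin σ v := fun _ => rfl
  have h1 : σ.re * σ.re + σ.im * σ.im = 1 := by
    rw [← Complex.normSq_apply, Complex.normSq_eq_norm_sq, hσ, one_pow]
  rw [linearEquiv_det_eq_one_iff, det_eq_coords]
  simp only [h, rotLin_vec, vec_apply_zero, vec_apply_one, vec_apply_two]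
  simp
  linarith

/-- A rotation that fixes the vertical axis multiplies the horizontal plane by a number of
modulus one. -/
theorem exists_rot_of_fix {R : E3 ≃ₗᵢ[ℝ] E3} (hdet : LinearEquiv.det R.toLinearEquiv = 1)
    (hfix : R (vec (0, 1)) = vec (0, 1)) :
    ∃ σ : ℂ, ‖σ‖ = 1 ∧ ∀ z h, R (vec (z, h)) = vec (σ * z, h) := by
  set a := R (vec (1, 0)) with ha
  set b := R (vec (Complex.I, 0)) with hb
  have hin : ∀ v w, inner ℝ (R v) (R w) = inner ℝ v w := R.inner_map_map
  have ha2 : a 2 = 0 := by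
    have := hin (vec (1, 0)) (vec (0, 1))
    rw [hfix, ← ha, inner_eq_coords, inner_eq_coords] at this
    simpa using this
  have hb2 : b 2 = 0 := by
    have := hin (vec (Complex.I, 0)) (vec (0, 1))
    rw [hfix, ← hb, inner_eq_coords, inner_eq_coords] at this
    simpa using this
  have haa : a 0 * a 0 + a 1 * a 1 = 1 := by
    have := hin (vec (1, 0)) (vec (1, 0))
    rw [← ha, inner_eq_coords, inner_eq_coords, ha2] at this
    simpa using this
  have hbb : b 0 * b 0 + b 1 * b 1 = 1 := by
    have := hin (vec (Complex.I, 0)) (vec (Complex.I, 0))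
    rw [← hb, inner_eq_coords, inner_eq_coords, hb2] at this
    simpa using this
  have hd : a 0 * b 1 - b 0 * a 1 = 1 := by
    rw [linearEquiv_det_eq_one_iff, det_eq_coords] at hdet
    have h : ∀ v, (R.toLinearEquiv : E3 →ₗ[ℝ] E3) v = R v := fun _ => rfl
    simp only [h, hfix, ← ha, ← hb, ha2, hb2] at hdet
    simpa using hdet
  have hsq : (b 0 + a 1) ^ 2 + (b 1 - a 0) ^ 2 = 0 := by nlinarith
  have hb0 : b 0 = -a 1 := by nlinarith [sq_nonneg (b 0 + a 1), sq_nonneg (b 1 - a 0)]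
  have hb1 : b 1 = a 0 := by nlinarith [sq_nonneg (b 0 + a 1), sq_nonneg (b 1 - a 0)]
  refine ⟨⟨a 0, a 1⟩, ?_, fun z h => ?_⟩
  · have : ‖(⟨a 0, a 1⟩ : ℂ)‖ ^ 2 = 1 := by
      rw [← Complex.normSq_eq_norm_sq, Complex.normSq_apply]; exact haa
    exact (pow_eq_one_iff_of_nonneg (norm_nonneg _) two_ne_zero).1 this
  · have : vec (z, h) = z.re • vec (1, 0) + z.im • vec (Complex.I, 0) + h • vec (0, 1) := by
      ext k; fin_cases k <;> simp
    rw [this, map_add, map_add, map_smul, map_smul, map_smul, hfix, ← ha, ← hb]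
    ext k
    fin_cases k
    · simp [hb0]; ring
    · simp [hb1]; ring
    · simp [ha2, hb2]

/-- Complex conjugation of the horizontal plane, a reflection. -/
def conjIso : E3 ≃ₗᵢ[ℝ] E3 :=
  LinearIsometry.toLinearIsometryEquiv
    { toFun := fun v => vec (conj ⟨v 0, v 1⟩, v 2)
      map_add' := fun a b => by rw [← map_add, Prod.mk_add_mk, ← map_add]; rfl
      map_smul' := fun c a => by ext k; fin_cases k <;> simp
      norm_map' := fun v => by
        rw [← sq_eq_sq₀ (norm_nonneg _) (norm_nonneg _)]
        change ‖vec (conj ⟨v 0, v 1⟩, v 2)‖ ^ 2 = _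
        conv_rhs => rw [← vec_coords v]
        rw [norm_sq_vec, norm_sq_vec, RCLike.norm_conj] } rfl

theorem conjIso_vec (z : ℂ) (h : ℝ) : conjIso (vec (z, h)) = vec (conj z, h) := rfl

theorem det_conjIso : LinearEquiv.det conjIso.toLinearEquiv = -1 := by
  have h : ∀ v, (conjIso.toLinearEquiv : E3 →ₗ[ℝ] E3) v = conjIso v := fun _ => rfl
  apply Units.ext
  rw [LinearEquiv.coe_det, det_eq_coords]
  simp only [h, conjIso_vec, vec_apply_zero, vec_apply_one, vec_apply_two]
  simp

/-- Every vector can be rotated to the upward vertical direction. -/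
theorem exists_rotation_to_vertical (w : E3) : ∃ R : E3 ≃ₗᵢ[ℝ] E3,
    LinearEquiv.det R.toLinearEquiv = 1 ∧ R w = vec (0, ‖w‖) := by
  have hn : ‖w‖ = ‖vec (0, ‖w‖)‖ := by
    rw [← sq_eq_sq₀ (norm_nonneg _) (norm_nonneg _), norm_sq_vec]; simp
  let T : E3 ≃ₗᵢ[ℝ] E3 := (ℝ ∙ (w - vec (0, ‖w‖)))ᗮ.reflection
  have hT : T w = vec (0, ‖w‖) := Submodule.reflection_sub hn
  have hdet : LinearEquiv.det T.toLinearEquiv = 1 ∨ LinearEquiv.det T.toLinearEquiv = -1 := by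
    have : LinearEquiv.det T.toLinearEquiv = (-1) ^ _ := Submodule.linearEquiv_det_reflection _
    rw [this]
    exact neg_one_pow_eq_or _ _
  rcases hdet with h | h
  · exact ⟨T, h, hT⟩
  · refine ⟨T.trans conjIso, ?_, ?_⟩
    · have : LinearEquiv.det (T.toLinearEquiv.trans conjIso.toLinearEquiv) = 1 := by
        rw [LinearEquiv.det_trans, h, det_conjIso]; simp
      exact this
    · rw [LinearIsometryEquiv.trans_apply, hT, conjIso_vec, map_zero]

/-! ### The moduli space of polygon pairs is Hausdorff -/

theorem IsPolygonPair.rotate {α : Fin n → ℝ} {S : Finset (Fin n)} {z : VectorTuple S}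
    (hz : IsPolygonPair α S z) (R : E3 ≃ₗᵢ[ℝ] E3) :
    IsPolygonPair α S (fun i => R (z.1 i), fun j => R (z.2.1 j), R z.2.2) where
  sum_v := by
    change R z.2.2 + ∑ j, R (z.2.1 j) = 0
    rw [← map_sum, ← map_add, hz.sum_v, map_zero]
  sum_u := by
    change ∑ i, R (z.1 i) = 0
    rw [← map_sum, hz.sum_u, map_zero]
  perp i := by
    change inner ℝ (R (z.1 i)) (R z.2.2) = 0
    rw [R.inner_map_map, hz.perp i]
  norm_v j := by
    change ‖R (z.2.1 j)‖ = α j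
    rw [R.norm_map, hz.norm_v j]
  norm_w := by
    change ‖R z.2.2‖ = ∑ i : {i // i ∈ S}, Real.sqrt (α i ^ 2 + ‖R (z.1 i)‖ ^ 2)
    simp only [R.norm_map, hz.norm_w]

/-- The tuples satisfying the five conditions. -/
abbrev PolygonPair (α : Fin n → ℝ) (S : Finset (Fin n)) : Type :=
  {z : VectorTuple S // IsPolygonPair α S z}

/-- The class of a tuple in the moduli space of polygon pairs. -/
def toModuli (α : Fin n → ℝ) (S : Finset (Fin n)) (z : PolygonPair α S) :
    PolygonModuli α S := Quotient.mk (rotationSetoid α S) z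

theorem toModuli_eq_iff {α : Fin n → ℝ} {S : Finset (Fin n)}
    {z z' : PolygonPair α S} : toModuli α S z = toModuli α S z' ↔
    ∃ R : E3 ≃ₗᵢ[ℝ] E3, LinearEquiv.det R.toLinearEquiv = 1 ∧
      (∀ i, R (z.1.1 i) = z'.1.1 i) ∧ (∀ j, R (z.1.2.1 j) = z'.1.2.1 j) ∧ R z.1.2.2 = z'.1.2.2 :=
  ⟨fun h => Quotient.exact h, fun h => Quotient.sound h⟩

theorem toModuli_rotate {α : Fin n → ℝ} {S : Finset (Fin n)} {R : E3 ≃ₗᵢ[ℝ] E3}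
    (hR : LinearEquiv.det R.toLinearEquiv = 1) (z : PolygonPair α S) :
    toModuli α S ⟨_, z.2.rotate R⟩ = toModuli α S z :=
  (toModuli_eq_iff.2 ⟨R, hR, fun _ => rfl, fun _ => rfl, rfl⟩).symm

theorem isOpenQuotientMap_toModuli (α : Fin n → ℝ) (S : Finset (Fin n)) :
    IsOpenQuotientMap (toModuli α S) := by
  refine ⟨Quotient.mk_surjective, continuous_quotient_mk', fun V hV => ?_⟩
  change IsOpen (toModuli α S ⁻¹' (toModuli α S '' V))
  have : toModuli α S ⁻¹' (toModuli α S '' V) =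
      ⋃ R : {R : E3 ≃ₗᵢ[ℝ] E3 // LinearEquiv.det R.toLinearEquiv = 1},
        (fun z : PolygonPair α S =>
          (⟨_, z.2.rotate R.1⟩ : PolygonPair α S)) ⁻¹' V := by
    ext z
    simp only [Set.mem_preimage, Set.mem_image, Set.mem_iUnion]
    constructor
    · rintro ⟨z', hz', hzz⟩
      obtain ⟨R, hR, h1, h2, h3⟩ := toModuli_eq_iff.1 hzz.symm
      have : (⟨_, z.2.rotate R⟩ : PolygonPair α S) = z' :=
        Subtype.ext (Prod.ext (funext h1) (Prod.ext (funext h2) h3))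
      exact ⟨⟨R, hR⟩, this ▸ hz'⟩
    · rintro ⟨R, hR⟩
      exact ⟨_, hR, toModuli_rotate R.2 z⟩
  rw [this]
  refine isOpen_iUnion fun R => hV.preimage (Continuous.subtype_mk ?_ _)
  fun_prop

/-- The rotations of three-space, as a set of continuous linear maps. -/
def rotations : Set (E3 →L[ℝ] E3) := {A | (∀ v, ‖A v‖ = ‖v‖) ∧ A.det = 1}

theorem isCompact_rotations : IsCompact rotations := by
  refine Metric.isCompact_of_isClosed_isBounded ?_ ?_
  · refine isClosed_setOf_and (isClosed_setOf_forall fun v => ?_) ?_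
    · exact isClosed_eq (by fun_prop) continuous_const
    · exact isClosed_eq ContinuousLinearMap.continuous_det continuous_const
  · refine (Metric.isBounded_closedBall (x := 0) (r := 1)).subset fun A hA => ?_
    rw [mem_closedBall_zero_iff]
    exact A.opNorm_le_bound zero_le_one fun v => by rw [hA.1 v, one_mul]

theorem coe_mem_rotations {R : E3 ≃ₗᵢ[ℝ] E3} (hR : LinearEquiv.det R.toLinearEquiv = 1) :
    (R.toContinuousLinearEquiv : E3 →L[ℝ] E3) ∈ rotations :=
  ⟨fun v => R.norm_map v, (linearEquiv_det_eq_one_iff R).1 hR⟩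

theorem exists_of_mem_rotations {A : E3 →L[ℝ] E3} (hA : A ∈ rotations) :
    ∃ R : E3 ≃ₗᵢ[ℝ] E3, LinearEquiv.det R.toLinearEquiv = 1 ∧ ∀ v, R v = A v := by
  let R : E3 ≃ₗᵢ[ℝ] E3 := LinearIsometry.toLinearIsometryEquiv ⟨(A : E3 →ₗ[ℝ] E3), hA.1⟩ rfl
  refine ⟨R, ?_, fun v => rfl⟩
  rw [linearEquiv_det_eq_one_iff]
  have : (R.toLinearEquiv : E3 →ₗ[ℝ] E3) = (A : E3 →ₗ[ℝ] E3) := by ext v : 1; rfl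
  rw [this]
  exact hA.2

/-- The group of rotations is compact, so its orbit relation is closed. -/
instance instT2SpacePolygonModuli (α : Fin n → ℝ) (S : Finset (Fin n)) :
    T2Space (PolygonModuli α S) := by
  rw [t2Space_iff_of_isOpenQuotientMap (isOpenQuotientMap_toModuli α S)]
  have := isCompact_iff_compactSpace.1 isCompact_rotations
  let T : Set (rotations × (PolygonPair α S × PolygonPair α S)) :=
    {a | (∀ i, a.1.1 (a.2.1.1.1 i) = a.2.2.1.1 i) ∧
    (∀ j, a.1.1 (a.2.1.1.2.1 j) = a.2.2.1.2.1 j) ∧ a.1.1 a.2.1.1.2.2 = a.2.2.1.2.2}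
  have hT : IsClosed T := by
    have h1 : Continuous fun a : rotations × PolygonPair α S × PolygonPair α S => a.2.1.1 := by
      fun_prop
    have h2 : Continuous fun a : rotations × PolygonPair α S × PolygonPair α S => a.2.2.1 := by
      fun_prop
    have h0 : Continuous fun a : rotations × PolygonPair α S × PolygonPair α S => a.1.1 := by
      fun_prop
    refine isClosed_setOf_and (isClosed_setOf_forall fun i => ?_)
      (isClosed_setOf_and (isClosed_setOf_forall fun j => ?_) ?_)
    · exact isClosed_eq (h0.clm_apply (by fun_prop)) (by fun_prop)
    · exact isClosed_eq (h0.clm_apply (by fun_prop)) (by fun_prop)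
    · exact isClosed_eq (h0.clm_apply (by fun_prop)) (by fun_prop)
  have key : {q : PolygonPair α S × PolygonPair α S | toModuli α S q.1 = toModuli α S q.2} =
      Prod.snd '' T := by
    ext ⟨x, y⟩
    refine (Iff.trans (toModuli_eq_iff (z := x) (z' := y)) ?_)
    constructor
    · rintro ⟨R, hR, h⟩
      exact ⟨⟨⟨_, coe_mem_rotations hR⟩, x, y⟩, h, rfl⟩
    · rintro ⟨⟨⟨A, hA⟩, z⟩, h, rfl⟩
      obtain ⟨R, hR, h'⟩ := exists_of_mem_rotations hA
      refine ⟨R, hR, ?_⟩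
      simp only [h']
      exact h
  rw [key]
  exact isClosedMap_snd_of_compactSpace T hT

/-! ### From standard points to pairs of polygons -/

theorem unitaryAct_fst_apply (M : Matrix (Fin 2) (Fin 2) ℂ) (e : Fin n → ℂ) (x : CotRep n)
    (i : Fin n) (k : Fin 2) :
    (unitaryAct M e x).1 i k = conj (e i) * (x.1 i 0 * M 0 k + x.1 i 1 * M 1 k) := by
  change conj (e i) * (x.1 i ᵥ* M) k = _
  rw [Matrix.vecMul, dotProduct, Fin.sum_univ_two]

theorem unitaryAct_snd_apply (M : Matrix (Fin 2) (Fin 2) ℂ) (e : Fin n → ℂ) (x : CotRep n)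
    (i : Fin n) (k : Fin 2) :
    (unitaryAct M e x).2 i k = e i * (conj (M 0 k) * x.2 i 0 + conj (M 1 k) * x.2 i 1) := by
  change e i * (star M *ᵥ x.2 i) k = _
  rw [Matrix.mulVec, dotProduct, Fin.sum_univ_two]
  rfl

/-- The pair of polygons of a standard point: the off-diagonal entry of `q i p i` gives the
horizontal vector `u i`, the traceless part of `q j q j*` gives `v j`, and `w` is the
vertical vector that closes the second polygon. -/
def polygonTuple (S : Finset (Fin n)) (x : CotRep n) : VectorTuple S :=
  (fun i => vec (x.2 i 0 * x.1 i 1, 0),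
   fun j => vec (x.2 j 0 * conj (x.2 j 1), (‖x.2 j 0‖ ^ 2 - ‖x.2 j 1‖ ^ 2) / 2),
   vec (0, (∑ i ∈ S, (‖x.2 i 0‖ ^ 2 + ‖x.1 i 1‖ ^ 2)) / 2))

theorem sum_subtype_compl {M : Type*} [AddCommMonoid M] (S : Finset (Fin n)) (f : Fin n → M) :
    ∑ j : {j // j ∉ S}, f j = ∑ j ∈ Sᶜ, f j :=
  (Finset.sum_subtype Sᶜ (fun _ => Finset.mem_compl) f).symm

theorem sum_subtype_mem {M : Type*} [AddCommMonoid M] (S : Finset (Fin n)) (f : Fin n → M) :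
    ∑ i : {i // i ∈ S}, f i = ∑ i ∈ S, f i :=
  (Finset.sum_subtype S (fun _ => Iff.rfl) f).symm

/-- The Hopf vector of `(c, d)` has length `(‖c‖² + ‖d‖²) / 2`. -/
theorem norm_hopf (c d : ℂ) {t : ℝ} (ht : 0 ≤ t) (h : ‖c‖ ^ 2 + ‖d‖ ^ 2 = 2 * t) :
    ‖vec (c * conj d, (‖c‖ ^ 2 - ‖d‖ ^ 2) / 2)‖ = t := by
  rw [← sq_eq_sq₀ (norm_nonneg _) ht, norm_sq_vec, norm_mul, RCLike.norm_conj]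
  have : t = (‖c‖ ^ 2 + ‖d‖ ^ 2) / 2 := by linarith
  rw [this]
  ring

theorem sqrt_eq_half_add {a b t r : ℝ} (ht : a ^ 2 - b ^ 2 = 2 * t) (hr : r = a * b) :
    √(t ^ 2 + r ^ 2) = (a ^ 2 + b ^ 2) / 2 := by
  have : t ^ 2 + r ^ 2 = ((a ^ 2 + b ^ 2) / 2) ^ 2 := by
    subst hr
    linear_combination (-(a ^ 2 - b ^ 2) / 4 - t / 2) * ht
  rw [this, Real.sqrt_sq (by positivity)]

theorem isPolygonPair_polygonTuple {α : Fin n → ℝ} (hα : ∀ i, 0 < α i) {S : Finset (Fin n)}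
    {x : CotRep n} (hx : x ∈ stdSet α S) : IsPolygonPair α S (polygonTuple S x) := by
  obtain ⟨hS, hSc, h1, h2, h3, h4, h5⟩ := mem_stdSet_iff.1 hx
  refine ⟨?_, ?_, fun i => ?_, fun j => ?_, ?_⟩
  · simp only [polygonTuple]
    rw [← map_sum, ← map_add, sum_subtype_compl S fun j =>
      ((x.2 j 0 * conj (x.2 j 1), (‖x.2 j 0‖ ^ 2 - ‖x.2 j 1‖ ^ 2) / 2) : ℂ × ℝ)]
    have : ∀ a : ℂ × ℝ, a = 0 → vec a = 0 := fun a h => by rw [h, map_zero]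
    refine this _ (Prod.ext ?_ ?_)
    · rw [Prod.fst_add, Prod.fst_sum, h1]; simp
    · rw [Prod.snd_add, Prod.snd_sum, ← Finset.sum_div, ← add_div, h2]; simp
  · simp only [polygonTuple]
    rw [← map_sum, sum_subtype_mem S fun i => ((x.2 i 0 * x.1 i 1, 0) : ℂ × ℝ)]
    have : ∀ a : ℂ × ℝ, a = 0 → vec a = 0 := fun a h => by rw [h, map_zero]
    refine this _ (Prod.ext ?_ ?_)
    · rw [Prod.fst_sum, h5]; rfl
    · rw [Prod.snd_sum]; simp
  · simp [polygonTuple, inner_eq_coords]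
  · exact norm_hopf _ _ (hα j).le (h4 j j.2)
  · simp only [polygonTuple]
    have hnn : 0 ≤ (∑ i ∈ S, (‖x.2 i 0‖ ^ 2 + ‖x.1 i 1‖ ^ 2)) / 2 :=
      div_nonneg (Finset.sum_nonneg fun i _ => by positivity) zero_le_two
    have : ‖vec (0, (∑ i ∈ S, (‖x.2 i 0‖ ^ 2 + ‖x.1 i 1‖ ^ 2)) / 2)‖ =
        (∑ i ∈ S, (‖x.2 i 0‖ ^ 2 + ‖x.1 i 1‖ ^ 2)) / 2 := by
      rw [← sq_eq_sq₀ (norm_nonneg _) hnn, norm_sq_vec]; simp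
    rw [this, sum_subtype_mem S fun i =>
      √(α i ^ 2 + ‖vec (x.2 i 0 * x.1 i 1, 0)‖ ^ 2), Finset.sum_div]
    refine Finset.sum_congr rfl fun i hi => ?_
    rw [norm_sq_vec]
    simp only [norm_mul, ne_eq, OfNat.ofNat_ne_zero, not_false_eq_true, zero_pow, add_zero]
    exact (sqrt_eq_half_add (h3 i hi) rfl).symm

/-- The class of the pair of polygons of a standard point. -/
def polygonClass {α : Fin n → ℝ} (hα : ∀ i, 0 < α i) (S : Finset (Fin n)) (x : stdSet α S) :
    PolygonModuli α S :=
  toModuli α S ⟨polygonTuple S x, isPolygonPair_polygonTuple hα x.2⟩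

theorem continuous_polygonTuple (S : Finset (Fin n)) :
    Continuous (polygonTuple S : CotRep n → VectorTuple S) := by
  have hc : ∀ j k, Continuous fun x : CotRep n => conj (x.2 j k) := fun j k =>
    Complex.continuous_conj.comp (by fun_prop)
  refine Continuous.prodMk (continuous_pi fun i => ?_)
    (Continuous.prodMk (continuous_pi fun j => ?_) ?_)
  · exact continuous_vec.comp (by fun_prop)
  · exact continuous_vec.comp
      (Continuous.prodMk (Continuous.mul (by fun_prop) (hc _ _)) (by fun_prop))
  · exact continuous_vec.comp (by fun_prop)

theorem continuous_polygonClass {α : Fin n → ℝ} (hα : ∀ i, 0 < α i) (S : Finset (Fin n)) :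
    Continuous (polygonClass hα S) :=
  (isOpenQuotientMap_toModuli α S).continuous.comp
    (((continuous_polygonTuple S).comp continuous_subtype_val).subtype_mk _)

/-- The pairs of polygons of two standard points differ by a rotation about the vertical axis,
multiplication by `σ` on the horizontal plane. -/
def RotRel (S : Finset (Fin n)) (x y : CotRep n) : Prop :=
  ∃ σ : ℂ, ‖σ‖ = 1 ∧ (∀ i ∈ S, y.2 i 0 * y.1 i 1 = σ * (x.2 i 0 * x.1 i 1)) ∧
    ∀ j ∉ S, y.2 j 0 * conj (y.2 j 1) = σ * (x.2 j 0 * conj (x.2 j 1)) ∧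
      ‖y.2 j 0‖ ^ 2 - ‖y.2 j 1‖ ^ 2 = ‖x.2 j 0‖ ^ 2 - ‖x.2 j 1‖ ^ 2

/-- Since `w` is vertical and not zero, only rotations about the vertical axis can relate the pairs
of polygons of two standard points. -/
theorem polygonClass_eq_iff {α : Fin n → ℝ} (hα : ∀ i, 0 < α i) {S : Finset (Fin n)}
    (hne : S.Nonempty) (x y : stdSet α S) :
    polygonClass hα S x = polygonClass hα S y ↔ RotRel S (x : CotRep n) y := by
  refine toModuli_eq_iff.trans ⟨?_, ?_⟩
  · rintro ⟨R, hR, hu, hv, hw⟩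
    simp only [polygonTuple] at hu hv hw
    set a := (∑ i ∈ S, (‖x.1.2 i 0‖ ^ 2 + ‖x.1.1 i 1‖ ^ 2)) / 2 with ha
    set b := (∑ i ∈ S, (‖y.1.2 i 0‖ ^ 2 + ‖y.1.1 i 1‖ ^ 2)) / 2 with hb
    have hpos : ∀ z ∈ stdSet α S, 0 < (∑ i ∈ S, (‖z.2 i 0‖ ^ 2 + ‖z.1 i 1‖ ^ 2)) / 2 :=
      fun z hz => div_pos (Finset.sum_pos (fun i hi => by
        have := stdSet_norm_pos hα hz hi
        positivity) hne) two_pos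
    have ha0 : 0 < a := hpos x x.2
    have hb0 : 0 < b := hpos y y.2
    have hab : a = b := by
      rw [← sq_eq_sq₀ ha0.le hb0.le]
      have := R.norm_map (vec (0, a))
      rw [hw, ← sq_eq_sq₀ (norm_nonneg _) (norm_nonneg _), norm_sq_vec, norm_sq_vec] at this
      simpa using this.symm
    have hfix : R (vec (0, 1)) = vec (0, 1) := by
      have h1 : vec (0, a) = a • vec (0, 1) := by rw [← map_smul]; simp
      rw [← hab, h1, map_smul] at hw
      exact smul_right_injective _ ha0.ne' hw
    obtain ⟨σ, hσ, h⟩ := exists_rot_of_fix hR hfix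
    refine ⟨σ, hσ, fun i hi => ?_, fun j hj => ?_⟩
    · have := hu ⟨i, hi⟩
      rw [h] at this
      exact (congrArg Prod.fst (vec_injective this)).symm
    · have := hv ⟨j, hj⟩
      rw [h] at this
      have h2 := vec_injective this
      refine ⟨(congrArg Prod.fst h2).symm, ?_⟩
      have := congrArg Prod.snd h2
      simp only at this
      linarith
  · rintro ⟨σ, hσ, h1, h2⟩
    refine ⟨rot σ hσ, det_rot σ hσ, fun i => ?_, fun j => ?_, ?_⟩
    · simp only [polygonTuple, rot_vec, h1 i i.2]
    · simp only [polygonTuple, rot_vec, (h2 j j.2).1, (h2 j j.2).2]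
    · simp only [polygonTuple, rot_vec, mul_zero]
      have hx := (mem_stdSet_iff.1 x.2).2.2.2.1
      have hy := (mem_stdSet_iff.1 y.2).2.2.2.1
      have : ∑ j ∈ Sᶜ, (‖y.1.2 j 0‖ ^ 2 - ‖y.1.2 j 1‖ ^ 2) =
          ∑ j ∈ Sᶜ, (‖x.1.2 j 0‖ ^ 2 - ‖x.1.2 j 1‖ ^ 2) :=
        Finset.sum_congr rfl fun j hj => (h2 j (Finset.mem_compl.1 hj)).2
      congr 3
      linarith

/-- A vector of `ℂ²` is determined up to a phase by its Hopf vector and its norm. -/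
theorem exists_phase {c d c' d' : ℂ} (h : c' * conj d' = c * conj d)
    (hm : ‖c'‖ ^ 2 - ‖d'‖ ^ 2 = ‖c‖ ^ 2 - ‖d‖ ^ 2) (hp : ‖c'‖ ^ 2 + ‖d'‖ ^ 2 = ‖c‖ ^ 2 + ‖d‖ ^ 2) :
    ∃ e : ℂ, ‖e‖ = 1 ∧ c' = e * c ∧ d' = e * d := by
  have hc : ‖c'‖ = ‖c‖ := by
    rw [← sq_eq_sq₀ (norm_nonneg _) (norm_nonneg _)]; linarith
  have hd : ‖d'‖ = ‖d‖ := by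
    rw [← sq_eq_sq₀ (norm_nonneg _) (norm_nonneg _)]; linarith
  by_cases hd0 : d = 0
  · have hd0' : d' = 0 := by rw [hd0, norm_zero, norm_eq_zero] at hd; exact hd
    by_cases hc0 : c = 0
    · have hc0' : c' = 0 := by rw [hc0, norm_zero, norm_eq_zero] at hc; exact hc
      exact ⟨1, norm_one, by simp [hc0, hc0'], by simp [hd0, hd0']⟩
    · refine ⟨c' / c, ?_, by field_simp, by simp [hd0, hd0']⟩
      rw [norm_div, hc, div_self (norm_ne_zero_iff.2 hc0)]
  · refine ⟨d' / d, ?_, ?_, by field_simp⟩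
    · rw [norm_div, hd, div_self (norm_ne_zero_iff.2 hd0)]
    · have h1 : conj d * d = conj d' * d' := by
        rw [mul_comm, mul_comm (conj d'), Complex.mul_conj, Complex.mul_conj,
          Complex.normSq_eq_norm_sq, Complex.normSq_eq_norm_sq, hd]
      have hd0' : conj d' ≠ 0 := by
        rw [ne_eq, map_eq_zero, ← norm_eq_zero, hd, norm_eq_zero]; exact hd0
      rw [div_mul_eq_mul_div, eq_div_iff hd0]
      apply mul_right_cancel₀ hd0'
      linear_combination d * h + c * h1

/-- A unitary matrix relating two standard points fixes the line of the first basis vector, so it is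
diagonal with entries `s⁻¹, s`; it rotates the polygons by `σ = s²`.  The phases of the `q j` are
absorbed by the torus. -/
theorem stdClass_eq_iff {α : Fin n → ℝ} (hα : ∀ i, 0 < α i) {S : Finset (Fin n)}
    (hne : S.Nonempty) (x y : stdSet α S) :
    stdClass α S x = stdClass α S y ↔ RotRel S (x : CotRep n) y := by
  refine toSpace_eq_iff.trans ⟨?_, ?_⟩
  · rintro ⟨g, hg, h⟩
    rw [act_eq_unitaryAct hg] at h
    set M : Matrix (Fin 2) (Fin 2) ℂ := (g.1 : Matrix (Fin 2) (Fin 2) ℂ) with hMdef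
    have hM : M * star M = 1 := Matrix.mem_unitaryGroup_iff.1 hg.1
    have hdet : M.det = 1 := g.1.2
    have he := hg.2
    set e : Fin n → ℂ := fun i => (g.2 i : ℂ) with hedef
    change ∀ i, ‖e i‖ = 1 at he
    have he0 : ∀ i, e i ≠ 0 := fun i h => by simpa [h] using he i
    have he1 : ∀ i, conj (e i) * e i = 1 := fun i => by
      rw [mul_comm, Complex.mul_conj, Complex.normSq_eq_norm_sq, he]; simp
    have hq : ∀ i k, y.1.2 i k = e i * (conj (M 0 k) * x.1.2 i 0 + conj (M 1 k) * x.1.2 i 1) :=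
      fun i k => by
        rw [← h, unitaryAct_snd_apply]
    have hp : ∀ i k, y.1.1 i k = conj (e i) * (x.1.1 i 0 * M 0 k + x.1.1 i 1 * M 1 k) :=
      fun i k => by
        rw [← h, unitaryAct_fst_apply]
    have h01 : M 0 1 = 0 := by
      obtain ⟨i, hi⟩ := hne
      have h1 := hq i 1
      rw [(y.2.2.1 i hi).1, (x.2.2.1 i hi).1] at h1
      have h2 : x.1.2 i 0 ≠ 0 := norm_pos_iff.1 (stdSet_norm_pos hα x.2 hi)
      simpa [he0 i, h2] using h1.symm
    have h00 : M 0 0 * conj (M 0 0) = 1 := by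
      have := congrFun (congrFun hM 0) 0
      simpa [Matrix.mul_apply, Fin.sum_univ_two, Matrix.star_apply, h01] using this
    have hne0 : M 0 0 ≠ 0 := fun h => by simp [h] at h00
    have h10 : M 1 0 = 0 := by
      have := congrFun (congrFun hM 1) 0
      simpa [Matrix.mul_apply, Fin.sum_univ_two, Matrix.star_apply, h01, hne0] using this
    have h11 : M 1 1 = conj (M 0 0) := by
      rw [Matrix.det_fin_two, h01, zero_mul, sub_zero] at hdet
      exact mul_left_cancel₀ hne0 (hdet.trans h00.symm)
    have hs : ‖M 0 0‖ = 1 := by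
      rw [Complex.mul_conj, Complex.normSq_eq_norm_sq] at h00
      exact (pow_eq_one_iff_of_nonneg (norm_nonneg _) two_ne_zero).1 (by exact_mod_cast h00)
    refine ⟨conj (M 0 0) ^ 2, by simp [hs], fun i hi => ?_, fun j hj => ?_⟩
    · rw [hq, hp, h01, h10, h11, (x.2.2.1 i hi).1]
      linear_combination conj (M 0 0) ^ 2 * x.1.2 i 0 * x.1.1 i 1 * he1 i
    · have h1 : y.1.2 j 0 = e j * (conj (M 0 0) * x.1.2 j 0) := by rw [hq, h10]; simp
      have h2 : y.1.2 j 1 = e j * (M 0 0 * x.1.2 j 1) := by rw [hq, h01, h11]; simp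
      constructor
      · rw [h1, h2, map_mul, map_mul]
        linear_combination conj (M 0 0) ^ 2 * x.1.2 j 0 * conj (x.1.2 j 1) * he1 j
      · rw [h1, h2]
        simp only [norm_mul, RCLike.norm_conj, hs, he, one_mul]
  · rintro ⟨σ, hσ, h1, h2⟩
    obtain ⟨s, hs⟩ := IsAlgClosed.exists_pow_nat_eq σ two_pos
    replace hs := hs.symm
    have hs1 : ‖s‖ = 1 := by
      rw [hs, norm_pow] at hσ
      exact (pow_eq_one_iff_of_nonneg (norm_nonneg _) two_ne_zero).1 hσ
    have hss : s * conj s = 1 := by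
      rw [Complex.mul_conj, Complex.normSq_eq_norm_sq, hs1]; simp
    have hxS := mem_stdSet_iff.1 x.2
    have hyS := mem_stdSet_iff.1 y.2
    have hph : ∀ j ∉ S, ∃ e : ℂ, ‖e‖ = 1 ∧ y.1.2 j 0 = e * (s * x.1.2 j 0) ∧
        y.1.2 j 1 = e * (conj s * x.1.2 j 1) := fun j hj => by
      refine exists_phase ?_ ?_ ?_
      · rw [(h2 j hj).1, hs, map_mul, Complex.conj_conj]; ring
      · rw [(h2 j hj).2]; simp [hs1]
      · rw [hyS.2.2.2.2.2.1 j hj]; simp [hs1, hxS.2.2.2.2.2.1 j hj]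
    choose! e he heq0 heq1 using hph
    let e' : Fin n → ℂ := fun i => if i ∈ S then conj s else e i
    have he' : ∀ i, ‖e' i‖ = 1 := fun i => by
      by_cases hi : i ∈ S
      · simp [e', hi, hs1]
      · simp [e', hi, he i hi]
    have hM : !![conj s, 0; 0, s] * star !![conj s, 0; 0, s] = 1 := by
      ext i j
      fin_cases i <;> fin_cases j <;>
        simp [Matrix.mul_apply, Fin.sum_univ_two, Matrix.star_apply, hss, mul_comm (conj s) s]
    have hdet : (!![conj s, 0; 0, s]).det = 1 := by
      rw [Matrix.det_fin_two_of]; linear_combination hss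
    obtain ⟨g, hg, hgx⟩ := exists_act_eq_unitaryAct (Matrix.mem_unitaryGroup_iff.2 hM) hdet he'
    refine ⟨g, hg, ?_⟩
    rw [hgx]
    have hA : ∀ i ∈ S, x.1.2 i 0 = y.1.2 i 0 := fun i hi => by
      have e1 := sqrt_eq_half_add (hxS.2.2.2.2.1 i hi) rfl
      have e2 := sqrt_eq_half_add (hyS.2.2.2.2.1 i hi) rfl
      rw [← norm_mul] at e1 e2
      rw [h1 i hi, norm_mul, hσ, one_mul, e1] at e2
      have e3 := hxS.2.2.2.2.1 i hi
      have e4 := hyS.2.2.2.2.1 i hi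
      have e5 : ‖x.1.2 i 0‖ = ‖y.1.2 i 0‖ := by
        rw [← sq_eq_sq₀ (norm_nonneg _) (norm_nonneg _)]; linarith
      rw [(x.2.2.1 i hi).2.2, (y.2.2.1 i hi).2.2, e5]
    refine Prod.ext (funext fun i => ?_) (funext fun i => ?_)
    · by_cases hi : i ∈ S
      · have h3 := h1 i hi
        rw [← hA i hi] at h3
        have h4 : x.1.2 i 0 ≠ 0 := norm_pos_iff.1 (stdSet_norm_pos hα x.2 hi)
        have h5 : y.1.1 i 1 = σ * x.1.1 i 1 := by
          apply mul_left_cancel₀ h4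
          rw [h3]; ring
        funext k
        fin_cases k
        · simp [unitaryAct_fst_apply, (x.2.2.1 i hi).2.1, (y.2.2.1 i hi).2.1]
        · simp [unitaryAct_fst_apply, h5, e', hi, hs]
          ring
      · simp [unitaryAct, x.2.2.2 i hi, y.2.2.2 i hi]
    · funext k
      by_cases hi : i ∈ S
      · fin_cases k
        · simp [unitaryAct_snd_apply, e', hi, ← hA i hi]
          linear_combination x.1.2 i 0 * hss
        · simp [unitaryAct_snd_apply, (x.2.2.1 i hi).1, (y.2.2.1 i hi).1]
      · fin_cases k
        · simp [unitaryAct_snd_apply, e', hi, heq0 i hi]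
        · simp [unitaryAct_snd_apply, e', hi, heq1 i hi]

/-- The Hopf map is surjective. -/
theorem exists_hopf_lift (ζ : ℂ) (h : ℝ) : ∃ c d : ℂ, c * conj d = ζ ∧
    (‖c‖ ^ 2 - ‖d‖ ^ 2) / 2 = h := by
  set N := √(‖ζ‖ ^ 2 + h ^ 2) with hN
  have hNsq : N ^ 2 = ‖ζ‖ ^ 2 + h ^ 2 := Real.sq_sqrt (by positivity)
  have hN0 : 0 ≤ N := Real.sqrt_nonneg _
  have hle : 0 ≤ N + h := by nlinarith [abs_le_of_sq_le_sq (show h ^ 2 ≤ N ^ 2 by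
    rw [hNsq]; nlinarith [sq_nonneg ‖ζ‖]) hN0]
  rcases hle.eq_or_lt with h0 | hpos
  · have hz : ζ = 0 := by
      have : ‖ζ‖ ^ 2 = 0 := by
        have : h = -N := by linarith
        rw [this] at hNsq; linarith
      simpa using this
    refine ⟨0, (√(2 * N) : ℝ), by simp [hz], ?_⟩
    rw [Complex.norm_real, Real.norm_of_nonneg (Real.sqrt_nonneg _), Real.sq_sqrt (by positivity),
      norm_zero]
    linarith
  · have hs : 0 < √(N + h) := Real.sqrt_pos.2 hpos
    have hs' : ((√(N + h) : ℝ) : ℂ) ≠ 0 := by exact_mod_cast hs.ne'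
    refine ⟨(√(N + h) : ℝ), conj ζ / (√(N + h) : ℝ), ?_, ?_⟩
    · simp only [map_div₀, Complex.conj_conj, Complex.conj_ofReal]
      field_simp
    · rw [norm_div, RCLike.norm_conj, Complex.norm_real, Real.norm_of_nonneg hs.le, div_pow,
        Real.sq_sqrt hle]
      field_simp
      linear_combination hNsq

/-- The positive real `A` with `A² - (r / A)² = 2 t`. -/
def halfLength (t r : ℝ) : ℝ := √(t + √(t ^ 2 + r ^ 2))

theorem halfLength_pos {t : ℝ} (ht : 0 < t) (r : ℝ) : 0 < halfLength t r :=
  Real.sqrt_pos.2 (by positivity)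

theorem halfLength_sq {t : ℝ} (ht : 0 < t) (r : ℝ) :
    halfLength t r ^ 2 = t + √(t ^ 2 + r ^ 2) := Real.sq_sqrt (by positivity)

theorem div_halfLength_sq {t : ℝ} (ht : 0 < t) (r : ℝ) :
    (r / halfLength t r) ^ 2 = √(t ^ 2 + r ^ 2) - t := by
  have h : 0 < t + √(t ^ 2 + r ^ 2) := by positivity
  rw [div_pow, halfLength_sq ht, div_eq_iff h.ne']
  have := Real.sq_sqrt (show 0 ≤ t ^ 2 + r ^ 2 by positivity)
  linear_combination -this

/-- The standard point with prescribed products `q i p i = β i` for `i ∈ S` and prescribed `q j`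
for `j ∉ S`. -/
def stdPoint (α : Fin n → ℝ) (S : Finset (Fin n)) (β : Fin n → ℂ) (Q : Fin n → Fin 2 → ℂ) :
    CotRep n :=
  (fun i => if i ∈ S then ![0, β i / (halfLength (α i) ‖β i‖ : ℝ)] else 0,
   fun i => if i ∈ S then ![(halfLength (α i) ‖β i‖ : ℝ), 0] else Q i)

theorem stdPoint_mem {α : Fin n → ℝ} (hα : ∀ i, 0 < α i) {S : Finset (Fin n)} {β : Fin n → ℂ}
    {Q : Fin n → Fin 2 → ℂ} (h1 : ∑ j ∈ Sᶜ, Q j 0 * conj (Q j 1) = 0)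
    (h2 : ∑ i ∈ S, √(α i ^ 2 + ‖β i‖ ^ 2) + ∑ j ∈ Sᶜ, (‖Q j 0‖ ^ 2 - ‖Q j 1‖ ^ 2) / 2 = 0)
    (h3 : ∀ j ∉ S, ‖Q j 0‖ ^ 2 + ‖Q j 1‖ ^ 2 = 2 * α j) (h4 : ∑ i ∈ S, β i = 0) :
    stdPoint α S β Q ∈ stdSet α S := by
  have hA : ∀ i, ‖((halfLength (α i) ‖β i‖ : ℝ) : ℂ)‖ = halfLength (α i) ‖β i‖ := fun i => by
    rw [Complex.norm_real, Real.norm_of_nonneg (halfLength_pos (hα i) _).le]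
  have hA0 : ∀ i, ((halfLength (α i) ‖β i‖ : ℝ) : ℂ) ≠ 0 := fun i => by
    exact_mod_cast (halfLength_pos (hα i) _).ne'
  have hc : ∀ j ∈ Sᶜ, j ∉ S := fun j hj => Finset.mem_compl.1 hj
  rw [mem_stdSet_iff]
  refine ⟨fun i hi => ?_, fun j hj => ?_, ?_, ?_, fun i hi => ?_, fun j hj => ?_, ?_⟩
  · simp only [stdPoint, hi, if_true]
    simp [abs_of_pos (halfLength_pos (hα i) _)]
  · simp [stdPoint, hj]
  · rw [← h1]
    exact Finset.sum_congr rfl fun j hj => by simp [stdPoint, hc j hj]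
  · have e1 : ∀ i ∈ S, ‖(stdPoint α S β Q).2 i 0‖ ^ 2 + ‖(stdPoint α S β Q).1 i 1‖ ^ 2 =
        2 * √(α i ^ 2 + ‖β i‖ ^ 2) := fun i hi => by
      simp only [stdPoint, hi, if_true, Matrix.cons_val_zero, Matrix.cons_val_one, norm_div, hA,
        halfLength_sq (hα i), div_halfLength_sq (hα i)]
      ring
    have e2 : ∀ j ∈ Sᶜ, ‖(stdPoint α S β Q).2 j 0‖ ^ 2 - ‖(stdPoint α S β Q).2 j 1‖ ^ 2 =
        2 * ((‖Q j 0‖ ^ 2 - ‖Q j 1‖ ^ 2) / 2) := fun j hj => by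
      simp only [stdPoint, hc j hj, if_false]
      ring
    rw [Finset.sum_congr rfl e1, Finset.sum_congr rfl e2, ← Finset.mul_sum, ← Finset.mul_sum,
      ← mul_add, h2, mul_zero]
  · simp only [stdPoint, hi, if_true, Matrix.cons_val_zero, Matrix.cons_val_one, norm_div, hA,
      halfLength_sq (hα i), div_halfLength_sq (hα i)]
    ring
  · simp [stdPoint, hj, h3 j hj]
  · rw [← h4]
    refine Finset.sum_congr rfl fun i hi => ?_
    simp only [stdPoint, hi, if_true, Matrix.cons_val_zero, Matrix.cons_val_one]
    rw [mul_div_cancel₀ _ (hA0 i)]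

/-- Every pair of polygons with upward vertical `w` comes from a standard point: the `q j` are Hopf
lifts of the `v j`, and the lengths of `q i` and `p i` are determined by their product `u i`. -/
theorem exists_polygonTuple_eq {α : Fin n → ℝ} (hα : ∀ i, 0 < α i) {S : Finset (Fin n)}
    {z : VectorTuple S} (hz : IsPolygonPair α S z) {ω : ℝ} (hω : 0 < ω)
    (hw : z.2.2 = vec (0, ω)) : ∃ x ∈ stdSet α S, polygonTuple S x = z := by
  have hu : ∀ i, z.1 i = vec (⟨z.1 i 0, z.1 i 1⟩, 0) := fun i => by
    have h := hz.perp i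
    rw [hw, inner_eq_coords] at h
    have h2 : z.1 i 2 = 0 := by simpa [hω.ne'] using h
    conv_lhs => rw [← vec_coords (z.1 i), h2]
  choose c d hcd1 hcd2 using fun j => exists_hopf_lift ⟨z.2.1 j 0, z.2.1 j 1⟩ (z.2.1 j 2)
  have hv : ∀ j, z.2.1 j = vec (c j * conj (d j), (‖c j‖ ^ 2 - ‖d j‖ ^ 2) / 2) := fun j => by
    rw [hcd1, hcd2, vec_coords]
  let β : Fin n → ℂ := fun i => if h : i ∈ S then ⟨z.1 ⟨i, h⟩ 0, z.1 ⟨i, h⟩ 1⟩ else 0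
  let Q : Fin n → Fin 2 → ℂ := fun j => if h : j ∉ S then ![c ⟨j, h⟩, d ⟨j, h⟩] else 0
  have hβ : ∀ i : {i // i ∈ S}, z.1 i = vec (β i, 0) := fun i => by
    rw [hu i]; simp only [β, i.2, dif_pos]
  have hQ : ∀ j : {j // j ∉ S}, Q j = ![c j, d j] := fun j => by
    simp only [Q, j.2, not_false_eq_true, dif_pos]
  have hωn : ‖vec (0, ω)‖ = ω := by
    rw [← sq_eq_sq₀ (norm_nonneg _) hω.le, norm_sq_vec]; simp
  have hβn : ∀ i : {i // i ∈ S}, ‖z.1 i‖ ^ 2 = ‖β i‖ ^ 2 := fun i => by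
    rw [hβ, norm_sq_vec]; simp
  have hsum : ((0, ω) : ℂ × ℝ) + ∑ j : {j // j ∉ S},
      (Q j 0 * conj (Q j 1), (‖Q j 0‖ ^ 2 - ‖Q j 1‖ ^ 2) / 2) = 0 := by
    apply vec_injective
    rw [map_add, map_sum, map_zero, ← hw, ← hz.sum_v]
    congr 1
    refine Finset.sum_congr rfl fun j _ => ?_
    rw [hQ, hv]
    rfl
  rw [sum_subtype_compl S fun j =>
    ((Q j 0 * conj (Q j 1), (‖Q j 0‖ ^ 2 - ‖Q j 1‖ ^ 2) / 2) : ℂ × ℝ)] at hsum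
  have hmem : stdPoint α S β Q ∈ stdSet α S := by
    refine stdPoint_mem hα ?_ ?_ (fun j hj => ?_) ?_
    · have := congrArg Prod.fst hsum
      simpa [Prod.fst_sum] using this
    · have := congrArg Prod.snd hsum
      have h2 := hz.norm_w
      rw [hw, hωn] at h2
      simp only [hβn] at h2
      rw [sum_subtype_mem S fun i => √(α i ^ 2 + ‖β i‖ ^ 2)] at h2
      rw [← h2]
      simpa [Prod.snd_sum] using this
    · have h1 := norm_hopf (c ⟨j, hj⟩) (d ⟨j, hj⟩)
        (t := (‖c ⟨j, hj⟩‖ ^ 2 + ‖d ⟨j, hj⟩‖ ^ 2) / 2) (by positivity) (by ring)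
      rw [← hv, hz.norm_v] at h1
      have h2 := hQ ⟨j, hj⟩
      simp only at h1 h2
      rw [h2, h1]
      simp only [Matrix.cons_val_zero, Matrix.cons_val_one]
      ring
    · have : vec (∑ i ∈ S, β i, 0) = 0 := by
        rw [← hz.sum_u]
        simp only [hβ]
        rw [← map_sum, sum_subtype_mem S fun i => ((β i, 0) : ℂ × ℝ)]
        congr 1
        refine Prod.ext ?_ ?_
        · rw [Prod.fst_sum]
        · rw [Prod.snd_sum]; simp
      rw [← map_zero vec] at this
      exact congrArg Prod.fst (vec_injective this)
  refine ⟨_, hmem, Prod.ext (funext fun i => ?_) (Prod.ext (funext fun j => ?_) ?_)⟩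
  · rw [hβ]
    have h0 : ((halfLength (α i) ‖β i‖ : ℝ) : ℂ) ≠ 0 := by
      exact_mod_cast (halfLength_pos (hα i) _).ne'
    simp only [polygonTuple, stdPoint, i.2, if_true, Matrix.cons_val_zero, Matrix.cons_val_one]
    rw [mul_div_cancel₀ _ h0]
  · rw [hv]
    simp only [polygonTuple, stdPoint, j.2, if_false, hQ, Matrix.cons_val_zero,
      Matrix.cons_val_one]
  · have h1 := (isPolygonPair_polygonTuple hα hmem).sum_v
    have h2 := hz.sum_v
    have h3 : ∀ j, (polygonTuple S (stdPoint α S β Q)).2.1 j = z.2.1 j := fun j => by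
      rw [hv]
      simp only [polygonTuple, stdPoint, j.2, if_false, hQ, Matrix.cons_val_zero,
        Matrix.cons_val_one]
    simp only [h3] at h1
    exact add_right_cancel (h1.trans h2.symm)

theorem exists_polygonClass_eq {α : Fin n → ℝ} (hα : ∀ i, 0 < α i) {S : Finset (Fin n)}
    (hne : S.Nonempty) (z : PolygonPair α S) : ∃ (x : stdSet α S) (R : E3 ≃ₗᵢ[ℝ] E3),
      polygonTuple S x = (fun i => R (z.1.1 i), fun j => R (z.1.2.1 j), R z.1.2.2) ∧
      polygonClass hα S x = toModuli α S z := by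
  obtain ⟨R, hR, hRw⟩ := exists_rotation_to_vertical z.1.2.2
  have hpos : 0 < ‖z.1.2.2‖ := by
    rw [z.2.norm_w]
    obtain ⟨i, hi⟩ := hne
    exact Finset.sum_pos (fun i _ => Real.sqrt_pos.2 (by have := hα i; positivity))
      ⟨⟨i, hi⟩, Finset.mem_univ _⟩
  obtain ⟨x, hx, hxz⟩ := exists_polygonTuple_eq hα (z.2.rotate R) hpos hRw
  refine ⟨⟨x, hx⟩, R, hxz, ?_⟩
  rw [← toModuli_rotate hR z, polygonClass]
  congr 1
  exact Subtype.ext hxz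

/-- Two quotients of a space by the same equivalence relation are homeomorphic. -/
theorem exists_homeomorph_of_isQuotientMap {C X Y : Type*} [TopologicalSpace C]
    [TopologicalSpace X] [TopologicalSpace Y] {f : C → X} {g : C → Y} (hf : IsQuotientMap f)
    (hg : IsQuotientMap g) (h : ∀ a b, f a = f b ↔ g a = g b) :
    ∃ e : X ≃ₜ Y, ∀ c, e (f c) = g c := by
  have hF : ∀ c, g (Function.surjInv hf.surjective (f c)) = g c := fun c =>
    (h _ _).1 (Function.surjInv_eq hf.surjective _)
  have hG : ∀ c, f (Function.surjInv hg.surjective (g c)) = f c := fun c =>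
    (h _ _).2 (Function.surjInv_eq hg.surjective _)
  refine ⟨⟨⟨fun x => g (Function.surjInv hf.surjective x),
    fun y => f (Function.surjInv hg.surjective y), fun x => ?_, fun y => ?_⟩, ?_, ?_⟩, hF⟩
  · obtain ⟨c, rfl⟩ := hf.surjective x
    simp only [hF, hG]
  · obtain ⟨c, rfl⟩ := hg.surjective y
    simp only [hF, hG]
  · exact hf.continuous_iff.2 (hg.continuous.congr fun c => (hF c).symm)
  · exact hg.continuous_iff.2 (hf.continuous.congr fun c => (hG c).symm)

theorem isQuotientMap_of_compact {C X : Type*} [TopologicalSpace C] [TopologicalSpace X]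
    [CompactSpace C] [T2Space X] {f : C → X} (hf : Continuous f) (hs : Function.Surjective f) :
    IsQuotientMap f :=
  hf.isClosedMap.isQuotientMap hf hs

/-- The classes of standard points form a space homeomorphic to the moduli space of pairs of
polygons. -/
theorem exists_homeomorph_range {α : Fin n → ℝ} (hα : ∀ i, 0 < α i) {S : Finset (Fin n)}
    (hne : S.Nonempty) : ∃ e : Set.range (stdClass α S) ≃ₜ PolygonModuli α S,
      ∀ x, e ⟨stdClass α S x, Set.mem_range_self x⟩ = polygonClass hα S x := by
  have := isCompact_iff_compactSpace.1 (isCompact_stdSet hα S)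
  refine exists_homeomorph_of_isQuotientMap
    (f := fun x => (⟨stdClass α S x, Set.mem_range_self x⟩ : Set.range (stdClass α S)))
    (isQuotientMap_of_compact ((continuous_stdClass α S).subtype_mk _) ?_)
    (isQuotientMap_of_compact (continuous_polygonClass hα S) ?_) fun x y => ?_
  · rintro ⟨_, x, rfl⟩
    exact ⟨x, rfl⟩
  · intro m
    obtain ⟨z, rfl⟩ := (isOpenQuotientMap_toModuli α S).surjective m
    obtain ⟨x, _, _, hx⟩ := exists_polygonClass_eq hα hne z
    exact ⟨x, hx⟩
  · rw [← Subtype.coe_inj, polygonClass_eq_iff hα hne]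
    exact stdClass_eq_iff hα hne x y

/-! ### Solving the real moment map equation along the flow -/

section Balance

variable {ι : Type*}

/-- The length `∑ √(αᵢ² + e²ˢ bᵢ²)` of the vertical vector after rescaling. -/
def scaledLength (I : Finset ι) (α b : ι → ℝ) (s : ℝ) : ℝ :=
  ∑ i ∈ I, √(α i ^ 2 + (Real.exp s * b i) ^ 2)

theorem continuous_scaledLength (I : Finset ι) (α b : ι → ℝ) :
    Continuous (scaledLength I α b) := by
  unfold scaledLength; fun_prop

/-- An antiderivative in `s` of the length of the vertical vector minus `a`. -/
def potential (I : Finset ι) (α b : ι → ℝ) (a s : ℝ) : ℝ :=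
  (∫ t in (0 : ℝ)..s, scaledLength I α b t) - a * s

theorem hasDerivAt_potential (I : Finset ι) (α b : ι → ℝ) (a s : ℝ) :
    HasDerivAt (potential I α b a) (scaledLength I α b s - a) s := by
  have h1 := ((continuous_scaledLength I α b).integral_hasStrictDerivAt 0 s).hasDerivAt
  have h2 : HasDerivAt (fun s : ℝ => a * s) a s := by
    simpa using (hasDerivAt_id s).const_mul a
  exact h1.sub h2

/-- As `s → -∞` the length decreases to `∑ αᵢ < a`, so the potential grows linearly. -/
theorem tendsto_potential_atBot {I : Finset ι} {α b : ι → ℝ} (hα : ∀ i, 0 ≤ α i)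
    (hb : ∀ i, 0 ≤ b i) {a : ℝ} (ha : ∑ i ∈ I, α i < a) :
    Tendsto (potential I α b a) atBot atTop := by
  set A := ∑ i ∈ I, α i with hA
  set B := ∑ i ∈ I, b i with hB
  have hlin : Tendsto (fun s : ℝ => (a - A) * (-s) - B) atBot atTop :=
    tendsto_atTop_add_const_right _ _
      (Tendsto.const_mul_atTop (sub_pos.2 ha) tendsto_neg_atBot_atTop)
  refine tendsto_atTop_mono' _ ?_ hlin
  filter_upwards [eventually_le_atBot 0] with s hs
  have hg : ∀ t, scaledLength I α b t ≤ A + B * Real.exp t := fun t => by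
    rw [hA, hB, Finset.sum_mul, ← Finset.sum_add_distrib]
    refine Finset.sum_le_sum fun i _ => ?_
    have h1 := hα i
    have h2 := mul_nonneg (hb i) (Real.exp_pos t).le
    rw [Real.sqrt_le_left (by positivity)]
    nlinarith [mul_nonneg h1 h2]
  have hint : ∫ t in s..0, scaledLength I α b t ≤ ∫ t in s..0, (A + B * Real.exp t) := by
    refine intervalIntegral.integral_mono_on hs
      ((continuous_scaledLength I α b).intervalIntegrable _ _)
      (Continuous.intervalIntegrable (by fun_prop) _ _) fun t _ => hg t
  have hval : ∫ t in s..0, (A + B * Real.exp t) = A * (-s) + B * (1 - Real.exp s) := by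
    rw [intervalIntegral.integral_add (by simp)
      (Continuous.intervalIntegrable (by fun_prop) _ _), intervalIntegral.integral_const_mul,
      integral_exp]
    simp
    ring
  have hB0 : 0 ≤ B := Finset.sum_nonneg fun i _ => hb i
  have := mul_nonneg hB0 (Real.exp_pos s).le
  rw [potential, intervalIntegral.integral_symm]
  nlinarith

/-- As `s → ∞` a single nonzero `b i₀` makes the length grow exponentially. -/
theorem tendsto_potential_atTop {I : Finset ι} {α b : ι → ℝ} {i₀ : ι}
    (hi₀ : i₀ ∈ I) (hpos : 0 < b i₀) (a : ℝ) : Tendsto (potential I α b a) atTop atTop := by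
  have hlin : Tendsto (fun s : ℝ => s * (b i₀ / 2 * s + (b i₀ - a))) atTop atTop :=
    tendsto_id.atTop_mul_atTop₀ (tendsto_atTop_add_const_right _ _
      (Tendsto.const_mul_atTop (half_pos hpos) tendsto_id))
  refine tendsto_atTop_mono' _ ?_ hlin
  filter_upwards [eventually_ge_atTop 0] with s hs
  have hg : ∀ t, b i₀ * Real.exp t ≤ scaledLength I α b t := fun t => by
    refine le_trans ?_ (Finset.single_le_sum
      (f := fun i => √(α i ^ 2 + (Real.exp t * b i) ^ 2)) (fun i _ => Real.sqrt_nonneg _) hi₀)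
    apply Real.le_sqrt_of_sq_le
    nlinarith [sq_nonneg (α i₀)]
  have hint : ∫ t in (0 : ℝ)..s, b i₀ * Real.exp t ≤ ∫ t in (0 : ℝ)..s, scaledLength I α b t :=
    intervalIntegral.integral_mono_on hs (Continuous.intervalIntegrable (by fun_prop) _ _)
      ((continuous_scaledLength I α b).intervalIntegrable _ _) fun t _ => hg t
  rw [intervalIntegral.integral_const_mul, integral_exp, Real.exp_zero] at hint
  have hq := Real.quadratic_le_exp_of_nonneg hs
  rw [potential]
  nlinarith

/-- The function of `x = (s, c)` whose critical points solve the real moment map equation for the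
data rescaled by `eˢ` and translated by `c`: the Kempf-Ness function of the upper triangular
subgroup. -/
def energy (I J : Finset ι) (α b : ι → ℝ) (ζ : ι → ℂ) (x : ℝ × ℂ) : ℝ :=
  potential I α b (∑ j ∈ J, α j) x.1 +
    ∑ j ∈ J, α j * Real.log (1 + ‖(Real.exp x.1) • ζ j + x.2‖ ^ 2)

theorem continuous_energy (I J : Finset ι) (α b : ι → ℝ) (ζ : ι → ℂ) :
    Continuous (energy I J α b ζ) := by
  have h1 : Continuous (potential I α b (∑ j ∈ J, α j)) :=
    continuous_iff_continuousAt.2 fun s => (hasDerivAt_potential I α b _ s).continuousAt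
  unfold energy
  refine (h1.comp continuous_fst).add (continuous_finsetSum _ fun j _ =>
    continuous_const.mul (Continuous.log (by fun_prop) fun x => ?_))
  positivity

/-- The energy is proper: the potential controls `s`, and the term of a point at the origin
controls `c`. -/
theorem tendsto_energy {I J : Finset ι} {α b : ι → ℝ} {ζ : ι → ℂ} (hα : ∀ i, 0 < α i)
    (hb : ∀ i, 0 ≤ b i) {i₀ j₀ : ι} (hi₀ : i₀ ∈ I) (hpos : 0 < b i₀) (hj₀ : j₀ ∈ J)
    (hζ : ζ j₀ = 0) (hshort : ∑ i ∈ I, α i < ∑ j ∈ J, α j) :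
    Tendsto (energy I J α b ζ) (cocompact (ℝ × ℂ)) atTop := by
  have hk : Tendsto (potential I α b (∑ j ∈ J, α j)) (cocompact ℝ) atTop := by
    rw [cocompact_eq_atBot_atTop]
    exact (tendsto_potential_atBot (fun i => (hα i).le) hb hshort).sup
      (tendsto_potential_atTop hi₀ hpos _)
  have hkc : Continuous (potential I α b (∑ j ∈ J, α j)) :=
    continuous_iff_continuousAt.2 fun s => (hasDerivAt_potential I α b _ s).continuousAt
  obtain ⟨s₁, hs₁⟩ := hkc.exists_forall_le hk
  have hl : Tendsto (fun c : ℂ => α j₀ * Real.log (1 + ‖c‖ ^ 2)) (cocompact ℂ) atTop := by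
    refine Tendsto.const_mul_atTop (hα j₀) (Real.tendsto_log_atTop.comp ?_)
    exact tendsto_atTop_add_const_left _ _
      ((tendsto_pow_atTop two_ne_zero).comp (tendsto_norm_cocompact_atTop))
  have hle : ∀ x : ℝ × ℂ, potential I α b (∑ j ∈ J, α j) x.1 +
      α j₀ * Real.log (1 + ‖x.2‖ ^ 2) ≤ energy I J α b ζ x := fun x => by
    refine add_le_add le_rfl ?_
    have := Finset.single_le_sum
      (f := fun j => α j * Real.log (1 + ‖(Real.exp x.1) • ζ j + x.2‖ ^ 2))
      (fun j _ => mul_nonneg (hα j).le (Real.log_nonneg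
        (le_add_of_nonneg_right (by positivity)))) hj₀
    simpa [hζ] using this
  refine tendsto_atTop_mono hle ?_
  rw [← coprod_cocompact, Filter.coprod]
  refine Tendsto.sup ?_ ?_
  · refine tendsto_atTop_mono (fun x => le_add_of_nonneg_right ?_) (hk.comp tendsto_comap)
    exact mul_nonneg (hα j₀).le (Real.log_nonneg (by nlinarith [sq_nonneg ‖x.2‖]))
  · exact tendsto_atTop_add_left_of_le _ _ (fun x => hs₁ x.1) (hl.comp tendsto_comap)

/-- Critical points of the energy solve the balance equations. -/
theorem balance_of_isMin {I J : Finset ι} {α b : ι → ℝ} {ζ : ι → ℂ} {s : ℝ} {c : ℂ}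
    (h : ∀ x, energy I J α b ζ (s, c) ≤ energy I J α b ζ x) {z : ι → ℂ}
    (hz : ∀ j, z j = (Real.exp s) • ζ j + c) :
    ∑ j ∈ J, (α j / (1 + ‖z j‖ ^ 2)) • z j = 0 ∧
    ∑ j ∈ J, α j * ((1 - ‖z j‖ ^ 2) / (1 + ‖z j‖ ^ 2)) = scaledLength I α b s := by
  have hlog : ∀ (j : ι) {f : ℝ → ℂ} {f' : ℂ} {t : ℝ}, HasDerivAt f f' t → f t = z j →
      HasDerivAt (fun t => α j * Real.log (1 + ‖f t‖ ^ 2))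
        (2 * inner ℝ ((α j / (1 + ‖z j‖ ^ 2)) • z j) f') t := fun j f f' t hf hft => by
    have h0 : (1 + ‖f t‖ ^ 2) ≠ 0 := by positivity
    have := ((hf.norm_sq.const_add 1).log h0).const_mul (α j)
    convert! this using 1
    rw [hft, real_inner_smul_left]
    ring
  have h1 : ∑ j ∈ J, (α j / (1 + ‖z j‖ ^ 2)) • z j = 0 := by
    set d := ∑ j ∈ J, (α j / (1 + ‖z j‖ ^ 2)) • z j with hd
    have hder : HasDerivAt (fun t : ℝ => energy I J α b ζ (s, c + t • d))
        (0 + ∑ j ∈ J, 2 * inner ℝ ((α j / (1 + ‖z j‖ ^ 2)) • z j) d) 0 := by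
      have h3 : HasDerivAt (fun _ : ℝ => potential I α b (∑ j ∈ J, α j) s) 0 0 :=
        hasDerivAt_const _ _
      refine h3.fun_add (HasDerivAt.fun_sum fun j _ => ?_)
      refine hlog j ?_ (by simp [hz])
      have h2 : HasDerivAt (fun t : ℝ => t • d) d 0 := by
        simpa using (hasDerivAt_id (0 : ℝ)).smul_const d
      exact (h2.const_add c).const_add (Real.exp s • ζ j)
    have hmin : IsLocalMin (fun t : ℝ => energy I J α b ζ (s, c + t • d)) 0 :=
      Eventually.of_forall fun t => by simpa using h (s, c + t • d)
    have h0 := hmin.hasDerivAt_eq_zero hder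
    rw [zero_add, ← Finset.mul_sum, ← sum_inner, ← hd] at h0
    exact inner_self_eq_zero.1 ((mul_eq_zero.1 h0).resolve_left two_ne_zero)
  refine ⟨h1, ?_⟩
  have hder : HasDerivAt (fun t : ℝ => energy I J α b ζ (t, c))
      ((scaledLength I α b s - ∑ j ∈ J, α j) +
        ∑ j ∈ J, 2 * inner ℝ ((α j / (1 + ‖z j‖ ^ 2)) • z j) (Real.exp s • ζ j)) s := by
    refine (hasDerivAt_potential I α b _ s).fun_add (HasDerivAt.fun_sum fun j _ => ?_)
    exact hlog j (((Real.hasDerivAt_exp s).smul_const (ζ j)).add_const c) (hz j).symm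
  have hmin : IsLocalMin (fun t : ℝ => energy I J α b ζ (t, c)) s :=
    Eventually.of_forall fun t => h (t, c)
  have h0 := hmin.hasDerivAt_eq_zero hder
  have h2 : ∑ j ∈ J, 2 * inner ℝ ((α j / (1 + ‖z j‖ ^ 2)) • z j) (Real.exp s • ζ j) =
      ∑ j ∈ J, α j * (2 * ‖z j‖ ^ 2 / (1 + ‖z j‖ ^ 2)) := by
    have h3 : ∀ j, Real.exp s • ζ j = z j - c := fun j => by rw [hz]; ring
    simp only [h3, inner_sub_right, mul_sub, Finset.sum_sub_distrib]
    rw [← Finset.mul_sum J (fun j => inner ℝ ((α j / (1 + ‖z j‖ ^ 2)) • z j) c), ← sum_inner, h1,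
      inner_zero_left, mul_zero, sub_zero]
    refine Finset.sum_congr rfl fun j _ => ?_
    rw [real_inner_smul_left, real_inner_self_eq_norm_sq]
    ring
  rw [h2] at h0
  have h4 : ∑ j ∈ J, α j * ((1 - ‖z j‖ ^ 2) / (1 + ‖z j‖ ^ 2)) =
      ∑ j ∈ J, α j - ∑ j ∈ J, α j * (2 * ‖z j‖ ^ 2 / (1 + ‖z j‖ ^ 2)) := by
    rw [← Finset.sum_sub_distrib]
    refine Finset.sum_congr rfl fun j _ => ?_
    have : (1 + ‖z j‖ ^ 2) ≠ 0 := by positivity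
    field_simp
    ring
  linarith

/-- Points of `ℂ` can be moved by an affine map `z ↦ l z + c`, `l > 0`, to a position in which their
weighted stereographic images sum to a vertical vector of the prescribed length. -/
theorem exists_balance {I J : Finset ι} {α b : ι → ℝ} (hα : ∀ i, 0 < α i)
    (hb : ∀ i, 0 ≤ b i) {i₀ : ι} (hi₀ : i₀ ∈ I) (hpos : 0 < b i₀)
    (hshort : ∑ i ∈ I, α i < ∑ j ∈ J, α j) (ζ : ι → ℂ) :
    ∃ (l : ℝ) (c : ℂ), 0 < l ∧
      ∑ j ∈ J, (α j / (1 + ‖l • ζ j + c‖ ^ 2)) • (l • ζ j + c) = 0 ∧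
      ∑ j ∈ J, α j * ((1 - ‖l • ζ j + c‖ ^ 2) / (1 + ‖l • ζ j + c‖ ^ 2)) =
        ∑ i ∈ I, √(α i ^ 2 + (l * b i) ^ 2) := by
  have hJ : J.Nonempty := by
    rw [Finset.nonempty_iff_ne_empty]
    rintro rfl
    rw [Finset.sum_empty] at hshort
    exact absurd (Finset.sum_nonneg fun i _ => (hα i).le) (not_le.2 hshort)
  obtain ⟨j₀, hj₀⟩ := hJ
  -- Translating so that one of the points is the origin makes the energy proper.
  obtain ⟨⟨s, c⟩, hmin⟩ := (continuous_energy I J α b fun j => ζ j - ζ j₀).exists_forall_le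
    (tendsto_energy hα hb hi₀ hpos hj₀ (sub_self _) hshort)
  obtain ⟨h1, h2⟩ := balance_of_isMin hmin
    (z := fun j => Real.exp s • ζ j + (c - Real.exp s • ζ j₀)) fun j => by
      rw [smul_sub]; ring
  exact ⟨Real.exp s, c - Real.exp s • ζ j₀, Real.exp_pos s, h1, h2⟩

/-- The translation that balances points in a disc about the origin is bounded by its radius. -/
theorem norm_le_of_balance {J : Finset ι} {α : ι → ℝ} (hα : ∀ i, 0 < α i) (hJ : J.Nonempty)
    {δ : ι → ℂ} {c : ℂ} {r : ℝ} (hr : ∀ j ∈ J, ‖δ j‖ ≤ r)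
    (h : ∑ j ∈ J, (α j / (1 + ‖δ j + c‖ ^ 2)) • (δ j + c) = 0) : ‖c‖ ≤ r := by
  by_contra! hlt
  have h0 : 0 < inner ℝ (∑ j ∈ J, (α j / (1 + ‖δ j + c‖ ^ 2)) • (δ j + c)) c := by
    rw [sum_inner]
    refine Finset.sum_pos (fun j hj => ?_) hJ
    rw [real_inner_smul_left]
    refine mul_pos (div_pos (hα j) (by positivity)) ?_
    rw [inner_add_left, real_inner_self_eq_norm_sq]
    have h1 := neg_le_of_abs_le (abs_real_inner_le_norm (δ j) c)
    have h2 := hr j hj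
    nlinarith [norm_nonneg (δ j), norm_nonneg c]
  rw [h, inner_zero_left] at h0
  exact lt_irrefl _ h0

end Balance

/-! ### Invariants of the complex group and limits of the flow -/

theorem act_fst_apply (x : CotRep n) (g : ComplexGroup n) (i : Fin n) (k : Fin 2) :
    (act x g).1 i k = ((g.2 i : ℂ))⁻¹ * (x.1 i 0 * g.1.1 0 k + x.1 i 1 * g.1.1 1 k) := by
  change ((g.2 i : ℂ))⁻¹ * (x.1 i ᵥ* g.1.1) k = _
  rw [Matrix.vecMul, dotProduct, Fin.sum_univ_two]

theorem act_snd_apply_zero (x : CotRep n) (g : ComplexGroup n) (i : Fin n) :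
    (act x g).2 i 0 = (g.2 i : ℂ) * (g.1.1 1 1 * x.2 i 0 - g.1.1 0 1 * x.2 i 1) := by
  change (g.2 i : ℂ) * (((g.1⁻¹ : Matrix.SpecialLinearGroup (Fin 2) ℂ) :
      Matrix (Fin 2) (Fin 2) ℂ) *ᵥ x.2 i) 0 = _
  rw [Matrix.mulVec, dotProduct, Fin.sum_univ_two, Matrix.SpecialLinearGroup.coe_inv,
    Matrix.adjugate_fin_two]
  simp
  ring

theorem act_snd_apply_one (x : CotRep n) (g : ComplexGroup n) (i : Fin n) :
    (act x g).2 i 1 = (g.2 i : ℂ) * (g.1.1 0 0 * x.2 i 1 - g.1.1 1 0 * x.2 i 0) := by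
  change (g.2 i : ℂ) * (((g.1⁻¹ : Matrix.SpecialLinearGroup (Fin 2) ℂ) :
      Matrix (Fin 2) (Fin 2) ℂ) *ᵥ x.2 i) 1 = _
  rw [Matrix.mulVec, dotProduct, Fin.sum_univ_two, Matrix.SpecialLinearGroup.coe_inv,
    Matrix.adjugate_fin_two]
  simp
  ring

/-- The pairing `p i q k`. -/
def pairing (x : CotRep n) (i k : Fin n) : ℂ := x.1 i 0 * x.2 k 0 + x.1 i 1 * x.2 k 1

/-- The determinant of `q i` and `q k`. -/
def bracket (x : CotRep n) (i k : Fin n) : ℂ := x.2 i 0 * x.2 k 1 - x.2 i 1 * x.2 k 0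

theorem pairing_act (x : CotRep n) (g : ComplexGroup n) (i k : Fin n) :
    pairing (act x g) i k = ((g.2 i : ℂ))⁻¹ * (g.2 k : ℂ) * pairing x i k := by
  have hd : g.1.1 0 0 * g.1.1 1 1 - g.1.1 0 1 * g.1.1 1 0 = 1 := by
    rw [← Matrix.det_fin_two]; exact g.1.2
  simp only [pairing, act_fst_apply, act_snd_apply_zero, act_snd_apply_one]
  linear_combination ((g.2 i : ℂ))⁻¹ * (g.2 k : ℂ) *
    (x.1 i 0 * x.2 k 0 + x.1 i 1 * x.2 k 1) * hd

theorem bracket_act (x : CotRep n) (g : ComplexGroup n) (i k : Fin n) :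
    bracket (act x g) i k = (g.2 i : ℂ) * (g.2 k : ℂ) * bracket x i k := by
  have hd : g.1.1 0 0 * g.1.1 1 1 - g.1.1 0 1 * g.1.1 1 0 = 1 := by
    rw [← Matrix.det_fin_two]; exact g.1.2
  simp only [bracket, act_snd_apply_zero, act_snd_apply_one]
  linear_combination (g.2 i : ℂ) * (g.2 k : ℂ) *
    (x.2 i 0 * x.2 k 1 - x.2 i 1 * x.2 k 0) * hd

theorem pairing_scale (τ : ℂˣ) (x : CotRep n) (i k : Fin n) :
    pairing (scale τ x) i k = τ * pairing x i k := by
  simp [pairing, scale]; ring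

theorem bracket_scale (τ : ℂˣ) (x : CotRep n) (i k : Fin n) :
    bracket (scale τ x) i k = bracket x i k := rfl

theorem scale_act (τ : ℂˣ) (x : CotRep n) (g : ComplexGroup n) :
    scale τ (act x g) = act (scale τ x) g := by
  refine Prod.ext (funext fun i => funext fun k => ?_) rfl
  rw [act_fst_apply]
  change (τ : ℂ) * (act x g).1 i k = _
  rw [act_fst_apply]
  change _ = _ * (((τ : ℂ) * x.1 i 0) * _ + ((τ : ℂ) * x.1 i 1) * _)
  ring

theorem continuous_pairing (i k : Fin n) : Continuous fun x : CotRep n => pairing x i k := by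
  unfold pairing; fun_prop

theorem continuous_bracket (i k : Fin n) : Continuous fun x : CotRep n => bracket x i k := by
  unfold bracket; fun_prop

/-- The filter `τ → ∞` on the nonzero complex numbers. -/
abbrev unitsAtInfty : Filter ℂˣ := comap (fun τ : ℂˣ => ‖(τ : ℂ)‖) atTop

theorem neBot_unitsAtInfty : NeBot unitsAtInfty := by
  refine comap_neBot fun s hs => ?_
  obtain ⟨R, hR⟩ := mem_atTop_sets.1 hs
  have h0 : (0 : ℝ) < max R 1 := lt_max_of_lt_right one_pos
  refine ⟨Units.mk0 ((max R 1 : ℝ) : ℂ) (by exact_mod_cast h0.ne'), hR _ ?_⟩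
  rw [Units.val_mk0, Complex.norm_real, Real.norm_of_nonneg h0.le]
  exact le_max_left _ _

/-- If `τ · [x]` tends to `[y]`, then the complex orbit of `τ · x` meets every neighbourhood of `y`
for large `τ`. -/
theorem eventually_exists_act_mem {α : Fin n → ℝ} {x y : levelSet α} {f : ℂˣ → Space α}
    (hf : ∀ τ, IsScaling α τ (toSpace α x) (f τ))
    (hlim : Tendsto f unitsAtInfty (𝓝 (toSpace α y))) {V : Set (CotRep n)}
    (hV : V ∈ 𝓝 (y : CotRep n)) :
    ∀ᶠ τ in unitsAtInfty, ∃ g : ComplexGroup n, act (scale τ (x : CotRep n)) g ∈ V := by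
  have h1 : (Subtype.val ⁻¹' V : Set (levelSet α)) ∈ 𝓝 y :=
    continuous_subtype_val.continuousAt hV
  filter_upwards [hlim ((isOpenQuotientMap_toSpace α).isOpenMap.image_mem_nhds h1)] with τ hτ
  obtain ⟨y₁, hy₁, hfy⟩ := hτ
  obtain ⟨x₂, y₂, hx, hy, g, hg⟩ := hf τ
  obtain ⟨k, -, hk⟩ := toSpace_eq_iff.1 hx.symm
  obtain ⟨k', -, hk'⟩ := toSpace_eq_iff.1 (hy.trans hfy.symm)
  refine ⟨k * g * k', ?_⟩
  rw [act_mul, act_mul, ← scale_act, hk, hg, hk']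
  exact hy₁

/-- A quantity `W` vanishes if `τᵏ W` is the value of `F₁ C / F₂` at points that, for large `τ`,
come arbitrarily close to `y`, where this quotient is bounded. -/
theorem eq_zero_of_bounded {X : Type*} [TopologicalSpace X] {y : X} {P : ℂˣ → X → Prop}
    (hP : ∀ V ∈ 𝓝 y, ∀ᶠ τ in unitsAtInfty, ∃ z ∈ V, P τ z) {F₁ F₂ : X → ℂ}
    (h₁ : Continuous F₁) (h₂ : Continuous F₂) (hy : F₂ y ≠ 0) {W C : ℂ} {k : ℕ} (hk : k ≠ 0)
    (h : ∀ τ z, P τ z → (τ : ℂ) ^ k * W * F₂ z = F₁ z * C) : W = 0 := by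
  by_contra hW
  have hn := neBot_unitsAtInfty
  set δ := ‖F₂ y‖ / 2 with hδ
  have hδ0 : 0 < δ := half_pos (norm_pos_iff.2 hy)
  have hV : {z | ‖F₁ z‖ < ‖F₁ y‖ + 1} ∩ {z | δ < ‖F₂ z‖} ∈ 𝓝 y := by
    refine inter_mem ?_ ?_
    · exact h₁.norm.continuousAt.eventually_lt continuousAt_const (lt_add_one _)
    · exact continuousAt_const.eventually_lt h₂.norm.continuousAt
        (half_lt_self (norm_pos_iff.2 hy))
  have hT : Tendsto (fun τ : ℂˣ => ‖(τ : ℂ)‖ ^ k * (‖W‖ * δ)) unitsAtInfty atTop :=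
    ((tendsto_pow_atTop hk).comp tendsto_comap).atTop_mul_const
      (mul_pos (norm_pos_iff.2 hW) hδ0)
  obtain ⟨τ, ⟨z, ⟨hz1, hz2⟩, hz⟩, hτ⟩ :=
    ((hP _ hV).and (hT.eventually_gt_atTop ((‖F₁ y‖ + 1) * ‖C‖))).exists
  have h3 := congrArg norm (h τ z hz)
  simp only [norm_mul, norm_pow] at h3
  have h4 : ‖(τ : ℂ)‖ ^ k * (‖W‖ * δ) ≤ ‖(τ : ℂ)‖ ^ k * ‖W‖ * ‖F₂ z‖ := by
    rw [← mul_assoc]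
    exact mul_le_mul_of_nonneg_left hz2.le (by positivity)
  have h5 : ‖F₁ z‖ * ‖C‖ ≤ (‖F₁ y‖ + 1) * ‖C‖ :=
    mul_le_mul_of_nonneg_right hz1.le (norm_nonneg _)
  linarith

/-- If also the complement of `S` is straight, the `q j`, `j ∉ S`, are multiples of the second
basis vector. -/
theorem stdSet_of_straight_compl {α : Fin n → ℝ} (hα : ∀ i, 0 < α i) {S : Finset (Fin n)}
    {y : CotRep n} (hy : y ∈ stdSet α S) (hS : Straight y Sᶜ) {j : Fin n} (hj : j ∉ S) :
    y.2 j 0 = 0 ∧ y.2 j 1 ≠ 0 := by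
  obtain ⟨-, -, h1, h2, -, h4, -⟩ := mem_stdSet_iff.1 hy
  have hjc : j ∈ Sᶜ := Finset.mem_compl.2 hj
  choose! c hc using fun i hi => hS i hi j hjc
  have h5 : y.2 j 1 ≠ 0 := fun h0 => by
    have h6 : ∀ k ∈ Sᶜ, ‖y.2 k 0‖ ^ 2 - ‖y.2 k 1‖ ^ 2 = 2 * α k := fun k hk => by
      rw [← h4 k (Finset.mem_compl.1 hk), hc k hk]
      simp [h0]
    rw [Finset.sum_congr rfl h6] at h2
    have h7 : 0 ≤ ∑ i ∈ S, (‖y.2 i 0‖ ^ 2 + ‖y.1 i 1‖ ^ 2) :=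
      Finset.sum_nonneg fun i _ => by positivity
    have h8 : 0 < ∑ k ∈ Sᶜ, 2 * α k :=
      Finset.sum_pos (fun k _ => by linarith [hα k]) ⟨j, hjc⟩
    linarith
  refine ⟨?_, h5⟩
  by_contra h0
  have h6 : ∀ k ∈ Sᶜ, y.2 k 0 * conj (y.2 k 1) =
      ((‖c k‖ ^ 2 : ℝ) : ℂ) * (y.2 j 0 * conj (y.2 j 1)) := fun k hk => by
    rw [hc k hk, ← Complex.normSq_eq_norm_sq, ← Complex.mul_conj]
    simp only [Pi.smul_apply, smul_eq_mul, map_mul]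
    ring
  rw [Finset.sum_congr rfl h6, ← Finset.sum_mul] at h1
  have h7 : y.2 j 0 * conj (y.2 j 1) ≠ 0 := mul_ne_zero h0 (by simpa using h5)
  have h8 := (mul_eq_zero.1 h1).resolve_right h7
  rw [← Complex.ofReal_sum, Complex.ofReal_eq_zero,
    Finset.sum_eq_zero_iff_of_nonneg fun k _ => by positivity] at h8
  have h9 := h8 j hjc
  have h10 := congrFun (hc j hjc) 0
  have h11 : c j = 0 := by simpa using h9
  rw [h11] at h10
  exact h0 (by simpa using h10)

/-- In the fixed component some `p i`, `i ∈ S`, is not zero: otherwise all edges would be vertical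
and `S` would have the same weight as its complement. -/
theorem exists_ne_zero_of_straight_compl {α : Fin n → ℝ} (hα : ∀ i, 0 < α i)
    {S : Finset (Fin n)} (hshort : Short α S) {y : CotRep n} (hy : y ∈ stdSet α S)
    (hS : Straight y Sᶜ) : ∃ i ∈ S, y.1 i 1 ≠ 0 := by
  by_contra! h
  obtain ⟨-, -, -, h2, h3, h4, -⟩ := mem_stdSet_iff.1 hy
  have h5 : ∀ i ∈ S, ‖y.2 i 0‖ ^ 2 + ‖y.1 i 1‖ ^ 2 = 2 * α i := fun i hi => by
    rw [← h3 i hi, h i hi]; simp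
  have h6 : ∀ j ∈ Sᶜ, ‖y.2 j 0‖ ^ 2 - ‖y.2 j 1‖ ^ 2 = -(2 * α j) := fun j hj => by
    have hj' := Finset.mem_compl.1 hj
    rw [← h4 j hj', (stdSet_of_straight_compl hα hy hS hj').1]; simp
  rw [Finset.sum_congr rfl h5, Finset.sum_congr rfl h6, Finset.sum_neg_distrib, ← Finset.mul_sum,
    ← Finset.mul_sum] at h2
  have : ∑ i ∈ S, α i < ∑ j ∈ Sᶜ, α j := hshort
  linarith

theorem Short.compl_nonempty {α : Fin n → ℝ} (hα : ∀ i, 0 < α i) {S : Finset (Fin n)}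
    (hshort : Short α S) : Sᶜ.Nonempty := by
  rw [Finset.nonempty_iff_ne_empty]
  intro h
  have h1 : ∑ i ∈ S, α i < ∑ j ∈ Sᶜ, α j := hshort
  rw [h, Finset.sum_empty] at h1
  exact absurd (Finset.sum_nonneg fun i _ => (hα i).le) (not_le.2 h1)

theorem exists_smul_of_annihilated {p u v : Fin 2 → ℂ} (hp : p ≠ 0) (hv : v ≠ 0)
    (h1 : p 0 * u 0 + p 1 * u 1 = 0) (h2 : p 0 * v 0 + p 1 * v 1 = 0) :
    ∃ c : ℂ, u = c • v := by
  have hdet : u 0 * v 1 = u 1 * v 0 := by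
    by_cases h0 : p 0 = 0
    · have h01 : p 1 ≠ 0 := fun h => hp (funext fun k => by fin_cases k <;> assumption)
      apply mul_left_cancel₀ h01
      linear_combination u 0 * h2 - v 0 * h1
    · apply mul_left_cancel₀ h0
      linear_combination v 1 * h1 - u 1 * h2
  by_cases h0 : v 0 = 0
  · have h01 : v 1 ≠ 0 := fun h => hv (funext fun k => by fin_cases k <;> assumption)
    refine ⟨u 1 / v 1, funext fun k => ?_⟩
    fin_cases k
    · have : u 0 = 0 := by simpa [h0, h01] using hdet
      simp [h0, this]
    · simp [h01]
  · refine ⟨u 0 / v 0, funext fun k => ?_⟩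
    fin_cases k
    · simp [h0]
    · simp only [Fin.mk_one, Pi.smul_apply, smul_eq_mul]
      rw [div_mul_eq_mul_div, hdet, mul_div_cancel_right₀ _ h0]

/-- A point that flows up to the fixed component has a standard representative.  The ratio
`(p i q k) [q i, q k'] / [q k, q k']` scales with `τ` and `(p k q i) (p i q k)` with `τ²`, so both
must vanish when the limit exists and lies in the fixed component. -/
theorem flowsUpTo_subset {α : Fin n → ℝ} (hα : ∀ i, 0 < α i) {S : Finset (Fin n)}
    (hne : S.Nonempty) (hshort : Short α S) :
    flowsUpTo α (fixedComponent α S) ⊆ Set.range (stdClass α S) := by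
  rintro m ⟨f, hf, m', ⟨y₀, rfl, hy1, hy2, hy3⟩, hlim⟩
  obtain ⟨x, rfl⟩ := (isOpenQuotientMap_toSpace α).surjective m
  obtain ⟨g, hg, hy⟩ := exists_act_mem_stdSet hα hne y₀.2 hy1 hy3
  have hyS := hy2.act g
  rw [← toSpace_act hg y₀] at hlim
  set y : CotRep n := act y₀ g with hydef
  have hP := fun V (hV : V ∈ 𝓝 y) => eventually_exists_act_mem hf hlim hV
  obtain ⟨i, hi, hpi⟩ := exists_ne_zero_of_straight_compl hα hshort hy hyS
  have hq : ∀ j ∉ S, y.2 j 0 = 0 ∧ y.2 j 1 ≠ 0 := fun j hj =>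
    stdSet_of_straight_compl hα hy hyS hj
  have hq' : ∀ k ∈ S, y.2 k 0 ≠ 0 := fun k hk => norm_pos_iff.1 (stdSet_norm_pos hα hy hk)
  have hyp : ∀ j ∉ S, pairing y i j ≠ 0 := fun j hj => by
    simp [pairing, (hy.2.1 i hi).2.1, hpi, hq j hj]
  have hyb : ∀ k ∈ S, ∀ j ∉ S, bracket y k j ≠ 0 := fun k hk j hj => by
    simp [bracket, (hy.2.1 k hk).1, hq' k hk, hq j hj]
  have hn := neBot_unitsAtInfty
  -- Nonvanishing is an open condition, and invariant under scaling and the complex group.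
  have hxp : ∀ j ∉ S, pairing (x : CotRep n) i j ≠ 0 := fun j hj h0 => by
    obtain ⟨τ, k, hk⟩ :=
      (hP _ ((continuous_pairing i j).continuousAt.eventually_ne (hyp j hj))).exists
    apply hk
    rw [pairing_act, pairing_scale, h0]
    simp
  have hxb : ∀ k ∈ S, ∀ j ∉ S, bracket (x : CotRep n) k j ≠ 0 := fun k hk j hj h0 => by
    obtain ⟨τ, k', hk'⟩ :=
      (hP _ ((continuous_bracket k j).continuousAt.eventually_ne (hyb k hk j hj))).exists
    apply hk'
    rw [bracket_act, bracket_scale, h0]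
    simp
  have hP' : ∀ V ∈ 𝓝 y, ∀ᶠ τ in unitsAtInfty,
      ∃ z ∈ V, ∃ k : ComplexGroup n, z = act (scale τ (x : CotRep n)) k := fun V hV => by
    filter_upwards [hP V hV] with τ hτ
    obtain ⟨k, hk⟩ := hτ
    exact ⟨_, hk, k, rfl⟩
  obtain ⟨j₀, hj₀⟩ := hshort.compl_nonempty hα
  rw [Finset.mem_compl] at hj₀
  have hpq : ∀ k ∈ S, pairing (x : CotRep n) i k = 0 := fun k hk => by
    have h0 := eq_zero_of_bounded (W := pairing (x : CotRep n) i k * bracket (x : CotRep n) i j₀)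
      (F₁ := fun z => pairing z i k * bracket z i j₀) (C := bracket (x : CotRep n) k j₀) hP'
      ((continuous_pairing i k).mul (continuous_bracket i j₀)) (continuous_bracket k j₀)
      (hyb k hk j₀ hj₀) one_ne_zero ?_
    · exact (mul_eq_zero.1 h0).resolve_right (hxb i hi j₀ hj₀)
    · rintro τ z ⟨h, rfl⟩
      have : (h.2 i : ℂ) ≠ 0 := (h.2 i).ne_zero
      simp only [pairing_act, bracket_act, pairing_scale, bracket_scale]
      field_simp
  have hpx : (x : CotRep n).1 i ≠ 0 := fun h0 => hxp j₀ hj₀ (by simp [pairing, h0])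
  have hqx : ∀ k ∈ S, (x : CotRep n).2 k ≠ 0 := fun k hk h0 =>
    hxb k hk j₀ hj₀ (by simp [bracket, h0])
  have hpj : ∀ j ∉ S, (x : CotRep n).1 j = 0 := fun j hj => by
    have h0 := eq_zero_of_bounded (W := pairing (x : CotRep n) j i * pairing (x : CotRep n) i j)
      (F₁ := fun z => pairing z j i * pairing z i j) (C := 1) (F₂ := fun _ => 1) hP'
      ((continuous_pairing j i).mul (continuous_pairing i j))
      continuous_const one_ne_zero two_ne_zero ?_
    · have h1 : pairing (x : CotRep n) j i = 0 := (mul_eq_zero.1 h0).resolve_right (hxp j hj)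
      have h2 := ((mem_levelSet_iff α _).1 x.2).2.2.2.1 j
      have h3 := hxb i hi j hj
      rw [pairing] at h1
      rw [bracket] at h3
      funext k
      fin_cases k
      · apply mul_right_cancel₀ h3
        simp only [Fin.zero_eta, Pi.zero_apply]
        linear_combination (x : CotRep n).2 j 1 * h1 - (x : CotRep n).2 i 1 * h2
      · apply mul_right_cancel₀ h3
        simp only [Fin.mk_one, Pi.zero_apply]
        linear_combination (x : CotRep n).2 i 0 * h2 - (x : CotRep n).2 j 0 * h1
    · rintro τ z ⟨h, rfl⟩
      have h1 : (h.2 i : ℂ) ≠ 0 := (h.2 i).ne_zero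
      have h2 : (h.2 j : ℂ) ≠ 0 := (h.2 j).ne_zero
      simp only [pairing_act, pairing_scale]
      field_simp
  have hstr : Straight (x : CotRep n) S := fun k hk k' hk' =>
    exists_smul_of_annihilated hpx (hqx k' hk') (hpq k hk) (hpq k' hk')
  obtain ⟨h, hh, hmem⟩ := exists_act_mem_stdSet hα hne x.2 hstr hpj
  exact ⟨⟨_, hmem⟩, toSpace_act hh x⟩

/-! ### Generic standard points flow up to the fixed component -/

/-- The vector of squared norm `2 t`, with positive second entry, whose entries have quotient
`z`. -/
def hopfLift (t : ℝ) (z : ℂ) : Fin 2 → ℂ :=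
  ![(√(2 * t / (1 + ‖z‖ ^ 2)) : ℝ) * z, (√(2 * t / (1 + ‖z‖ ^ 2)) : ℝ)]

theorem hopfLift_zero (t : ℝ) (z : ℂ) :
    hopfLift t z 0 = ((√(2 * t / (1 + ‖z‖ ^ 2)) : ℝ) : ℂ) * z := rfl

theorem hopfLift_one (t : ℝ) (z : ℂ) :
    hopfLift t z 1 = ((√(2 * t / (1 + ‖z‖ ^ 2)) : ℝ) : ℂ) := rfl

theorem hopfLift_norms {t : ℝ} (ht : 0 < t) (z : ℂ) :
    ‖hopfLift t z 0‖ ^ 2 = 2 * t / (1 + ‖z‖ ^ 2) * ‖z‖ ^ 2 ∧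
    ‖hopfLift t z 1‖ ^ 2 = 2 * t / (1 + ‖z‖ ^ 2) := by
  have h : ‖((√(2 * t / (1 + ‖z‖ ^ 2)) : ℝ) : ℂ)‖ ^ 2 = 2 * t / (1 + ‖z‖ ^ 2) := by
    rw [Complex.norm_real, Real.norm_of_nonneg (Real.sqrt_nonneg _), Real.sq_sqrt (by positivity)]
  rw [hopfLift_zero, hopfLift_one, norm_mul, mul_pow, h]
  exact ⟨rfl, rfl⟩

theorem hopfLift_mul_conj {t : ℝ} (ht : 0 < t) (z : ℂ) :
    hopfLift t z 0 * conj (hopfLift t z 1) = 2 * ((t / (1 + ‖z‖ ^ 2)) • z) := by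
  rw [hopfLift_zero, hopfLift_one, Complex.conj_ofReal, mul_right_comm, ← Complex.ofReal_mul,
    Real.mul_self_sqrt (by positivity), Complex.real_smul]
  push_cast
  ring

/-- The standard point with `q i p i = l β i` and with `q j` over `z j` lies in the level set if `l`
and the `z j` satisfy the balance equations. -/
theorem flowPoint_mem {α : Fin n → ℝ} (hα : ∀ i, 0 < α i) {S : Finset (Fin n)} {β : Fin n → ℂ}
    (hβ : ∑ i ∈ S, β i = 0) {l : ℝ} (hl : 0 < l) {z : Fin n → ℂ}
    (h1 : ∑ j ∈ Sᶜ, (α j / (1 + ‖z j‖ ^ 2)) • z j = 0)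
    (h2 : ∑ j ∈ Sᶜ, α j * ((1 - ‖z j‖ ^ 2) / (1 + ‖z j‖ ^ 2)) =
      ∑ i ∈ S, √(α i ^ 2 + (l * ‖β i‖) ^ 2)) :
    stdPoint α S (fun i => (l : ℂ) * β i) (fun j => hopfLift (α j) (z j)) ∈ stdSet α S := by
  refine stdPoint_mem hα ?_ ?_ (fun j _ => ?_) ?_
  · simp only [hopfLift_mul_conj (hα _)]
    rw [← Finset.mul_sum, h1, mul_zero]
  · simp only [norm_mul, Complex.norm_real, Real.norm_of_nonneg hl.le]
    rw [← h2, ← Finset.sum_add_distrib]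
    refine Finset.sum_eq_zero fun j _ => ?_
    have h0 : 1 + ‖z j‖ ^ 2 ≠ 0 := by positivity
    rw [(hopfLift_norms (hα j) _).1, (hopfLift_norms (hα j) _).2]
    field_simp
    ring
  · have h0 : 1 + ‖z j‖ ^ 2 ≠ 0 := by positivity
    rw [(hopfLift_norms (hα j) _).1, (hopfLift_norms (hα j) _).2]
    field_simp
    ring
  · rw [← Finset.mul_sum, hβ, mul_zero]

theorem continuous_flowPoint {α : Fin n → ℝ} (hα : ∀ i, 0 < α i) (S : Finset (Fin n))
    (β : Fin n → ℂ) : Continuous fun a : ℝ × (Fin n → ℂ) =>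
      stdPoint α S (fun i => (a.1 : ℂ) * β i) (fun j => hopfLift (α j) (a.2 j)) := by
  have hl : Continuous fun a : ℝ × (Fin n → ℂ) => (a.1 : ℂ) :=
    Complex.continuous_ofReal.comp continuous_fst
  have hA : ∀ i, Continuous fun a : ℝ × (Fin n → ℂ) =>
      ((halfLength (α i) ‖(a.1 : ℂ) * β i‖ : ℝ) : ℂ) := fun i => by
    refine Complex.continuous_ofReal.comp ?_
    unfold halfLength
    have : Continuous fun a : ℝ × (Fin n → ℂ) => ‖(a.1 : ℂ) * β i‖ :=
      (hl.mul continuous_const).norm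
    fun_prop
  have hD : ∀ j, Continuous fun a : ℝ × (Fin n → ℂ) =>
      ((√(2 * α j / (1 + ‖a.2 j‖ ^ 2)) : ℝ) : ℂ) := fun j => by
    refine Complex.continuous_ofReal.comp (Real.continuous_sqrt.comp ?_)
    exact continuous_const.div (by fun_prop) fun a => by positivity
  refine Continuous.prodMk (continuous_pi fun i => continuous_pi fun k => ?_)
    (continuous_pi fun i => continuous_pi fun k => ?_)
  · by_cases hi : i ∈ S
    · simp only [hi, if_true]
      fin_cases k
      · exact continuous_const
      · exact (hl.mul continuous_const).div (hA i) fun a => by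
          exact_mod_cast (halfLength_pos (hα i) _).ne'
    · simp only [hi, if_false]
      exact continuous_const
  · by_cases hi : i ∈ S
    · simp only [hi, if_true]
      fin_cases k
      · exact hA i
      · exact continuous_const
    · simp only [hi, if_false]
      fin_cases k
      · exact (hD i).mul (by fun_prop)
      · exact hD i

/-- The complex group moves `τ · x` to the flow point with balanced data: the upper triangular
matrix with diagonal entries `t, t⁻¹`, where `t² = l / τ`, acts on the quotients `q j 0 / q j 1` as
the affine map `ζ ↦ (l / τ) ζ + c`. -/
theorem exists_act_eq_flowPoint {α : Fin n → ℝ} (hα : ∀ i, 0 < α i) {S : Finset (Fin n)}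
    {x : CotRep n} (hx : x ∈ stdSet α S) (hq : ∀ j ∉ S, x.2 j 1 ≠ 0) (τ : ℂˣ) {l : ℝ} (hl : 0 < l)
    (c : ℂ) : ∃ g : ComplexGroup n, act (scale τ x) g =
      stdPoint α S (fun i => (l : ℂ) * (x.2 i 0 * x.1 i 1))
        (fun j => hopfLift (α j) (l • ((τ : ℂ)⁻¹ * (x.2 j 0 / x.2 j 1)) + c)) := by
  have hlc : (l : ℂ) ≠ 0 := by exact_mod_cast hl.ne'
  have hτ : (τ : ℂ) ≠ 0 := τ.ne_zero
  obtain ⟨t, ht⟩ := IsAlgClosed.exists_pow_nat_eq ((l : ℂ) / τ) two_pos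
  have ht0 : t ≠ 0 := fun h => by
    rw [h, zero_pow two_ne_zero] at ht
    exact div_ne_zero hlc hτ ht.symm
  have htτ : (τ : ℂ) * t ^ 2 = l := by rw [ht]; field_simp
  set β : Fin n → ℂ := fun i => (l : ℂ) * (x.2 i 0 * x.1 i 1) with hβ
  set z : Fin n → ℂ := fun j => l • ((τ : ℂ)⁻¹ * (x.2 j 0 / x.2 j 1)) + c with hz
  have hA0 : ∀ i, ((halfLength (α i) ‖β i‖ : ℝ) : ℂ) ≠ 0 := fun i => by
    exact_mod_cast (halfLength_pos (hα i) _).ne'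
  have hD0 : ∀ j, ((√(2 * α j / (1 + ‖z j‖ ^ 2)) : ℝ) : ℂ) ≠ 0 := fun j => by
    have : 0 < √(2 * α j / (1 + ‖z j‖ ^ 2)) :=
      Real.sqrt_pos.2 (div_pos (by linarith [hα j]) (by positivity))
    exact_mod_cast this.ne'
  have hx0 : ∀ i ∈ S, x.2 i 0 ≠ 0 := fun i hi => norm_pos_iff.1 (stdSet_norm_pos hα hx hi)
  let e : Fin n → ℂ := fun i => if i ∈ S then ((halfLength (α i) ‖β i‖ : ℝ) : ℂ) / (t * x.2 i 0)
    else ((√(2 * α i / (1 + ‖z i‖ ^ 2)) : ℝ) : ℂ) * t / x.2 i 1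
  have he0 : ∀ i, e i ≠ 0 := fun i => by
    by_cases hi : i ∈ S
    · simp only [e, hi, if_true]
      exact div_ne_zero (hA0 i) (mul_ne_zero ht0 (hx0 i hi))
    · simp only [e, hi, if_false]
      exact div_ne_zero (mul_ne_zero (hD0 i) ht0) (hq i hi)
  have hdet : (!![t⁻¹, -(c / t); 0, t]).det = 1 := by
    rw [Matrix.det_fin_two_of]; field_simp; simp
  refine ⟨(⟨!![t⁻¹, -(c / t); 0, t], hdet⟩, fun i => Units.mk0 (e i) (he0 i)), ?_⟩
  refine Prod.ext (funext fun i => funext fun k => ?_) (funext fun i => funext fun k => ?_)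
  · rw [act_fst_apply]
    change (e i)⁻¹ * ((τ * x.1 i 0) * _ + (τ * x.1 i 1) * _) = _
    by_cases hi : i ∈ S
    · have h1 := (hx.2.1 i hi).2.1
      have h2 := hx0 i hi
      have h3 := hA0 i
      simp only [e, stdPoint, hi, if_true, h1]
      fin_cases k
      · simp
      · simp only [Fin.mk_one, Matrix.of_apply, Matrix.cons_val_one, Matrix.cons_val_zero,
          mul_zero, zero_mul, zero_add]
        rw [inv_div, div_mul_eq_mul_div]
        congr 1
        simp only [hβ]
        linear_combination x.2 i 0 * x.1 i 1 * htτ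
    · simp [stdPoint, hi, hx.2.2 i hi]
  · have h4 : ∀ k, (scale τ x).2 i k = x.2 i k := fun _ => rfl
    by_cases hi : i ∈ S
    · have h1 := (hx.2.1 i hi).1
      have h2 := hx0 i hi
      fin_cases k
      · simp only [Fin.zero_eta, act_snd_apply_zero, h4, h1]
        change e i * (t * x.2 i 0 - _ * 0) = _
        simp only [e, stdPoint, hi, if_true, Matrix.cons_val_zero]
        field_simp
        ring
      · simp only [Fin.mk_one, act_snd_apply_one, h4, h1]
        change e i * (t⁻¹ * 0 - 0 * x.2 i 0) = _
        simp [stdPoint, hi]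
    · have h2 := hq i hi
      fin_cases k
      · simp only [Fin.zero_eta, act_snd_apply_zero, h4]
        change e i * (t * x.2 i 0 - -(c / t) * x.2 i 1) = _
        simp only [e, stdPoint, hi, if_false, hopfLift_zero]
        have h5 : z i = t ^ 2 * (x.2 i 0 / x.2 i 1) + c := by
          simp only [hz, Complex.real_smul]
          rw [← htτ]
          field_simp
        change _ = ((√(2 * α i / (1 + ‖z i‖ ^ 2)) : ℝ) : ℂ) * z i
        rw [mul_div_assoc, mul_assoc]
        congr 1
        rw [h5]
        field_simp
        ring
      · simp only [Fin.mk_one, act_snd_apply_one, h4]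
        change e i * (t⁻¹ * x.2 i 1 - 0 * x.2 i 0) = _
        simp only [e, stdPoint, hi, if_false, hopfLift_one]
        change _ = ((√(2 * α i / (1 + ‖z i‖ ^ 2)) : ℝ) : ℂ)
        field_simp
        simp

theorem strictMonoOn_length {ι : Type*} {I : Finset ι} {α b : ι → ℝ}
    (hb : ∀ i, 0 ≤ b i) {i₀ : ι} (hi₀ : i₀ ∈ I) (hpos : 0 < b i₀) :
    StrictMonoOn (fun l : ℝ => ∑ i ∈ I, √(α i ^ 2 + (l * b i) ^ 2)) (Set.Ici 0) := by
  intro l hl l' hl' hll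
  have hl0 : 0 ≤ l := hl
  refine Finset.sum_lt_sum (fun i _ => Real.sqrt_le_sqrt ?_) ⟨i₀, hi₀, Real.sqrt_lt_sqrt
    (by positivity) ?_⟩
  · have := mul_le_mul_of_nonneg_right hll.le (hb i)
    have := mul_nonneg hl0 (hb i)
    gcongr
  · have := mul_lt_mul_of_pos_right hll hpos
    have := mul_nonneg hl0 hpos.le
    gcongr

/-- A standard point flows up to the fixed component if some `p i`, `i ∈ S`, is not zero and no
`q j`, `j ∉ S`, is a multiple of the first basis vector.  In the affine coordinate `q j 0 / q j 1`
the flow contracts the points to the origin; the rescaling `l` and the translation `c` that restore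
the real moment map equation stay bounded and converge. -/
theorem stdClass_mem_flowsUpTo {α : Fin n → ℝ} (hα : ∀ i, 0 < α i) {S : Finset (Fin n)}
    (hshort : Short α S) (x : stdSet α S) {i₀ : Fin n} (hi₀ : i₀ ∈ S)
    (hp : (x : CotRep n).1 i₀ 1 ≠ 0) (hq : ∀ j ∉ S, (x : CotRep n).2 j 1 ≠ 0) :
    stdClass α S x ∈ flowsUpTo α (fixedComponent α S) := by
  set β : Fin n → ℂ := fun i => (x : CotRep n).2 i 0 * (x : CotRep n).1 i 1 with hβdef
  set ζ : Fin n → ℂ := fun j => (x : CotRep n).2 j 0 / (x : CotRep n).2 j 1 with hζ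
  have hβ : ∑ i ∈ S, β i = 0 := (mem_stdSet_iff.1 x.2).2.2.2.2.2.2
  have hb : ∀ i, 0 ≤ ‖β i‖ := fun i => norm_nonneg _
  have hpos : 0 < ‖β i₀‖ :=
    norm_pos_iff.2 (mul_ne_zero (norm_pos_iff.1 (stdSet_norm_pos hα x.2 hi₀)) hp)
  have hJ := hshort.compl_nonempty hα
  choose l c hl hbal1 hbal2 using fun τ : ℂˣ =>
    exists_balance hα hb hi₀ hpos hshort fun j => (τ : ℂ)⁻¹ * ζ j
  obtain ⟨l₁, c₁, hl₁, h1, h2⟩ := exists_balance hα hb hi₀ hpos hshort fun _ => 0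
  have hc₁ : c₁ = 0 := by
    have := norm_le_of_balance hα hJ (r := 0) (δ := fun _ => 0) (c := c₁)
      (fun _ _ => norm_zero.le) (by simpa only [smul_zero] using h1)
    exact norm_le_zero_iff.1 this
  subst hc₁
  let z : ℂˣ → Fin n → ℂ := fun τ j => l τ • ((τ : ℂ)⁻¹ * ζ j) + c τ
  have hY : ∀ τ, stdPoint α S (fun i => (l τ : ℂ) * β i) (fun j => hopfLift (α j) (z τ j)) ∈
      stdSet α S := fun τ => flowPoint_mem hα hβ (hl τ) (hbal1 τ) (hbal2 τ)
  have hY₁ : stdPoint α S (fun i => (l₁ : ℂ) * β i)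
      (fun j => hopfLift (α j) ((0 : Fin n → ℂ) j)) ∈ stdSet α S :=
    flowPoint_mem hα hβ hl₁ (by simp) (by simpa using h2)
  refine ⟨fun τ => stdClass α S ⟨_, hY τ⟩, fun τ => ?_, stdClass α S ⟨_, hY₁⟩, ?_, ?_⟩
  · exact ⟨⟨x, x.2.1⟩, ⟨_, (hY τ).1⟩, rfl, rfl,
      exists_act_eq_flowPoint hα x.2 hq τ (hl τ) (c τ)⟩
  · refine ⟨⟨_, hY₁.1⟩, rfl, stdSet_straight hα hY₁, fun j hj j' hj' => ?_, hY₁.2.2⟩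
    have hjS := Finset.mem_compl.1 hj
    have hjS' := Finset.mem_compl.1 hj'
    have h0 : hopfLift (α j') 0 1 ≠ 0 := by
      intro h
      have h3 := (hopfLift_norms (hα j') 0).2
      rw [h] at h3
      simp only [norm_zero, ne_eq, OfNat.ofNat_ne_zero, not_false_eq_true, zero_pow, add_zero,
        div_one] at h3
      linarith [hα j']
    refine ⟨hopfLift (α j) 0 1 / hopfLift (α j') 0 1, funext fun k => ?_⟩
    simp only [stdPoint, hjS, hjS', if_false, Pi.zero_apply]
    fin_cases k
    · simp [hopfLift_zero]
    · simp [h0]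
  · have hG := strictMonoOn_length (α := α) hb hi₀ hpos
    have hGl : ∀ τ, l τ ≤ (∑ j ∈ Sᶜ, α j) / ‖β i₀‖ := fun τ => by
      rw [le_div_iff₀ hpos]
      calc l τ * ‖β i₀‖ ≤ √(α i₀ ^ 2 + (l τ * ‖β i₀‖) ^ 2) :=
            Real.le_sqrt_of_sq_le (by nlinarith [sq_nonneg (α i₀)])
        _ ≤ ∑ i ∈ S, √(α i ^ 2 + (l τ * ‖β i‖) ^ 2) :=
            Finset.single_le_sum (f := fun i => √(α i ^ 2 + (l τ * ‖β i‖) ^ 2))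
              (fun i _ => Real.sqrt_nonneg _) hi₀
        _ ≤ ∑ j ∈ Sᶜ, α j := by
            rw [← hbal2 τ]
            refine Finset.sum_le_sum fun j _ => ?_
            refine mul_le_of_le_one_right (hα j).le ?_
            rw [div_le_one (by positivity)]
            nlinarith [sq_nonneg ‖l τ • ((τ : ℂ)⁻¹ * ζ j) + c τ‖]
    set a : ℝ := ∑ j ∈ Sᶜ, α j with ha
    set B : ℝ := a / ‖β i₀‖ * ∑ j, ‖ζ j‖ with hB
    have hδ : ∀ τ : ℂˣ, ∀ j, ‖l τ • ((τ : ℂ)⁻¹ * ζ j)‖ ≤ B * ‖(τ : ℂ)‖⁻¹ := fun τ j => by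
      rw [norm_smul, norm_mul, norm_inv, Real.norm_of_nonneg (hl τ).le]
      calc l τ * (‖(τ : ℂ)‖⁻¹ * ‖ζ j‖) = (l τ * ‖ζ j‖) * ‖(τ : ℂ)‖⁻¹ := by ring
        _ ≤ B * ‖(τ : ℂ)‖⁻¹ := by
          refine mul_le_mul_of_nonneg_right ?_ (by positivity)
          exact mul_le_mul (hGl τ) (Finset.single_le_sum (f := fun j => ‖ζ j‖)
            (fun i _ => norm_nonneg _) (Finset.mem_univ j)) (norm_nonneg _)
            ((hl τ).le.trans (hGl τ))
    have hc : ∀ τ : ℂˣ, ‖c τ‖ ≤ B * ‖(τ : ℂ)‖⁻¹ := fun τ =>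
      norm_le_of_balance hα hJ (fun j _ => hδ τ j) (hbal1 τ)
    have hinv : Tendsto (fun τ : ℂˣ => B * ‖(τ : ℂ)‖⁻¹ + B * ‖(τ : ℂ)‖⁻¹) unitsAtInfty (𝓝 0) := by
      have : Tendsto (fun τ : ℂˣ => ‖(τ : ℂ)‖⁻¹) unitsAtInfty (𝓝 0) :=
        tendsto_inv_atTop_zero.comp tendsto_comap
      simpa using (this.const_mul B).add (this.const_mul B)
    have hz : Tendsto z unitsAtInfty (𝓝 0) := by
      rw [tendsto_pi_nhds]
      intro j
      exact squeeze_zero_norm (fun τ => (norm_add_le _ _).trans (add_le_add (hδ τ j) (hc τ))) hinv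
    have hlen : Tendsto (fun τ => ∑ i ∈ S, √(α i ^ 2 + (l τ * ‖β i‖) ^ 2)) unitsAtInfty
        (𝓝 (∑ i ∈ S, √(α i ^ 2 + (l₁ * ‖β i‖) ^ 2))) := by
      simp only [← hbal2, ← h2]
      refine tendsto_finsetSum _ fun j _ => Tendsto.const_mul _ ?_
      have h3 : Continuous fun w : ℂ => (1 - ‖w‖ ^ 2) / (1 + ‖w‖ ^ 2) :=
        Continuous.div (by fun_prop) (by fun_prop) fun w => by positivity
      have := (h3.tendsto 0).comp ((tendsto_pi_nhds.1 hz) j)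
      have h4 : l₁ • (0 : ℂ) + 0 = 0 := by simp
      rw [h4]
      exact this
    have hlt : Tendsto l unitsAtInfty (𝓝 l₁) := by
      rw [tendsto_order]
      refine ⟨fun s hs => ?_, fun s hs => ?_⟩
      · rcases lt_or_ge s 0 with h0 | h0
        · exact Eventually.of_forall fun τ => h0.trans (hl τ)
        · filter_upwards [hlen.eventually_const_lt (hG h0 hl₁.le hs)] with τ hτ
          exact (hG.lt_iff_lt h0 (hl τ).le).1 hτ
      · have h0 : 0 ≤ s := hl₁.le.trans hs.le
        filter_upwards [hlen.eventually_lt_const (hG hl₁.le h0 hs)] with τ hτ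
        exact (hG.lt_iff_lt (hl τ).le h0).1 hτ
    refine ((continuous_stdClass α S).tendsto _).comp ?_
    rw [tendsto_subtype_rng]
    have h5 := ((continuous_flowPoint hα S β).tendsto (l₁, (0 : Fin n → ℂ))).comp
      (hlt.prodMk_nhds hz)
    exact h5

/-! ### Generic pairs of polygons are dense -/

theorem exists_unit_orthogonal (w : E3) : ∃ f : E3, ‖f‖ = 1 ∧ inner ℝ f w = 0 := by
  obtain ⟨f, hf, hfw⟩ : ∃ f : E3, f ≠ 0 ∧ inner ℝ f w = 0 := by
    by_cases h : w 0 = 0 ∧ w 1 = 0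
    · refine ⟨vec (1, 0), fun h0 => ?_, ?_⟩
      · simpa using congrArg (fun v : E3 => v 0) h0
      · simp [inner_eq_coords, h.1]
    · refine ⟨vec (⟨-w 1, w 0⟩, 0), fun h0 => h ⟨?_, ?_⟩, ?_⟩
      · simpa using congrArg (fun v : E3 => v 1) h0
      · simpa using congrArg (fun v : E3 => v 0) h0
      · simp [inner_eq_coords]; ring
  refine ⟨‖f‖⁻¹ • f, ?_, ?_⟩
  · rw [norm_smul, norm_inv, norm_norm, inv_mul_cancel₀ (norm_ne_zero_iff.2 hf)]
  · rw [real_inner_smul_left, hfw, mul_zero]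

theorem norm_rotate {c s a : ℝ} (hcs : c ^ 2 + s ^ 2 = 1) {v k : E3} (hv : ‖v‖ = a)
    (hk : ‖k‖ = a) (hvk : inner ℝ v k = 0) : ‖c • v + s • k‖ = a := by
  have ha : 0 ≤ a := hv ▸ norm_nonneg v
  rw [← sq_eq_sq₀ (norm_nonneg _) ha, norm_add_sq_real, norm_smul, norm_smul,
    real_inner_smul_left, real_inner_smul_right, hvk, hv, hk, mul_pow, mul_pow, Real.norm_eq_abs,
    Real.norm_eq_abs, sq_abs, sq_abs]
  linear_combination a ^ 2 * hcs

/-- The first coordinate of the rational parametrization of the circle. -/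
def circleCos (t : ℝ) : ℝ := (1 - t ^ 2) / (1 + t ^ 2)

/-- The second coordinate of the rational parametrization of the circle. -/
def circleSin (t : ℝ) : ℝ := 2 * t / (1 + t ^ 2)

theorem circle_sq (t : ℝ) : circleCos t ^ 2 + circleSin t ^ 2 = 1 := by
  have : 1 + t ^ 2 ≠ 0 := by positivity
  unfold circleCos circleSin
  field_simp
  ring

theorem one_sub_circleCos (t : ℝ) : 1 - circleCos t = t * circleSin t := by
  have : 1 + t ^ 2 ≠ 0 := by positivity
  unfold circleCos circleSin
  field_simp
  ring

theorem circleSin_pos {t : ℝ} (ht : 0 < t) : 0 < circleSin t := by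
  unfold circleSin; positivity

theorem continuous_circleCos : Continuous circleCos :=
  Continuous.div (by fun_prop) (by fun_prop) fun t => by positivity

theorem continuous_circleSin : Continuous circleSin :=
  Continuous.div (by fun_prop) (by fun_prop) fun t => by positivity

section Tilt

variable {J : Type*} [DecidableEq J]

/-- Rotate the vectors `v j`, `j ∈ T`, towards the vectors `k j`. -/
def tilt (T : Finset J) (v k : J → E3) (t : ℝ) (j : J) : E3 :=
  if j ∈ T then circleCos t • v j + circleSin t • k j else v j

theorem continuous_tilt (T : Finset J) (v k : J → E3) : Continuous (tilt T v k) := by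
  refine continuous_pi fun j => ?_
  unfold tilt
  have h1 := continuous_circleCos
  have h2 := continuous_circleSin
  by_cases hj : j ∈ T
  · simp only [hj, if_true]; fun_prop
  · simp only [hj, if_false]; fun_prop

theorem tilt_zero (T : Finset J) (v k : J → E3) : tilt T v k 0 = v := by
  funext j
  simp [tilt, circleCos, circleSin]

theorem norm_tilt {T : Finset J} {v k : J → E3} {α : J → ℝ} (hv : ∀ j, ‖v j‖ = α j)
    (hk : ∀ j ∈ T, ‖k j‖ = α j) (hvk : ∀ j ∈ T, inner ℝ (v j) (k j) = 0) (t : ℝ) (j : J) :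
    ‖tilt T v k t j‖ = α j := by
  unfold tilt
  split_ifs with hj
  · exact norm_rotate (circle_sq t) (hv j) (hk j hj) (hvk j hj)
  · exact hv j

theorem sum_tilt [Fintype J] (T : Finset J) (v k : J → E3) (t : ℝ) :
    ∑ j, tilt T v k t j = ∑ j, v j +
      ((circleCos t - 1) • ∑ j ∈ T, v j + circleSin t • ∑ j ∈ T, k j) := by
  rw [Finset.smul_sum, Finset.smul_sum, ← Finset.sum_add_distrib, ← sub_eq_iff_eq_add',
    ← Finset.sum_sub_distrib, ← Finset.sum_subset (Finset.subset_univ T)]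
  · refine Finset.sum_congr rfl fun j hj => ?_
    simp only [tilt, hj, if_true]
    module
  · intro j _ hj
    simp [tilt, hj]

/-- A polygon with a nonzero sum that is not stretched straight can be moved so that the sum gets
longer and no edge points opposite to the sum. -/
theorem exists_stretching [Fintype J] {v : J → E3} {α : J → ℝ} (hα : ∀ j, 0 < α j)
    (hv : ∀ j, ‖v j‖ = α j) {w : E3} (hw : w ≠ 0) (hsum : ∑ j, v j = -w)
    (hns : ∃ j, ‖w‖ • v j ≠ -(α j • w)) :
    ∃ V : ℝ → J → E3, Continuous V ∧ V 0 = v ∧ (∀ t j, ‖V t j‖ = α j) ∧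
      ∀ᶠ t in 𝓝[>] 0, ‖w‖ < ‖-∑ j, V t j‖ ∧
        ∀ j, ‖-∑ j, V t j‖ • V t j ≠ α j • (-∑ j, V t j) := by
  classical
  have hwn : 0 < ‖w‖ := norm_pos_iff.2 hw
  -- Edges that do not point opposite to the sum keep this property under small deformations.
  have hopen : ∀ V : ℝ → J → E3, Continuous V → V 0 = v → ∀ j, ‖w‖ • v j ≠ α j • w →
      ∀ᶠ t in 𝓝[>] (0 : ℝ), ‖-∑ j, V t j‖ • V t j ≠ α j • (-∑ j, V t j) := by
    intro V hV hV0 j hj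
    have hc : Continuous fun t => ‖-∑ j, V t j‖ • V t j - α j • (-∑ j, V t j) := by fun_prop
    have h0 : ‖-∑ j, V 0 j‖ • V 0 j - α j • (-∑ j, V 0 j) ≠ 0 := by
      rw [hV0, hsum, neg_neg]
      exact sub_ne_zero.2 hj
    filter_upwards [nhdsWithin_le_nhds (hc.continuousAt.eventually_ne h0)] with t ht
    exact sub_ne_zero.1 ht
  by_cases hP : ∃ j, ‖w‖ • v j = α j • w
  -- Tilting all edges that point opposite to the sum in one direction `f` lengthens the sum.
  · obtain ⟨f, hf, hfw⟩ := exists_unit_orthogonal w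
    let T : Finset J := Finset.univ.filter fun j => ‖w‖ • v j = α j • w
    have hT : ∀ j, j ∈ T ↔ ‖w‖ • v j = α j • w := fun j => by simp [T]
    have hvT : ∀ j ∈ T, v j = (α j / ‖w‖) • w := fun j hj => by
      rw [div_eq_inv_mul, mul_smul, ← (hT j).1 hj, smul_smul, inv_mul_cancel₀ hwn.ne', one_smul]
    set A := ∑ j ∈ T, α j with hA
    have hA0 : 0 < A := Finset.sum_pos (fun j _ => hα j) (by
      obtain ⟨j, hj⟩ := hP
      exact ⟨j, (hT j).2 hj⟩)
    have hs : ∀ t, ∑ j, tilt T v (fun j => α j • f) t j =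
        -w + ((circleCos t - 1) • (A / ‖w‖) • w + circleSin t • A • f) := fun t => by
      rw [sum_tilt, hsum, Finset.sum_congr rfl hvT, ← Finset.sum_smul, ← Finset.sum_smul,
        ← Finset.sum_div]
    have hsw : ∀ t, inner ℝ (-∑ j, tilt T v (fun j => α j • f) t j) w =
        ‖w‖ ^ 2 + t * circleSin t * (A * ‖w‖) := fun t => by
      rw [hs, inner_neg_left, inner_add_left, inner_add_left, inner_neg_left,
        real_inner_smul_left, real_inner_smul_left, real_inner_smul_left, real_inner_smul_left,
        hfw, real_inner_self_eq_norm_sq, ← one_sub_circleCos]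
      field_simp
      ring
    have hsf : ∀ t, inner ℝ (-∑ j, tilt T v (fun j => α j • f) t j) f = -(circleSin t * A) :=
      fun t => by
        rw [hs, inner_neg_left, inner_add_left, inner_add_left, inner_neg_left,
          real_inner_smul_left, real_inner_smul_left, real_inner_smul_left, real_inner_smul_left,
          real_inner_comm, hfw, real_inner_self_eq_norm_sq, hf]
        ring
    have hcont := continuous_tilt T v fun j => α j • f
    have h0 := tilt_zero T v fun j => α j • f
    refine ⟨tilt T v fun j => α j • f, hcont, h0, norm_tilt hv (fun j _ => ?_) fun j hj => ?_, ?_⟩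
    · rw [norm_smul, hf, mul_one, Real.norm_of_nonneg (hα j).le]
    · rw [hvT j hj, real_inner_smul_left, real_inner_smul_right, real_inner_comm, hfw]
      ring
    · have hN : ∀ᶠ t in 𝓝[>] (0 : ℝ), ∀ j, j ∉ T → ‖-∑ j, tilt T v (fun j => α j • f) t j‖ •
          tilt T v (fun j => α j • f) t j ≠ α j • (-∑ j, tilt T v (fun j => α j • f) t j) := by
        rw [eventually_all]
        intro j
        by_cases hj : j ∈ T
        · exact Eventually.of_forall fun t h => absurd hj h
        · filter_upwards [hopen _ hcont h0 j fun h => hj ((hT j).2 h)] with t ht _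
          exact ht
      filter_upwards [hN, self_mem_nhdsWithin] with t ht htpos
      have hsin := circleSin_pos htpos
      have htpos' : 0 < t := htpos
      have hlt : ‖w‖ < ‖-∑ j, tilt T v (fun j => α j • f) t j‖ := by
        have h1 := real_inner_le_norm (-∑ j, tilt T v (fun j => α j • f) t j) w
        rw [hsw] at h1
        have h2 : 0 < t * circleSin t * (A * ‖w‖) := by positivity
        nlinarith
      refine ⟨hlt, fun j => ?_⟩
      by_cases hj : j ∈ T
      · intro h
        have h1 := congrArg (fun y => inner ℝ y f) h
        simp only [real_inner_smul_left, hsf] at h1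
        have h2 : inner ℝ (tilt T v (fun j => α j • f) t j) f = circleSin t * α j := by
          simp only [tilt, hj, if_true]
          rw [hvT j hj, inner_add_left, real_inner_smul_left, real_inner_smul_left,
            real_inner_smul_left, real_inner_smul_left, real_inner_comm, hfw,
            real_inner_self_eq_norm_sq, hf]
          ring
        rw [h2] at h1
        have h3 : 0 < ‖-∑ j, tilt T v (fun j => α j • f) t j‖ * (circleSin t * α j) :=
          mul_pos (hwn.trans hlt) (mul_pos hsin (hα j))
        have h4 : 0 < α j * (circleSin t * A) := mul_pos (hα j) (mul_pos hsin hA0)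
        linarith
      · exact ht j hj
  -- Otherwise one edge can be turned towards the sum, to which it is not parallel.
  · push Not at hP
    obtain ⟨i, hi⟩ := hns
    have hαi := hα i
    set k₀ : E3 := -w + (inner ℝ w (v i) / α i ^ 2) • v i with hk₀
    have hk₀v : inner ℝ k₀ (v i) = 0 := by
      rw [hk₀, inner_add_left, inner_neg_left, real_inner_smul_left, real_inner_self_eq_norm_sq,
        hv i]
      field_simp
      ring
    have hk₀0 : 0 < ‖k₀‖ := by
      rw [norm_pos_iff]
      intro h0
      rw [hk₀, neg_add_eq_zero] at h0
      set r := inner ℝ w (v i) / α i ^ 2 with hr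
      have h1 : ‖w‖ = |r| * α i := by
        rw [h0, norm_smul, hv i, Real.norm_eq_abs]
      rcases abs_choice r with h2 | h2
      · apply hP i
        rw [h1, h2, mul_comm, mul_smul, ← h0]
      · apply hi
        rw [h1, h2, neg_mul, neg_smul, mul_comm, mul_smul, ← h0]
    set k : E3 := (α i / ‖k₀‖) • k₀ with hk
    have hkw : inner ℝ k w = -(α i * ‖k₀‖) := by
      have h1 : w = (inner ℝ w (v i) / α i ^ 2) • v i - k₀ := by rw [hk₀]; abel
      rw [hk, real_inner_smul_left]
      conv_lhs => rw [h1]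
      rw [inner_sub_right, real_inner_smul_right, hk₀v, real_inner_self_eq_norm_sq]
      field_simp
      ring
    have hcont := continuous_tilt {i} v fun _ => k
    have h0 := tilt_zero {i} v fun _ => k
    refine ⟨tilt {i} v fun _ => k, hcont, h0, norm_tilt hv (fun j hj => ?_) fun j hj => ?_, ?_⟩
    · rw [Finset.mem_singleton.1 hj, hk, norm_smul, norm_div, norm_norm,
        Real.norm_of_nonneg hαi.le, div_mul_cancel₀ _ hk₀0.ne']
    · rw [Finset.mem_singleton.1 hj, hk, real_inner_smul_right, real_inner_comm, hk₀v, mul_zero]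
    · have hN : ∀ᶠ t in 𝓝[>] (0 : ℝ), ∀ j, ‖-∑ j, tilt {i} v (fun _ => k) t j‖ •
          tilt {i} v (fun _ => k) t j ≠ α j • (-∑ j, tilt {i} v (fun _ => k) t j) := by
        rw [eventually_all]
        exact fun j => hopen _ hcont h0 j (hP j)
      have hpos : ∀ᶠ t in 𝓝[>] (0 : ℝ), 0 < t * inner ℝ (v i) w + α i * ‖k₀‖ := by
        have hc : Continuous fun t : ℝ => t * inner ℝ (v i) w + α i * ‖k₀‖ := by fun_prop
        refine nhdsWithin_le_nhds (continuousAt_const.eventually_lt hc.continuousAt ?_)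
        simpa using mul_pos hαi hk₀0
      filter_upwards [hN, hpos, self_mem_nhdsWithin] with t ht htp htpos
      have hsin := circleSin_pos htpos
      refine ⟨?_, ht⟩
      have h1 := real_inner_le_norm (-∑ j, tilt {i} v (fun _ => k) t j) w
      have h2 : inner ℝ (-∑ j, tilt {i} v (fun _ => k) t j) w =
          ‖w‖ ^ 2 + circleSin t * (t * inner ℝ (v i) w + α i * ‖k₀‖) := by
        rw [sum_tilt, hsum, Finset.sum_singleton, Finset.sum_singleton, inner_neg_left,
          inner_add_left, inner_add_left, inner_neg_left, real_inner_smul_left,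
          real_inner_smul_left, hkw, real_inner_self_eq_norm_sq]
        linear_combination inner ℝ (v i) w * one_sub_circleCos t
      rw [h2] at h1
      have h3 := mul_pos hsin htp
      nlinarith

end Tilt

/-- The component of `v` orthogonal to `w`. -/
def perpPart (w v : E3) : E3 := v - (inner ℝ w v / ‖w‖ ^ 2) • w

theorem inner_perpPart {w : E3} (hw : w ≠ 0) (v : E3) : inner ℝ (perpPart w v) w = 0 := by
  have : ‖w‖ ≠ 0 := norm_ne_zero_iff.2 hw
  rw [perpPart, inner_sub_left, real_inner_smul_left, real_inner_self_eq_norm_sq,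
    real_inner_comm]
  field_simp
  ring

theorem norm_perpPart_le {w : E3} (hw : w ≠ 0) (v : E3) : ‖perpPart w v‖ ≤ ‖v‖ := by
  have h1 : v = perpPart w v + (inner ℝ w v / ‖w‖ ^ 2) • w := by rw [perpPart]; abel
  rw [← sq_le_sq₀ (norm_nonneg _) (norm_nonneg _)]
  conv_rhs => rw [h1]
  rw [norm_add_sq_real, real_inner_smul_right, inner_perpPart hw]
  nlinarith [sq_nonneg ‖(inner ℝ w v / ‖w‖ ^ 2) • w‖]

theorem perpPart_of_inner_eq_zero {w v : E3} (h : inner ℝ v w = 0) : perpPart w v = v := by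
  rw [perpPart, real_inner_comm, h]; simp

theorem perpPart_add_smul (w v k : E3) (s : ℝ) :
    perpPart w (v + s • k) = perpPart w v + s • perpPart w k := by
  simp only [perpPart, inner_add_right, real_inner_smul_right]
  module

theorem perpPart_sum {ι : Type*} (w : E3) (t : Finset ι) (v : ι → E3) :
    ∑ i ∈ t, perpPart w (v i) = perpPart w (∑ i ∈ t, v i) := by
  simp only [perpPart, inner_sum, Finset.sum_sub_distrib, Finset.sum_div, Finset.sum_smul]

theorem continuousAt_perpPart {w : E3} (hw : w ≠ 0) (v : E3) :
    ContinuousAt (fun w' => perpPart w' v) w := by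
  have : ‖w‖ ^ 2 ≠ 0 := pow_ne_zero _ (norm_ne_zero_iff.2 hw)
  have h1 : ContinuousAt (fun w' : E3 => inner ℝ w' v / ‖w'‖ ^ 2) w :=
    ContinuousAt.div (Continuous.continuousAt (by fun_prop))
      (Continuous.continuousAt (by fun_prop)) this
  exact continuousAt_const.sub (h1.smul continuousAt_id)

/-- The first polygon can be adjusted to a small change of `w` that makes `w` longer: move along a
direction in which all lengths grow, project to the new orthogonal complement, and use the
intermediate value theorem. -/
theorem exists_adjusted {ι : Type*} [Fintype ι] (hcard : 1 < Fintype.card ι) {α : ι → ℝ}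
    {u : ι → E3} {w : E3} (hw : w ≠ 0) (hsum : ∑ i, u i = 0) (hperp : ∀ i, inner ℝ (u i) w = 0)
    (hlen : ‖w‖ = ∑ i, √(α i ^ 2 + ‖u i‖ ^ 2)) {ε : ℝ} (hε : 0 < ε) :
    ∀ᶠ w' in 𝓝 w, ‖w‖ < ‖w'‖ → ∃ u' : ι → E3, (∀ i, ‖u' i - u i‖ < ε) ∧ ∑ i, u' i = 0 ∧
      (∀ i, inner ℝ (u' i) w' = 0) ∧ ‖w'‖ = ∑ i, √(α i ^ 2 + ‖u' i‖ ^ 2) := by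
  classical
  -- The direction is `u` itself unless `u = 0`; then two edges are opened up orthogonally to `w`.
  obtain ⟨k, hk0, hksum, hkw, hku⟩ : ∃ k : ι → E3, (∃ i, k i ≠ 0) ∧ ∑ i, k i = 0 ∧
      (∀ i, inner ℝ (k i) w = 0) ∧ ∀ i, 0 ≤ inner ℝ (u i) (k i) := by
    by_cases hu : ∃ i, u i ≠ 0
    · exact ⟨u, hu, hsum, hperp, fun i => real_inner_self_nonneg⟩
    · push Not at hu
      obtain ⟨i, j, hij⟩ := Fintype.one_lt_card_iff.1 hcard
      obtain ⟨f, hf, hfw⟩ := exists_unit_orthogonal w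
      refine ⟨Pi.single i f - Pi.single j f, ⟨i, ?_⟩, ?_, fun m => ?_, fun m => ?_⟩
      · have : f ≠ 0 := fun h => by simp [h] at hf
        simpa [hij] using this
      · simp [Finset.sum_sub_distrib]
      · simp only [Pi.sub_apply, Pi.single_apply, inner_sub_left]
        split_ifs <;> simp [hfw]
      · simp [hu]
  obtain ⟨η, hη, hηk⟩ : ∃ η : ℝ, 0 < η ∧ ∀ i, η * ‖k i‖ < ε / 2 := by
    have hK : 0 ≤ ∑ i, ‖k i‖ := Finset.sum_nonneg fun i _ => norm_nonneg _
    refine ⟨ε / 2 / (1 + ∑ i, ‖k i‖), div_pos (half_pos hε) (by linarith), fun i => ?_⟩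
    have h1 : ‖k i‖ ≤ ∑ i, ‖k i‖ := Finset.single_le_sum (f := fun i => ‖k i‖)
      (fun i _ => norm_nonneg _) (Finset.mem_univ i)
    rw [div_mul_eq_mul_div, div_lt_iff₀ (by linarith)]
    exact mul_lt_mul_of_pos_left (by linarith) (half_pos hε)
  have hgrow : ‖w‖ < ∑ i, √(α i ^ 2 + ‖u i + η • k i‖ ^ 2) := by
    rw [hlen]
    have hn : ∀ i, ‖u i‖ ^ 2 + η ^ 2 * ‖k i‖ ^ 2 ≤ ‖u i + η • k i‖ ^ 2 := fun i => by
      rw [norm_add_sq_real, real_inner_smul_right, norm_smul, Real.norm_of_nonneg hη.le, mul_pow]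
      have := mul_nonneg hη.le (hku i)
      linarith
    obtain ⟨i₀, hi₀⟩ := hk0
    refine Finset.sum_lt_sum (fun i _ => Real.sqrt_le_sqrt ?_) ⟨i₀, Finset.mem_univ _,
      Real.sqrt_lt_sqrt (by positivity) ?_⟩
    · have := hn i
      have : 0 ≤ η ^ 2 * ‖k i‖ ^ 2 := by positivity
      linarith
    · have := hn i₀
      have : 0 < η ^ 2 * ‖k i₀‖ ^ 2 := by
        have := norm_pos_iff.2 hi₀
        positivity
      linarith
  have hend : ∀ᶠ w' in 𝓝 w, ‖w'‖ < ∑ i, √(α i ^ 2 + ‖perpPart w' (u i + η • k i)‖ ^ 2) := by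
    have hc : ContinuousAt
        (fun w' => ∑ i, √(α i ^ 2 + ‖perpPart w' (u i + η • k i)‖ ^ 2)) w := by
      refine tendsto_finsetSum _ fun i _ => ?_
      exact (((continuousAt_perpPart hw _).norm.pow 2).const_add _).sqrt
    refine continuousAt_id.norm.eventually_lt hc ?_
    have : ∀ i, perpPart w (u i + η • k i) = u i + η • k i := fun i =>
      perpPart_of_inner_eq_zero (by rw [inner_add_left, real_inner_smul_left, hperp, hkw]; simp)
    simpa [this] using hgrow
  have hclose : ∀ᶠ w' in 𝓝 w, ∀ i, ‖perpPart w' (u i) - u i‖ < ε / 2 := by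
    rw [eventually_all]
    intro i
    refine ((continuousAt_perpPart hw (u i)).sub continuousAt_const).norm.eventually_lt
      continuousAt_const ?_
    simpa [perpPart_of_inner_eq_zero (hperp i)] using hε
  filter_upwards [hend, hclose] with w' hw1 hw2 hlt
  have hw' : w' ≠ 0 := norm_pos_iff.1 ((norm_nonneg w).trans_lt hlt)
  let φ : ℝ → ℝ := fun s => ∑ i, √(α i ^ 2 + ‖perpPart w' (u i + s • k i)‖ ^ 2)
  have hφ : Continuous φ := by
    simp only [φ, perpPart_add_smul]
    fun_prop
  have hφ0 : φ 0 ≤ ‖w'‖ := by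
    refine le_trans ?_ hlt.le
    rw [hlen]
    refine Finset.sum_le_sum fun i _ => Real.sqrt_le_sqrt ?_
    have := norm_perpPart_le hw' (u i)
    rw [zero_smul, add_zero]
    gcongr
  obtain ⟨s, ⟨hs0, hs1⟩, hs⟩ := intermediate_value_Icc hη.le hφ.continuousOn ⟨hφ0, hw1.le⟩
  refine ⟨fun i => perpPart w' (u i + s • k i), fun i => ?_, ?_, fun i => inner_perpPart hw' _,
    hs.symm⟩
  · change ‖perpPart w' (u i + s • k i) - u i‖ < ε
    rw [perpPart_add_smul, add_sub_right_comm]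
    refine (norm_add_le _ _).trans_lt ?_
    have h1 : ‖s • perpPart w' (k i)‖ ≤ η * ‖k i‖ := by
      rw [norm_smul, Real.norm_of_nonneg hs0]
      exact mul_le_mul hs1 (norm_perpPart_le hw' _) (norm_nonneg _) hη.le
    linarith [hw2 i, hηk i]
  · rw [perpPart_sum, Finset.sum_add_distrib, ← Finset.smul_sum, hsum, hksum]
    simp [perpPart]

/-- A pair of polygons is generic if the first polygon is not a point and no edge `v j` is a
positive multiple of `w`. -/
def IsGenericPair (α : Fin n → ℝ) (S : Finset (Fin n)) (z : VectorTuple S) : Prop :=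
  (∃ i, z.1 i ≠ 0) ∧ ∀ j, ‖z.2.2‖ • z.2.1 j ≠ α j • z.2.2

theorem IsPolygonPair.w_ne_zero {α : Fin n → ℝ} (hα : ∀ i, 0 < α i) {S : Finset (Fin n)}
    (hne : S.Nonempty) {z : VectorTuple S} (hz : IsPolygonPair α S z) : z.2.2 ≠ 0 := by
  rw [← norm_pos_iff, hz.norm_w]
  obtain ⟨i, hi⟩ := hne
  exact Finset.sum_pos (fun i _ => Real.sqrt_pos.2 (by have := hα i; positivity))
    ⟨⟨i, hi⟩, Finset.mem_univ _⟩

theorem IsPolygonPair.norm_w_of_eq_zero {α : Fin n → ℝ} (hα : ∀ i, 0 < α i)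
    {S : Finset (Fin n)} {z : VectorTuple S} (hz : IsPolygonPair α S z) (hu : ∀ i, z.1 i = 0) :
    ‖z.2.2‖ = ∑ i ∈ S, α i := by
  rw [hz.norm_w, ← sum_subtype_mem S α]
  refine Finset.sum_congr rfl fun i _ => ?_
  rw [hu i, norm_zero, zero_pow two_ne_zero, add_zero, Real.sqrt_sq (hα i).le]

/-- A pair that is not generic has a second polygon that is not stretched straight: if `u = 0`, this
is where `S` being short enters. -/
theorem exists_not_stretched {α : Fin n → ℝ} (hα : ∀ i, 0 < α i) {S : Finset (Fin n)}
    (hne : S.Nonempty) (hshort : Short α S) {z : VectorTuple S} (hz : IsPolygonPair α S z)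
    (hg : ¬ IsGenericPair α S z) : ∃ j, ‖z.2.2‖ • z.2.1 j ≠ -(α j • z.2.2) := by
  by_contra! h
  have hw := hz.w_ne_zero hα hne
  apply hg
  refine ⟨?_, fun j hj => ?_⟩
  · by_contra! hu
    have h1 := hz.norm_w_of_eq_zero hα hu
    have h2 : ‖z.2.2‖ • ∑ j, z.2.1 j = -((∑ j : {j // j ∉ S}, α j) • z.2.2) := by
      rw [Finset.smul_sum, Finset.sum_smul, ← Finset.sum_neg_distrib]
      exact Finset.sum_congr rfl fun j _ => h j
    rw [eq_neg_of_add_eq_zero_right hz.sum_v, smul_neg, neg_inj, h1, sum_subtype_compl S α] at h2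
    have h3 := smul_left_injective ℝ hw h2
    have h4 : ∑ i ∈ S, α i < ∑ j ∈ Sᶜ, α j := hshort
    exact h4.ne h3
  · have h1 : α j • z.2.2 = 0 := by
      have h2 := hj.symm.trans (h j)
      have h3 : (2 : ℝ) • (α j • z.2.2) = 0 := by
        rw [two_smul]
        nth_rewrite 1 [h2]
        simp
      exact (smul_eq_zero.1 h3).resolve_left two_ne_zero
    exact (smul_ne_zero (hα j).ne' hw) h1

/-- Generic pairs of polygons are dense: stretch the second polygon slightly, and adjust the first
one to the longer `w`, which forces it to be nonzero. -/
theorem mem_closure_isGenericPair {α : Fin n → ℝ} (hα : ∀ i, 0 < α i) {S : Finset (Fin n)}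
    (hcard : 2 ≤ S.card) (hshort : Short α S) (z : PolygonPair α S) :
    z ∈ closure {z : PolygonPair α S | IsGenericPair α S z.1} := by
  have hne : S.Nonempty := Finset.card_pos.1 (by omega)
  by_cases hg : IsGenericPair α S z.1
  · exact subset_closure hg
  have hw := z.2.w_ne_zero hα hne
  obtain ⟨V, hV, hV0, hVn, hVs⟩ := exists_stretching (fun j : {j // j ∉ S} => hα j) z.2.norm_v hw
    (eq_neg_of_add_eq_zero_right z.2.sum_v) (exists_not_stretched hα hne hshort z.2 hg)
  have hW : Continuous fun t => -∑ j, V t j := by fun_prop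
  have hW0 : -∑ j, V 0 j = z.1.2.2 := by
    rw [hV0, eq_neg_of_add_eq_zero_right z.2.sum_v, neg_neg]
  have hlim : Tendsto (fun t => -∑ j, V t j) (𝓝[>] 0) (𝓝 z.1.2.2) := by
    rw [← hW0]
    exact (hW.tendsto 0).mono_left nhdsWithin_le_nhds
  have hlimV : ∀ j, Tendsto (fun t => V t j) (𝓝[>] 0) (𝓝 (z.1.2.1 j)) := fun j => by
    rw [← hV0]
    exact (((continuous_apply j).comp hV).tendsto 0).mono_left nhdsWithin_le_nhds
  rw [Metric.mem_closure_iff]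
  intro ε hε
  have hadj := hlim.eventually (exists_adjusted
    (by rw [Fintype.card_coe]; omega) hw z.2.sum_u z.2.perp z.2.norm_w hε)
  have hVε : ∀ᶠ t in 𝓝[>] (0 : ℝ), ∀ j, dist (V t j) (z.1.2.1 j) < ε :=
    eventually_all.2 fun j => (hlimV j).eventually (Metric.ball_mem_nhds _ hε)
  obtain ⟨t, hta, ⟨hts, htg⟩, htV, htW⟩ := (hadj.and (hVs.and (hVε.and
    (hlim.eventually (Metric.ball_mem_nhds _ hε))))).exists
  obtain ⟨u, hu, husum, huperp, hulen⟩ := hta hts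
  have hz' : IsPolygonPair α S (u, V t, -∑ j, V t j) :=
    ⟨neg_add_cancel _, husum, huperp, hVn t, hulen⟩
  refine ⟨⟨_, hz'⟩, ⟨?_, htg⟩, ?_⟩
  · by_contra! hu0
    have h1 := hz'.norm_w_of_eq_zero hα hu0
    have h2 : ∑ i ∈ S, α i ≤ ‖z.1.2.2‖ := by
      rw [z.2.norm_w, ← sum_subtype_mem S α]
      exact Finset.sum_le_sum fun i _ => Real.le_sqrt_of_sq_le (by nlinarith [sq_nonneg ‖z.1.1 i‖])
    exact (h2.trans_lt hts).ne h1.symm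
  · rw [dist_comm, Subtype.dist_eq, Prod.dist_eq, max_lt_iff, Prod.dist_eq, max_lt_iff,
      dist_pi_lt_iff hε, dist_pi_lt_iff hε]
    exact ⟨fun i => by rw [dist_eq_norm]; exact hu i, htV, htW⟩

/-! ### The core component -/

/-- Generic pairs of polygons belong to standard points that flow up to the fixed component; as they
are dense, the homeomorphism with the moduli space puts all standard points into the closure. -/
theorem range_subset_coreComponent {α : Fin n → ℝ} (hα : ∀ i, 0 < α i) {S : Finset (Fin n)}
    (hcard : 2 ≤ S.card) (hshort : Short α S) :
    Set.range (stdClass α S) ⊆ coreComponent α S := by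
  have hne : S.Nonempty := Finset.card_pos.1 (by omega)
  rintro _ ⟨x, rfl⟩
  obtain ⟨e, he⟩ := exists_homeomorph_range hα hne
  have hcont : Continuous fun z : PolygonPair α S => (e.symm (toModuli α S z)).1 :=
    continuous_subtype_val.comp
      (e.symm.continuous.comp (isOpenQuotientMap_toModuli α S).continuous)
  have hval : ∀ y : stdSet α S, ∀ z, polygonClass hα S y = toModuli α S z →
      (e.symm (toModuli α S z)).1 = stdClass α S y := fun y z h => by
    rw [← h, ← he, e.symm_apply_apply]
  rw [← hval x _ rfl]
  refine map_mem_closure (f := fun z : PolygonPair α S => (e.symm (toModuli α S z)).1) hcont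
    (mem_closure_isGenericPair hα hcard hshort _) fun z hz => ?_
  obtain ⟨y, R, hyR, hy⟩ := exists_polygonClass_eq hα hne z
  beta_reduce
  rw [hval y z hy]
  obtain ⟨⟨i, hi⟩, hz2⟩ := hz
  refine stdClass_mem_flowsUpTo hα hshort y i.2 (fun h0 => hi ?_) fun j hj h0 => ?_
  · have h1 : R (z.1.1 i) = vec (y.1.2 i 0 * y.1.1 i 1, 0) :=
      (congrFun (congrArg Prod.fst hyR) i).symm
    rw [h0, mul_zero, Prod.mk_zero_zero, map_zero] at h1
    exact R.map_eq_zero_iff.1 h1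
  · have h1 : R (z.1.2.1 ⟨j, hj⟩) =
        vec (y.1.2 j 0 * conj (y.1.2 j 1), (‖y.1.2 j 0‖ ^ 2 - ‖y.1.2 j 1‖ ^ 2) / 2) :=
      (congrFun (congrArg (fun a => a.2.1) hyR) ⟨j, hj⟩).symm
    have h2 : R z.1.2.2 = vec (0, (∑ i ∈ S, (‖y.1.2 i 0‖ ^ 2 + ‖y.1.1 i 1‖ ^ 2)) / 2) :=
      (congrArg (fun a => a.2.2) hyR).symm
    set ω := (∑ i ∈ S, (‖y.1.2 i 0‖ ^ 2 + ‖y.1.1 i 1‖ ^ 2)) / 2 with hω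
    have hω0 : 0 ≤ ω := div_nonneg (Finset.sum_nonneg fun i _ => by positivity) zero_le_two
    have h3 := (mem_stdSet_iff.1 y.2).2.2.2.2.2.1 j hj
    have h4 : R (z.1.2.1 ⟨j, hj⟩) = vec (0, α j) := by
      rw [h1, h0]
      rw [h0] at h3
      congr 2
      · simp
      · rw [norm_zero] at h3 ⊢
        linarith
    have h5 : ‖z.1.2.2‖ = ω := by
      rw [← R.norm_map, h2, ← sq_eq_sq₀ (norm_nonneg _) hω0, norm_sq_vec]
      simp
    apply hz2 ⟨j, hj⟩
    apply R.injective
    rw [map_smul, map_smul, h4, h2, h5, ← map_smul, ← map_smul]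
    simp [mul_comm]

/-- The core component consists of the classes of standard points. -/
theorem coreComponent_eq_range {α : Fin n → ℝ} (hα : ∀ i, 0 < α i) {S : Finset (Fin n)}
    (hcard : 2 ≤ S.card) (hshort : Short α S) :
    coreComponent α S = Set.range (stdClass α S) := by
  have hne : S.Nonempty := Finset.card_pos.1 (by omega)
  have := isCompact_iff_compactSpace.1 (isCompact_stdSet hα S)
  exact (closure_minimal (flowsUpTo_subset hα hne hshort)
    (isCompact_range (continuous_stdClass α S)).isClosed).antisymm
      (range_subset_coreComponent hα hcard hshort)

end

end Hyperpolygon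

theorem theorem5p2p4 (n : ℕ) (α : Fin n → ℝ) (hα : ∀ i, 0 < α i)
    (hgen : Hyperpolygon.Generic α) (S : Finset (Fin n)) (hS : Hyperpolygon.Short α S)
    (hcard : 2 ≤ S.card) :
    Nonempty (Hyperpolygon.coreComponent α S ≃ₜ Hyperpolygon.PolygonModuli α S) := by
  obtain ⟨e, -⟩ := Hyperpolygon.exists_homeomorph_range hα (S := S) (Finset.card_pos.1 (by omega))
  exact ⟨(Homeomorph.setCongr (Hyperpolygon.coreComponent_eq_range hα hcard hS)).trans e⟩
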